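/- Let $(W,S)$ be the Coxeter group of type $F_4$, $S=\{1,2,3,4\}$, with diagram $1 - 2 = 3 - 4$ and length function $\ell$. Write $w^x=x^{-1}wx$. For $J\subseteq S$ let $W_J=\langle J\rangle$, let $w_J$ be its longest element, $X_J=\{x\in W:\ell(sx)>\ell(x)\ \forall s\in J\}$, $X_J^\sharp=\{x\in X_J: J^x\subseteq S\}$, $[J]=\{J^x:x\in X_J^\sharp\}$ and $x_J=\sum_{x\in X_J}x^{-1}\in\mathbb{Q}W$. The descent algebra $\Sigma(W)$ is the linear span of the $x_J$, $J\subseteq S$, in $\mathbb{Q}W$. Let $e_L$ ($L\subseteq S$) be the elements determined by $x_K=\sum_{L\subseteq K}|X_K\cap X_L^\sharp|\,e_L$ for all $K\subseteq S$, and put $e_{[J]}=\sum_{L\in[J]}e_L$. For $L\subseteq S$ and distinct $s,t,\dots\in L$ call $(L;s,t,\dots)$ a path; its length is the number of the elements $s,t,\dots$. For $r\in S$ put $(L;s,t,\dots).r=(L^d;s^d,t^d,\dots)$ with $d=w_Lw_{L\cup\{r\}}$. The street $[L;s,t,\dots]$ is the orbit of the path under the free monoid on $S$ acting in this way, identified with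 the sum of its elements. Let $\delta(L;s,t,\dots)=(L\setminus\{s\};t,\dots)-(L\setminus\{s\};t,\dots).s$ for paths of positive length, and let $\Delta$ be the linear map with $\Delta(a)=\delta^{l}(a)$ on paths $a$ of length $l$, where the path of length $0$ at $L$ is identified with $e_L$. Let $Q$ be the quiver with the following $12$ vertices, given by name and class, $$\emptyset=[\emptyset],\; A_1'=[1],\; A_1''=[3],\; A_{11}=[13],\; A_2'=[12],\; A_2''=[34],\; B_2=[23],$$ $$A_{21}'=[124],\; A_{21}''=[134],\; B_3'=[123],\; B_3''=[234],\; F_4=[S],$$ and the following $4$ edges, labelled by streets: two edges $A_{11}\to F_4$, labelled $[S;23]$ and $[S;31]$; one edge $A_1'\to B_3'$, labelled $[123;31]$; and one edge $A_1''\to B_3''$, labelled $[234;23]$. Here subsets and sequences are written without braces and commas. Then $W$ is finite, its longest element is central, and the following hold. 1. The $12$ classes above are pairwise distinct and are all the classes $[J]$, $J\subseteq S$. The parabolic subgroup $W_J$ of each listed representative $J$ has the type given by the name of the vertex, where $A_{jk}$ stands for $A_j\times A_k$ and primes distinguish classes of the same type. 2. $\Sigma(W)$ is a subalgebra of $\mathbb{Q}W$,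 and there is an isomorphism of $\mathbb{Q}$-algebras from the path algebra $\mathbb{Q}Q$ (without relations; the product $ab$ of paths means first $a$, then $b$) onto $\Sigma(W)$ that maps each vertex $\lambda$ to $e_\lambda$ and each edge with label $\alpha$ to $\Delta(\alpha)$. 3. The left modules $P_\lambda=\Sigma(W)e_\lambda$ are projective, indecomposable and pairwise non-isomorphic, and every finitely generated projective indecomposable left $\Sigma(W)$-module is isomorphic to one of them. With $\mathrm{rad}^0P=P$ and $\mathrm{rad}^{i+1}P=J\,\mathrm{rad}^iP$, where $J$ is the Jacobson radical of $\Sigma(W)$, the modules $S_\lambda=P_\lambda/\mathrm{rad}\,P_\lambda$ are simple and pairwise non-isomorphic. The Loewy layers $\mathrm{rad}^iP_\lambda/\mathrm{rad}^{i+1}P_\lambda$, from the top down, are $S_{B_3'}$, $S_{A_1'}$ for $\lambda=B_3'$; $S_{B_3''}$, $S_{A_1''}$ for $\lambda=B_3''$; $S_{F_4}$, $(S_{A_{11}})^2$ for $\lambda=F_4$; and only $S_\lambda$ for each of the other nine vertices. All further layers are zero. 4. The Cartan matrix $(c_{\lambda\mu})$, where $c_{\lambda\mu}$ is the multiplicity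 of $S_\mu$ as a composition factor of $P_\lambda$, has $c_{\lambda\lambda}=1$ for all $\lambda$, $c_{F_4,A_{11}}=2$, $c_{B_3',A_1'}=c_{B_3'',A_1''}=1$, and all other entries $0$. -/

import Mathlib

/-! ## Path algebras of quivers -/

namespace PathAlg

/-- A path of a quiver together with its source and its target. -/
structure TotalPath (V : Type*) [Quiver V] where
  src : V
  tgt : V
  path : Quiver.Path src tgt

/-- The path algebra of a quiver: the free module on the set of all paths (including the
paths of length `0`). -/
def PathAlgebra (k V : Type*) [CommRing k] [Quiver V] := TotalPath V →₀ k

namespace PathAlgebra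

noncomputable section

variable (k : Type*) {V : Type*} [CommRing k] [Quiver V]

instance : AddCommGroup (PathAlgebra k V) := inferInstanceAs (AddCommGroup (TotalPath V →₀ k))

instance : Module k (PathAlgebra k V) := inferInstanceAs (Module k (TotalPath V →₀ k))

/-- The basis element given by a path. -/
def ofPath (p : TotalPath V) : PathAlgebra k V := Finsupp.single p (1 : k)

/-- The basis element given by a vertex, that is, by a path of length `0`. -/
def vertex (v : V) : PathAlgebra k V := ofPath k ⟨v, v, Quiver.Path.nil⟩

/-- The basis element given by an edge, that is, by a path of length `1`. -/
def arrow {v w : V} (a : v ⟶ w) : PathAlgebra k V := ofPath k ⟨v, w, a.toPath⟩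

open Classical in
/-- The product of two paths: first `p`, then `q` if this is a path, and `0` otherwise. -/
def mulPath (p q : TotalPath V) : PathAlgebra k V :=
  if h : q.src = p.tgt then ofPath k ⟨p.src, q.tgt, p.path.comp (q.path.cast h rfl)⟩ else 0

/-- The linear map with given values on the paths. -/
def lin {N : Type*} [AddCommGroup N] [Module k N] (f : TotalPath V → N) :
    PathAlgebra k V →ₗ[k] N :=
  Finsupp.lift N k (TotalPath V) f

theorem lin_ofPath {N : Type*} [AddCommGroup N] [Module k N] (f : TotalPath V → N)
    (p : TotalPath V) : lin k f (ofPath k p) = f p := by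
  change Finsupp.lift N k (TotalPath V) f (Finsupp.single p 1) = f p
  simp

/-- The bilinear extension of the product of paths. -/
def mulHom : PathAlgebra k V →ₗ[k] PathAlgebra k V →ₗ[k] PathAlgebra k V :=
  lin k fun p => lin k fun q => mulPath k p q

instance : Mul (PathAlgebra k V) := ⟨fun x y => mulHom k x y⟩

theorem mul_def (x y : PathAlgebra k V) : x * y = mulHom k x y := rfl

theorem ofPath_mul_ofPath (p q : TotalPath V) : ofPath k p * ofPath k q = mulPath k p q := by
  rw [mul_def, mulHom, lin_ofPath, lin_ofPath]

variable {k}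

theorem lhom_ext {M : Type*} [AddCommMonoid M] [Module k M] {f g : PathAlgebra k V →ₗ[k] M}
    (h : ∀ p, f (ofPath k p) = g (ofPath k p)) : f = g :=
  Finsupp.lhom_ext' fun p => LinearMap.ext_ring (h p)

theorem ofPath_mul_assoc (p q r : TotalPath V) :
    ofPath k p * ofPath k q * ofPath k r = ofPath k p * (ofPath k q * ofPath k r) := by
  obtain ⟨a, b, p⟩ := p
  obtain ⟨c, d, q⟩ := q
  obtain ⟨e, f, r⟩ := r
  have z : ∀ x : PathAlgebra k V, (0 : PathAlgebra k V) * x = 0 := fun x => by simp [mul_def]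
  have z' : ∀ x : PathAlgebra k V, x * (0 : PathAlgebra k V) = 0 := fun x => by simp [mul_def]
  rw [ofPath_mul_ofPath, ofPath_mul_ofPath]
  by_cases h : c = b
  · subst h
    by_cases h' : e = d
    · subst h'
      simp [mulPath, ofPath_mul_ofPath, Quiver.Path.comp_assoc]
    · simp [mulPath, ofPath_mul_ofPath, h', z']
  · by_cases h' : e = d
    · subst h'
      simp [mulPath, ofPath_mul_ofPath, h, z]
    · simp [mulPath, h, h', z, z']

variable [Fintype V]

instance : One (PathAlgebra k V) := ⟨∑ v : V, vertex k v⟩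

theorem one_def : (1 : PathAlgebra k V) = ∑ v : V, vertex k v := rfl

theorem one_mul_ofPath (p : TotalPath V) : 1 * ofPath k p = ofPath k p := by
  classical
  have h : ∀ v : V, mulHom k (vertex k v) (ofPath k p) = if v = p.src then ofPath k p else 0 := by
    intro v
    rw [← mul_def, vertex, ofPath_mul_ofPath]
    obtain ⟨a, b, p⟩ := p
    by_cases h : a = v
    · subst h
      simp [mulPath]
    · simp [mulPath, h, Ne.symm h]
  rw [mul_def, one_def, map_sum, LinearMap.sum_apply, Finset.sum_congr rfl fun v _ => h v]
  simp

theorem ofPath_mul_one (p : TotalPath V) : ofPath k p * 1 = ofPath k p := by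
  classical
  have h : ∀ v : V, mulHom k (ofPath k p) (vertex k v) = if v = p.tgt then ofPath k p else 0 := by
    intro v
    rw [← mul_def, vertex, ofPath_mul_ofPath]
    obtain ⟨a, b, p⟩ := p
    by_cases h : v = b
    · subst h
      simp [mulPath]
    · simp [mulPath, h]
  rw [mul_def, one_def, map_sum, Finset.sum_congr rfl fun v _ => h v]
  simp

instance : Ring (PathAlgebra k V) where
  __ := (inferInstance : AddCommGroup (PathAlgebra k V))
  __ := (inferInstance : Mul (PathAlgebra k V))
  __ := (inferInstance : One (PathAlgebra k V))
  left_distrib x y z := by simp only [mul_def, map_add]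
  right_distrib x y z := by simp only [mul_def, map_add, LinearMap.add_apply]
  zero_mul x := by simp only [mul_def, map_zero, LinearMap.zero_apply]
  mul_zero x := by simp only [mul_def, map_zero]
  mul_assoc x y z := by
    have h : (mulHom k (V := V)).compr₂ (mulHom k) =
        (LinearMap.llcomp k (PathAlgebra k V) (PathAlgebra k V) (PathAlgebra k V)).compl₂
          (mulHom k) ∘ₗ mulHom k := by
      refine lhom_ext fun p => lhom_ext fun q => lhom_ext fun r => ?_
      exact ofPath_mul_assoc p q r
    exact congrArg (fun f => f x y z) h
  one_mul x := by
    have h : mulHom k (1 : PathAlgebra k V) = LinearMap.id := lhom_ext one_mul_ofPath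
    exact congrArg (fun f => f x) h
  mul_one x := by
    have h : (mulHom k).flip (1 : PathAlgebra k V) = LinearMap.id := lhom_ext ofPath_mul_one
    exact congrArg (fun f => f x) h

instance : Algebra k (PathAlgebra k V) :=
  Algebra.ofModule
    (fun r x y => by simp only [mul_def, map_smul, LinearMap.smul_apply])
    (fun r x y => by simp only [mul_def, map_smul])

end

end PathAlgebra

end PathAlg

/-! ## The descent algebra of a Coxeter group -/

namespace Descent

noncomputable section

open CoxeterSystem

variable {B : Type*} {M : CoxeterMatrix B} {W : Type*} [Group W] (cs : CoxeterSystem M W)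

/-- The parabolic subgroup `W_J` generated by `J`. -/
def parabolic (J : Finset B) : Subgroup W := Subgroup.closure (cs.simple '' J)

/-- The longest element `w_J` of `W_J` (for finite `W_J` it exists and is unique). -/
def longest (J : Finset B) : W :=
  Classical.epsilon fun w =>
    w ∈ parabolic cs J ∧ ∀ u ∈ parabolic cs J, cs.length u ≤ cs.length w

/-- The set `X_J` of minimal length right coset representatives of `W_J` in `W`. -/
def X (J : Finset B) : Set W :=
  {x | ∀ s ∈ J, cs.length x < cs.length (cs.simple s * x)}

/-- The element `x_J` of the group algebra, the sum of the inverses of the elements of `X_J`. -/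
def xElt (J : Finset B) : MonoidAlgebra ℚ W := ∑ᶠ x ∈ X cs J, MonoidAlgebra.of ℚ W x⁻¹

/-- The descent algebra as a subspace of the group algebra. -/
def descentSpace : Submodule ℚ (MonoidAlgebra ℚ W) := Submodule.span ℚ (Set.range (xElt cs))

/-- The subset `X_J^♯` of those `x` in `X_J` for which `J^x = x⁻¹ J x` is a subset of `S`. -/
def XSharp (J : Finset B) : Set W :=
  {x | x ∈ X cs J ∧ ∀ s ∈ J, ∃ t, cs.simple t = x⁻¹ * cs.simple s * x}

/-- The index of the simple reflection `s^x = x⁻¹ s x`. It is only used for `x` and `s`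
such that `s^x` is a simple reflection. -/
def conjIndex (x : W) (s : B) : B :=
  @Classical.epsilon B ⟨s⟩ fun t => cs.simple t = x⁻¹ * cs.simple s * x

variable [DecidableEq B]

/-- The class `[J]` of `J`, consisting of the subsets `J^x` of `S` with `x` in `X_J^♯`. -/
def cls (J : Finset B) : Set (Finset B) :=
  {K | ∃ x ∈ XSharp cs J, K = J.image (conjIndex cs x)}

/-- The matrix with the entries `m_{KL} = |X_K ∩ X_L^♯|` if `L ⊆ K` and `0` otherwise. -/
def mMat : Matrix (Finset B) (Finset B) ℚ :=
  Matrix.of fun K L => if L ⊆ K then (Nat.card ↥(X cs K ∩ XSharp cs L) : ℚ) else 0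

variable [Fintype B]

/-- The basis element `e_L`, determined by `x_K = ∑ L, m_{KL} e_L`. -/
def eElt (L : Finset B) : MonoidAlgebra ℚ W := ∑ K, (mMat cs)⁻¹ L K • xElt cs K

open Classical in
/-- The idempotent `e_λ` of the class `λ = [J]`, the sum of the `e_L` with `L` in `λ`. -/
def eClass (J : Finset B) : MonoidAlgebra ℚ W := ∑ L with L ∈ cls cs J, eElt cs L

/-- A path `(L; s, t, …)` from `L` to `L \ {s}` to `L \ {s, t}` and so on, where `s, t, …` are
distinct elements of `L`. -/
abbrev SPath (B : Type*) := Finset B × List B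

/-- The action of `r` on paths, `(L; s, t, …).r = (L^d; s^d, t^d, …)` with
`d = w_L w_{L ∪ {r}}`. -/
def act (p : SPath B) (r : B) : SPath B :=
  let d := longest cs p.1 * longest cs (insert r p.1)
  (p.1.image (conjIndex cs d), p.2.map (conjIndex cs d))

/-- The street `[L; s, t, …]`: the orbit of a path under the free monoid on `S`. -/
def street (p : SPath B) : Set (SPath B) := {q | ∃ rs : List B, q = rs.foldl (act cs) p}

/-- The map `δ` with `δ(L; s, t, …) = (L_s; t, …) - (L_s; t, …).s` on paths of positive length,
where `L_s = L \ {s}`. -/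
def delta : (SPath B →₀ ℚ) →ₗ[ℚ] (SPath B →₀ ℚ) :=
  Finsupp.lift (SPath B →₀ ℚ) ℚ (SPath B) fun p =>
    match p with
    | (_, []) => 0
    | (L, s :: ts) =>
      Finsupp.single (L.erase s, ts) 1 - Finsupp.single (act cs (L.erase s, ts) s) 1

/-- The linear map that sends a path `(L; ∅)` of length `0` to `e_L`. -/
def zeroPathMap : (SPath B →₀ ℚ) →ₗ[ℚ] MonoidAlgebra ℚ W :=
  Finsupp.lift (MonoidAlgebra ℚ W) ℚ (SPath B) fun p => eElt cs p.1

/-- `Δ(a) = δ^l(a)` for a path `a` of length `l`, with `(L; ∅)` identified with `e_L`. -/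
def Delta (p : SPath B) : MonoidAlgebra ℚ W :=
  zeroPathMap cs ((delta cs ^ p.2.length) (Finsupp.single p 1))

/-- The image under `Δ` of the street of `p`, regarded as the sum of its elements. -/
def DeltaStreet (p : SPath B) : MonoidAlgebra ℚ W := ∑ᶠ q ∈ street cs p, Delta cs q

end

end Descent

/-! ## Types of parabolic subgroups -/

namespace CoxType

/-- The Coxeter matrix of a direct product: generators of different factors commute. -/
def prod {B B' : Type*} (M : CoxeterMatrix B) (N : CoxeterMatrix B') : CoxeterMatrix (B ⊕ B') where
  M := Matrix.fromBlocks M.M (Matrix.of fun _ _ => 2) (Matrix.of fun _ _ => 2) N.M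
  isSymm := Matrix.IsSymm.fromBlocks M.isSymm rfl N.isSymm
  diagonal := by rintro (i | i) <;> simp
  off_diagonal := by
    rintro (i | i) (j | j) h
    · simpa using M.off_diagonal i j (by simpa using h)
    · simp
    · simp
    · simpa using N.off_diagonal i j (by simpa using h)

/-- The parabolic subgroup generated by `J` has the isomorphism type given by `N`: the
Coxeter matrix restricted to `J` is `N` up to a renaming of the generators. -/
def HasType {B ι : Type*} (M : CoxeterMatrix B) (J : Finset B) (N : CoxeterMatrix ι) : Prop :=
  ∃ e : ι ≃ J, ∀ i j, M (e i) (e j) = N i j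

end CoxType

/-! ## Modules -/

namespace ModRep

variable (A : Type*) [Ring A]

/-- A nonzero module that is not a direct sum of two nonzero submodules. -/
def IsIndecomposable (P : Type*) [AddCommGroup P] [Module A P] : Prop :=
  Nontrivial P ∧ ∀ N N' : Submodule A P, IsCompl N N' → N = ⊥ ∨ N' = ⊥

/-- The radical series of a module: `rad^0 P = P` and `rad^(i+1) P = J (rad^i P)`, where `J` is
the Jacobson radical of the ring. -/
def radSeries (P : Type*) [AddCommGroup P] [Module A P] : ℕ → Submodule A P
  | 0 => ⊤
  | i + 1 => Ring.jacobson A • radSeries P i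

/-- The `i`-th Loewy layer `rad^i P / rad^(i+1) P`. -/
abbrev LoewyLayer (P : Type*) [AddCommGroup P] [Module A P] (i : ℕ) : Type _ :=
  ↥(radSeries A P i) ⧸ (radSeries A P (i + 1)).submoduleOf (radSeries A P i)

/-- The top `P / rad P` of a module. -/
abbrev Top (P : Type*) [AddCommGroup P] [Module A P] : Type _ := P ⧸ radSeries A P 1

/-- The module `P` has a composition series in which exactly `c` factors are isomorphic
to `T`. -/
def HasCompMultiplicity (P T : Type*) [AddCommGroup P] [Module A P] [AddCommGroup T] [Module A T]
    (c : ℕ) : Prop :=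
  ∃ s : CompositionSeries (Submodule A P), s.head = ⊥ ∧ s.last = ⊤ ∧
    Nat.card {i : Fin s.length // Nonempty
      ((↥(s i.succ) ⧸ (s i.castSucc).submoduleOf (s i.succ)) ≃ₗ[A] T)} = c

variable {A}

/-- The left module `A ε`. -/
abbrev LeftIdeal (ε : A) : Type _ := ↥(Ideal.span {ε} : Ideal A)

end ModRep

/-! ## The data of type `F₄`

The generator with label `i` in `1 - 2 = 3 - 4` is the element `i - 1` of `Fin 4`. -/

namespace TypeF4

/-- The vertices of the quiver. -/
inductive Vertex : Type
  | empty | A1' | A1'' | A11 | A2' | A2'' | B2 | A21' | A21'' | B3' | B3'' | F4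
  deriving DecidableEq

instance : Fintype Vertex where
  elems := {.empty, .A1', .A1'', .A11, .A2', .A2'', .B2, .A21', .A21'', .B3', .B3'', .F4}
  complete v := by cases v <;> decide

/-- The edges of the quiver. -/
inductive Edge : Vertex → Vertex → Type
  | a₁ : Edge .A11 .F4
  | a₂ : Edge .A11 .F4
  | b' : Edge .A1' .B3'
  | b'' : Edge .A1'' .B3''

instance : Quiver Vertex := ⟨Edge⟩

/-- A representative of the class of subsets of the generators that labels a vertex. -/
def rep : Vertex → Finset (Fin 4)
  | .empty => ∅
  | .A1' => {0}
  | .A1'' => {2}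
  | .A11 => {0, 2}
  | .A2' => {0, 1}
  | .A2'' => {2, 3}
  | .B2 => {1, 2}
  | .A21' => {0, 1, 3}
  | .A21'' => {0, 2, 3}
  | .B3' => {0, 1, 2}
  | .B3'' => {1, 2, 3}
  | .F4 => Finset.univ

/-- The isomorphism type of the parabolic subgroups that belong to a vertex. -/
def type : Vertex → (ι : Type) × CoxeterMatrix ι
  | .empty => ⟨_, CoxeterMatrix.A 0⟩
  | .A1' | .A1'' => ⟨_, CoxeterMatrix.A 1⟩
  | .A11 => ⟨_, CoxType.prod (CoxeterMatrix.A 1) (CoxeterMatrix.A 1)⟩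
  | .A2' | .A2'' => ⟨_, CoxeterMatrix.A 2⟩
  | .B2 => ⟨_, CoxeterMatrix.B 2⟩
  | .A21' | .A21'' => ⟨_, CoxType.prod (CoxeterMatrix.A 2) (CoxeterMatrix.A 1)⟩
  | .B3' | .B3'' => ⟨_, CoxeterMatrix.B 3⟩
  | .F4 => ⟨_, CoxeterMatrix.F₄⟩

/-- A representative of the street that labels an edge. -/
def edgePath : {v w : Vertex} → Edge v w → Descent.SPath (Fin 4)
  | _, _, .a₁ => (Finset.univ, [1, 2])
  | _, _, .a₂ => (Finset.univ, [2, 0])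
  | _, _, .b' => ({0, 1, 2}, [2, 0])
  | _, _, .b'' => ({1, 2, 3}, [1, 2])

/-- The Loewy layers of the projective indecomposable modules, from the top. -/
def loewy : Vertex → List (Multiset Vertex)
  | .B3' => [{.B3'}, {.A1'}]
  | .B3'' => [{.B3''}, {.A1''}]
  | .F4 => [{.F4}, {.A11, .A11}]
  | v => [{v}]

/-- The Cartan matrix: rows are labelled by projective indecomposable modules, columns by
simple modules. -/
def cartan : Vertex → Vertex → ℕ
  | .F4, .A11 => 2
  | .B3', .A1' => 1
  | .B3'', .A1'' => 1
  | v, w => if v = w then 1 else 0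

end TypeF4

/-! The proof turns statements about the abstract group into integer arithmetic with weights, and
then argues structurally in a 16-dimensional algebra whose radical has square zero.

$W$ acts on integral weights, and a simple reflection $s$ shortens $w$ from the left exactly when
the $s$-coordinate of $w\rho$ is negative (`length_simple_mul_lt_iff`, from `le_coord_weightHom`).
Hence $\rho$ has trivial stabiliser, equality of words can be tested on $\rho$ (`wordProd_eq_iff`),
and descent sets are read off from signs. A chain of parabolic subgroups gives $2\cdot 3\cdot 8\cdot
24=1152$ words, one for each element of $W$.

The elements $x_J$, and so everything in $\Sigma(W)$, have coefficients that depend only on the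
right descent set. Atkinson's involution shows that a product of two such elements is again of this
kind (`sum_eq_sum_longest`), so a product is determined by its coefficients at the 16 longest
elements $w_K$. The $e_L$ are found by solving their triangular system with an explicit table
(`eElt_maskSet`). The classes $[J]$ are separated by a sign character and by the orders of products
of reflections (`cls_maskSet`). The streets that label the edges consist of one path each, so their
images under $\Delta$ are explicit combinations of the $e_L$ (`DeltaStreet_arrow`).

No edge of $Q$ ends where another begins, so $Q$ has exactly $12+4=16$ paths. A finite computation
shows that their images multiply like the paths (`pathElt_mul`). They are linearly independent, and
$\Sigma(W)$ is spanned by $2^4=16$ elements, so they form a basis (`span_pathElt`).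

The module theory uses only this multiplication table (`PathBasis`). The coordinate at each vertex
is a character, the Jacobson radical $J$ is the common kernel of the characters, and $J^2=0$. The
module $P_v$ is spanned by the paths that end at $v$ and has a unique maximal submodule; the arrows
into $v$ span its radical and give the second Loewy layer. A projective indecomposable module maps
nontrivially to some $S_v$, and lifting this map identifies the module with $P_v$
(`exists_equiv_proj`). -/

namespace TypeF4

/-! ## The reflection representation in weight coordinates -/

/-- An integral weight, given by its coordinates with respect to the fundamental weights. -/
structure Weight where
  a : ℤ
  b : ℤ
  c : ℤ
  d : ℤ
  deriving DecidableEq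

namespace Weight

/-- The coordinates of a weight. -/
def coord (v : Weight) : Fin 4 → ℤ := ![v.a, v.b, v.c, v.d]

/-- The action of a simple reflection. -/
def act : Fin 4 → Weight → Weight
  | 0, ⟨a, b, c, d⟩ => ⟨-a, a + b, c, d⟩
  | 1, ⟨a, b, c, d⟩ => ⟨a + b, -b, b + c, d⟩
  | 2, ⟨a, b, c, d⟩ => ⟨a, b + 2 * c, -c, c + d⟩
  | 3, ⟨a, b, c, d⟩ => ⟨a, b, c + d, -d⟩

/-- The action of a word in the simple reflections. -/
def acts (l : List (Fin 4)) (v : Weight) : Weight := l.foldr act v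

/-- The sum of the fundamental weights. -/
def rho : Weight := ⟨1, 1, 1, 1⟩

theorem coord_act_self (i : Fin 4) (v : Weight) : (act i v).coord i = -v.coord i := by
  fin_cases i <;> rfl

theorem isLiftable_act : CoxeterMatrix.F₄.IsLiftable (G := Function.End Weight) act := by
  have pow_apply : ∀ (i j : Fin 4) (n : ℕ) (v : Weight),
      (((show Function.End Weight from act i) * (show Function.End Weight from act j)) ^ n) v =
        (fun v => act i (act j v))^[n] v := by
    intro i j n
    induction n with
    | zero => intro v; rfl
    | succ n ih => intro v; rw [pow_succ, Function.iterate_succ_apply, ← ih]; rfl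
  intro i j
  funext v
  refine (pow_apply i j _ v).trans ?_
  obtain ⟨a, b, c, d⟩ := v
  fin_cases i <;> fin_cases j <;>
    simp [CoxeterMatrix.F₄, act, Function.End.one_def] <;> ring_nf <;> simp

/-- Here and in the next two lemmas the words applied to `x` are the nontrivial elements of the
dihedral group generated by `r` and `s` that `s` lengthens from the left. They turn the
`s`-coordinate into a nonzero combination of the `r`- and `s`-coordinates of `x` with nonnegative
integer coefficients. -/
theorem le_coord_of_two {r s : Fin 4} (h : CoxeterMatrix.F₄ r s = 2) {c : ℤ} {x : Weight}
    (hs : c ≤ x.coord s) : c ≤ (act r x).coord s := by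
  obtain ⟨x0, x1, x2, x3⟩ := x
  fin_cases r <;> fin_cases s <;> first | exact absurd h (by decide) | simpa [act, coord] using hs

theorem le_coord_of_three {r s : Fin 4} (h : CoxeterMatrix.F₄ r s = 3) {c : ℤ} {x : Weight}
    (hc : 0 ≤ c) (hr : c ≤ x.coord r) (hs : c ≤ x.coord s) :
    c ≤ (act r x).coord s ∧ c ≤ (act r (act s x)).coord s := by
  obtain ⟨x0, x1, x2, x3⟩ := x
  fin_cases r <;> fin_cases s <;> first
    | exact absurd h (by decide)
    | (simp [act, coord] at hr hs ⊢; omega)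

theorem le_coord_of_four {r s : Fin 4} (h : CoxeterMatrix.F₄ r s = 4) {c : ℤ} {x : Weight}
    (hc : 0 ≤ c) (hr : c ≤ x.coord r) (hs : c ≤ x.coord s) :
    c ≤ (act r x).coord s ∧ c ≤ (act r (act s x)).coord s ∧
      c ≤ (act r (act s (act r x))).coord s := by
  obtain ⟨x0, x1, x2, x3⟩ := x
  fin_cases r <;> fin_cases s <;> first
    | exact absurd h (by decide)
    | (simp [act, coord] at hr hs ⊢; omega)

end Weight

open Weight

theorem braid_three {G : Type*} [Group G] {a b : G} (ha : a⁻¹ = a) (hb : b⁻¹ = b)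
    (h : (a * b) ^ 3 = 1) : b * a * b = a * b * a := by
  have h' : (a * b * a) * (b * a * b) = 1 := by
    rw [← h]
    simp only [pow_succ, pow_zero, one_mul, mul_assoc]
  simpa [ha, hb, mul_assoc] using eq_inv_of_mul_eq_one_right h'

theorem braid_four {G : Type*} [Group G] {a b : G} (ha : a⁻¹ = a) (hb : b⁻¹ = b)
    (h : (a * b) ^ 4 = 1) : b * a * b * a = a * b * a * b := by
  have h' : (a * b * a * b) * (a * b * a * b) = 1 := by
    rw [← h]
    simp only [pow_succ, pow_zero, one_mul, mul_assoc]
  simpa [ha, hb, mul_assoc] using (eq_inv_of_mul_eq_one_right h').symm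

/-! ### Length and descents in terms of signs of coordinates. -/

section Coxeter

variable {W : Type*} [Group W] (cs : CoxeterSystem CoxeterMatrix.F₄ W)

/-- The action of the Coxeter group on weights. -/
def weightHom : W →* Function.End Weight := cs.lift ⟨act, isLiftable_act⟩

theorem weightHom_simple_mul (i : Fin 4) (w : W) (v : Weight) :
    weightHom cs (cs.simple i * w) v = act i (weightHom cs w v) := by
  rw [map_mul, weightHom, cs.lift_apply_simple isLiftable_act]
  rfl

theorem weightHom_wordProd (l : List (Fin 4)) (v : Weight) :
    weightHom cs (cs.wordProd l) v = acts l v := by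
  induction l with
  | nil => simp [acts, Function.End.one_def]
  | cons i l ih => rw [cs.wordProd_cons, weightHom_simple_mul, ih]; rfl

theorem length_simple_mul_of_not_lt {w : W} {i : Fin 4}
    (h : ¬ cs.length w < cs.length (cs.simple i * w)) :
    cs.length (cs.simple i * w) + 1 = cs.length w := by
  rcases cs.length_simple_mul w i with h' | h' <;> omega

/-- Peel off from `w` a left factor alternating in a left descent `r` and in `s` until the remaining
`u` is lengthened by both. Induction bounds the `r`- and `s`-coordinates of the image of `v` under
`u`, and the rank-two lemmas treat the factor. The factor cannot be the longest element of the
dihedral group, for then the braid relation would make `s` shorten `w`. The case `c = 1` with `rho`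
gives strict signs; `c = 0` serves for weights with stabilisers. -/
theorem le_coord_weightHom {c : ℤ} (hc : 0 ≤ c) {v : Weight} (hv : ∀ i, c ≤ v.coord i) (w : W)
    (s : Fin 4) (h : cs.length w < cs.length (cs.simple s * w)) :
    c ≤ (weightHom cs w v).coord s := by
  induction hn : cs.length w using Nat.strong_induction_on generalizing w s with
  | _ n ih =>
  subst hn
  by_cases h1 : w = 1
  · subst h1
    simpa [Function.End.one_def] using hv s
  obtain ⟨r, hr⟩ := cs.exists_leftDescent_of_ne_one h1
  rw [CoxeterSystem.IsLeftDescent] at hr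
  have descend : ∀ (x : W) (i : Fin 4), ¬ cs.length x < cs.length (cs.simple i * x) →
      ∃ y, x = cs.simple i * y ∧ cs.length y + 1 = cs.length x ∧
        cs.length y < cs.length (cs.simple i * y) := by
    intro x i hx
    have := length_simple_mul_of_not_lt cs hx
    exact ⟨cs.simple i * x, by simp, this, by simpa using by omega⟩
  have le2 : ∀ (i : Fin 4) (x : W), cs.length (cs.simple i * x) ≤ cs.length x + 1 := by
    intro i x
    rcases cs.length_simple_mul x i with h' | h' <;> omega
  obtain ⟨u, rfl, hu, hru⟩ := descend w r (by omega)
  have hcases : r = s ∨ CoxeterMatrix.F₄ r s = 2 ∨ CoxeterMatrix.F₄ r s = 3 ∨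
      CoxeterMatrix.F₄ r s = 4 := by
    clear * -
    revert r s
    decide
  have hpow := cs.simple_mul_simple_pow r s
  rcases hcases with rfl | hm | hm | hm
  · exact absurd h (by omega)
  · rw [hm] at hpow
    have braid : cs.simple s * cs.simple r = cs.simple r * cs.simple s := by
      rw [pow_two, mul_eq_one_iff_eq_inv] at hpow
      simpa using hpow.symm
    rw [weightHom_simple_mul]
    refine le_coord_of_two hm ?_
    by_cases hsu : cs.length u < cs.length (cs.simple s * u)
    · exact ih _ (by omega) u s hsu rfl
    · obtain ⟨u, rfl, hu2, -⟩ := descend u s hsu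
      have e : cs.simple s * (cs.simple r * (cs.simple s * u)) = cs.simple r * u := by
        rw [← mul_assoc, braid, mul_assoc, cs.simple_mul_simple_cancel_left]
      rw [e] at h
      have := le2 r u
      omega
  · rw [hm] at hpow
    have braid : cs.simple s * cs.simple r * cs.simple s =
        cs.simple r * cs.simple s * cs.simple r :=
      braid_three (cs.inv_simple r) (cs.inv_simple s) hpow
    by_cases hsu : cs.length u < cs.length (cs.simple s * u)
    · rw [weightHom_simple_mul]
      exact (le_coord_of_three hm hc (ih _ (by omega) u r hru rfl)
        (ih _ (by omega) u s hsu rfl)).1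
    obtain ⟨u, rfl, hu2, hsu⟩ := descend u s hsu
    by_cases hru2 : cs.length u < cs.length (cs.simple r * u)
    · rw [weightHom_simple_mul, weightHom_simple_mul]
      exact (le_coord_of_three hm hc (ih _ (by omega) u r hru2 rfl)
        (ih _ (by omega) u s hsu rfl)).2
    obtain ⟨u, rfl, hu3, -⟩ := descend u r hru2
    have e : cs.simple s * (cs.simple r * (cs.simple s * (cs.simple r * u))) =
        cs.simple r * (cs.simple s * u) := by
      have := congrArg (fun x => cs.simple s * x * u) braid
      simp only [mul_assoc, cs.simple_mul_simple_cancel_left] at this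
      exact this.symm
    rw [e] at h
    have := le2 r (cs.simple s * u)
    have := le2 s u
    omega
  · rw [hm] at hpow
    have braid : cs.simple s * cs.simple r * cs.simple s * cs.simple r =
        cs.simple r * cs.simple s * cs.simple r * cs.simple s :=
      braid_four (cs.inv_simple r) (cs.inv_simple s) hpow
    by_cases hsu : cs.length u < cs.length (cs.simple s * u)
    · rw [weightHom_simple_mul]
      exact (le_coord_of_four hm hc (ih _ (by omega) u r hru rfl)
        (ih _ (by omega) u s hsu rfl)).1
    obtain ⟨u, rfl, hu2, hsu⟩ := descend u s hsu
    by_cases hru2 : cs.length u < cs.length (cs.simple r * u)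
    · rw [weightHom_simple_mul, weightHom_simple_mul]
      exact (le_coord_of_four hm hc (ih _ (by omega) u r hru2 rfl)
        (ih _ (by omega) u s hsu rfl)).2.1
    obtain ⟨u, rfl, hu3, hru2⟩ := descend u r hru2
    by_cases hsu2 : cs.length u < cs.length (cs.simple s * u)
    · rw [weightHom_simple_mul, weightHom_simple_mul, weightHom_simple_mul]
      exact (le_coord_of_four hm hc (ih _ (by omega) u r hru2 rfl)
        (ih _ (by omega) u s hsu2 rfl)).2.2
    obtain ⟨u, rfl, hu4, -⟩ := descend u s hsu2
    have e : cs.simple s * (cs.simple r * (cs.simple s * (cs.simple r * (cs.simple s * u)))) =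
        cs.simple r * (cs.simple s * (cs.simple r * u)) := by
      have := congrArg (fun x => cs.simple s * x * u) braid
      simp only [mul_assoc, cs.simple_mul_simple_cancel_left] at this
      exact this.symm
    rw [e] at h
    have := le2 r (cs.simple s * (cs.simple r * u))
    have := le2 s (cs.simple r * u)
    have := le2 r u
    omega

theorem coord_weightHom_nonpos {v : Weight} (hv : ∀ i, 0 ≤ v.coord i) (w : W) (s : Fin 4)
    (h : cs.length (cs.simple s * w) < cs.length w) : (weightHom cs w v).coord s ≤ 0 := by
  have := le_coord_weightHom cs le_rfl hv (cs.simple s * w) s (by simpa using h)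
  rw [weightHom_simple_mul, coord_act_self] at this
  omega

theorem one_le_coord_rho (i : Fin 4) : 1 ≤ rho.coord i := by
  fin_cases i <;> simp [rho, coord]

theorem length_simple_mul_lt_iff (w : W) (s : Fin 4) :
    cs.length (cs.simple s * w) < cs.length w ↔ (weightHom cs w rho).coord s < 0 := by
  constructor
  · intro h
    have := le_coord_weightHom cs zero_le_one one_le_coord_rho (cs.simple s * w) s
      (by simpa using h)
    rw [weightHom_simple_mul, coord_act_self] at this
    omega
  · intro h
    by_contra h'
    have := le_coord_weightHom cs zero_le_one one_le_coord_rho w s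
      (by have := cs.length_simple_mul_ne w s; omega)
    omega

theorem lt_length_simple_mul_iff (w : W) (s : Fin 4) :
    cs.length w < cs.length (cs.simple s * w) ↔ ¬ (weightHom cs w rho).coord s < 0 := by
  rw [← length_simple_mul_lt_iff]
  have := cs.length_simple_mul_ne w s
  omega

/-- A nontrivial element has a left descent and so makes some coordinate of `rho` negative; hence
`rho` has trivial stabiliser. -/
theorem eq_of_weightHom_rho_eq {w w' : W} (h : weightHom cs w rho = weightHom cs w' rho) :
    w = w' := by
  have key : weightHom cs (w⁻¹ * w') rho = rho := by
    rw [map_mul]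
    change weightHom cs w⁻¹ (weightHom cs w' rho) = rho
    rw [← h]
    change (weightHom cs w⁻¹ * weightHom cs w) rho = rho
    rw [← map_mul, inv_mul_cancel, map_one]
    rfl
  by_contra hne
  obtain ⟨r, hr⟩ := cs.exists_leftDescent_of_ne_one (w := w⁻¹ * w')
    (fun h => hne (inv_mul_eq_one.mp h))
  rw [CoxeterSystem.IsLeftDescent, length_simple_mul_lt_iff, key] at hr
  have := one_le_coord_rho r
  omega

/-- This solves the word problem by integer arithmetic, so that `decide` can settle identities in
the abstract group. -/
theorem wordProd_eq_iff {l l' : List (Fin 4)} :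
    cs.wordProd l = cs.wordProd l' ↔ acts l rho = acts l' rho := by
  rw [← weightHom_wordProd cs, ← weightHom_wordProd cs]
  exact ⟨fun h => by rw [h], fun h => eq_of_weightHom_rho_eq cs h⟩

end Coxeter

end TypeF4

namespace TypeF4

open Weight

/-! ## Enumeration of the Coxeter group -/

/-- All concatenations of a word from `Y` and a word from `L`. -/
def appendWords (Y L : List (List (Fin 4))) : List (List (Fin 4)) :=
  Y.flatMap fun x => L.map fun l => x ++ l

/-- Minimal coset representatives of the trivial group in `⟨0⟩`. -/
def reps₀ : List (List (Fin 4)) := [[], [0]]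

/-- Minimal coset representatives of `⟨0⟩` in `⟨0, 1⟩`. -/
def reps₁ : List (List (Fin 4)) := [[], [1], [0, 1]]

/-- Minimal coset representatives of `⟨0, 1⟩` in `⟨0, 1, 2⟩`. -/
def reps₂ : List (List (Fin 4)) :=
  [[], [2], [1, 2], [0, 1, 2], [2, 1, 2], [2, 0, 1, 2], [1, 2, 0, 1, 2], [2, 1, 2, 0, 1, 2]]

/-- Minimal coset representatives of `⟨0, 1, 2⟩` in the whole group. -/
def reps₃ : List (List (Fin 4)) :=
  [[], [3], [2, 3], [1, 2, 3], [0, 1, 2, 3], [2, 1, 2, 3], [2, 0, 1, 2, 3], [3, 2, 1, 2, 3],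
    [1, 2, 0, 1, 2, 3], [3, 2, 0, 1, 2, 3], [2, 1, 2, 0, 1, 2, 3], [3, 1, 2, 0, 1, 2, 3],
    [3, 2, 1, 2, 0, 1, 2, 3], [2, 3, 1, 2, 0, 1, 2, 3], [2, 3, 2, 1, 2, 0, 1, 2, 3],
    [1, 2, 3, 1, 2, 0, 1, 2, 3], [1, 2, 3, 2, 1, 2, 0, 1, 2, 3], [0, 1, 2, 3, 1, 2, 0, 1, 2, 3],
    [0, 1, 2, 3, 2, 1, 2, 0, 1, 2, 3], [2, 1, 2, 3, 2, 1, 2, 0, 1, 2, 3],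
    [2, 0, 1, 2, 3, 2, 1, 2, 0, 1, 2, 3], [1, 2, 0, 1, 2, 3, 2, 1, 2, 0, 1, 2, 3],
    [2, 1, 2, 0, 1, 2, 3, 2, 1, 2, 0, 1, 2, 3], [3, 2, 1, 2, 0, 1, 2, 3, 2, 1, 2, 0, 1, 2, 3]]

/-- Reduced words for the elements of `⟨0, 1⟩`. -/
def words₁ : List (List (Fin 4)) := appendWords reps₁ (appendWords reps₀ [[]])

/-- Reduced words for the elements of `⟨0, 1, 2⟩`. -/
def words₂ : List (List (Fin 4)) := appendWords reps₂ words₁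

/-- Reduced words for all elements of the group. -/
def words : List (List (Fin 4)) := appendWords reps₃ words₂

theorem mem_appendWords {Y L : List (List (Fin 4))} {m : List (Fin 4)} :
    m ∈ appendWords Y L ↔ ∃ x ∈ Y, ∃ l ∈ L, x ++ l = m := by
  simp [appendWords]

namespace Weight

theorem acts_append (l l' : List (Fin 4)) (v : Weight) :
    acts (l ++ l') v = acts l (acts l' v) := List.foldr_append

/-- The fundamental weights. -/
def fundamental (j : Fin 4) : Weight :=
  ⟨if j = 0 then 1 else 0, if j = 1 then 1 else 0, if j = 2 then 1 else 0, if j = 3 then 1 else 0⟩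

/-- Linearity of the action: a statement about all weights needs checking on the fundamental ones
only. -/
theorem coord_acts (l : List (Fin 4)) (v : Weight) (i : Fin 4) :
    (acts l v).coord i = ∑ j, v.coord j * (acts l (fundamental j)).coord i := by
  induction l generalizing i with
  | nil => fin_cases i <;> simp [acts, fundamental, coord]
  | cons s l ih =>
    simp only [Fin.sum_univ_four] at ih ⊢
    change (act s (acts l v)).coord i = v.coord 0 * (act s (acts l _)).coord i +
      v.coord 1 * (act s (acts l _)).coord i + v.coord 2 * (act s (acts l _)).coord i +
      v.coord 3 * (act s (acts l _)).coord i
    generalize acts l v = x, acts l (fundamental 0) = x0, acts l (fundamental 1) = x1,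
      acts l (fundamental 2) = x2, acts l (fundamental 3) = x3 at ih ⊢
    have h0 := ih 0
    have h1 := ih 1
    have h2 := ih 2
    have h3 := ih 3
    simp only [coord, Matrix.cons_val] at h0 h1 h2 h3
    fin_cases s <;> fin_cases i <;> simp only [act, coord] <;> simp [h0, h1, h2, h3] <;> ring

end Weight

section Coxeter

variable {W : Type*} [Group W] (cs : CoxeterSystem CoxeterMatrix.F₄ W)

/-- The hypothesis `hY` is Deodhar's dichotomy for coset representatives: `s x` is again a
representative, or `s x = x t` with a generator `t` of the smaller parabolic subgroup, which can be
absorbed into the second factor. -/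
theorem exists_mem_appendWords {Y L : List (List (Fin 4))} {S S' : List (Fin 4)}
    (hY : ∀ x ∈ Y, ∀ s ∈ S, (∃ x' ∈ Y, acts (s :: x) rho = acts x' rho) ∨
      ∃ t ∈ S', acts (s :: x) rho = acts (x ++ [t]) rho)
    (hL : ∀ l ∈ L, ∀ t ∈ S', ∃ l' ∈ L, cs.wordProd (t :: l) = cs.wordProd l') :
    ∀ l ∈ appendWords Y L, ∀ s ∈ S, ∃ l' ∈ appendWords Y L,
      cs.wordProd (s :: l) = cs.wordProd l' := by
  intro m hm s hs
  obtain ⟨x, hx, l, hl, rfl⟩ := mem_appendWords.mp hm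
  rcases hY x hx s hs with ⟨x', hx', e⟩ | ⟨t, ht, e⟩
  · refine ⟨x' ++ l, mem_appendWords.mpr ⟨x', hx', l, hl, rfl⟩, ?_⟩
    rw [← wordProd_eq_iff cs] at e
    rw [← List.cons_append, cs.wordProd_append, e, cs.wordProd_append]
  · obtain ⟨l', hl', e'⟩ := hL l hl t ht
    refine ⟨x ++ l', mem_appendWords.mpr ⟨x, hx, l', hl', rfl⟩, ?_⟩
    rw [← wordProd_eq_iff cs] at e
    rw [← List.cons_append, cs.wordProd_append, e, cs.wordProd_append, cs.wordProd_append,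
      ← e', cs.wordProd_cons t l, cs.wordProd_singleton, mul_assoc]

/-- The second factors fix `ω`, so the image of `ω` recovers the first factor. -/
theorem nodup_map_wordProd_appendWords {Y L : List (List (Fin 4))} (ω : Weight)
    (hω : ∀ l ∈ L, acts l ω = ω) (hY : (Y.map fun x => acts x ω).Nodup)
    (hL : (L.map cs.wordProd).Nodup) : ((appendWords Y L).map cs.wordProd).Nodup := by
  rw [appendWords, List.map_flatMap, List.nodup_flatMap]
  constructor
  · intro x _
    rw [List.map_map]
    have : (cs.wordProd ∘ fun l => x ++ l) = (cs.wordProd x * ·) ∘ cs.wordProd := by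
      funext l
      simp [cs.wordProd_append]
    rw [this, ← List.map_map]
    exact hL.map (mul_right_injective _)
  · rw [List.Nodup, List.pairwise_map] at hY
    refine hY.imp ?_
    intro x y hxy
    rw [Function.onFun, List.disjoint_left]
    intro w hw hw'
    simp only [List.map_map, List.mem_map, Function.comp] at hw hw'
    obtain ⟨l, hl, rfl⟩ := hw
    obtain ⟨l', hl', e⟩ := hw'
    refine hxy ?_
    have := congrArg (fun w => weightHom cs w ω) e
    simp only [weightHom_wordProd, acts, List.foldr_append] at this
    change acts y (acts l' ω) = acts x (acts l ω) at this
    rwa [hω l hl, hω l' hl', eq_comm] at this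

theorem nodup_map_wordProd_words : (words.map cs.wordProd).Nodup := by
  -- The four weights are the fundamental weights fixed by `⟨0, 1, 2⟩`, `⟨0, 1⟩`, `⟨0⟩` and the
  -- trivial group.
  refine nodup_map_wordProd_appendWords cs ⟨0, 0, 0, 1⟩ (by decide +kernel) (by decide +kernel) ?_
  refine nodup_map_wordProd_appendWords cs ⟨0, 0, 1, 0⟩ (by decide +kernel) (by decide +kernel) ?_
  refine nodup_map_wordProd_appendWords cs ⟨0, 1, 0, 0⟩ (by decide +kernel) (by decide +kernel) ?_
  refine nodup_map_wordProd_appendWords cs ⟨1, 0, 0, 0⟩ (by decide +kernel) (by decide +kernel) ?_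
  simp

theorem exists_mem_words (w : W) : ∃ l ∈ words, cs.wordProd l = w := by
  have closed : ∀ l ∈ words, ∀ s ∈ [0, 1, 2, 3], ∃ l' ∈ words,
      cs.wordProd (s :: l) = cs.wordProd l' := by
    refine exists_mem_appendWords cs (S' := [0, 1, 2]) (by decide +kernel) ?_
    refine exists_mem_appendWords cs (S' := [0, 1]) (by decide +kernel) ?_
    refine exists_mem_appendWords cs (S' := [0]) (by decide +kernel) ?_
    refine exists_mem_appendWords cs (S' := []) (by decide +kernel) ?_
    simp
  induction w using cs.simple_induction_left with
  | one => exact ⟨[], by decide +kernel, cs.wordProd_nil⟩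
  | mul_simple_left w i ih =>
    obtain ⟨l, hl, rfl⟩ := ih
    obtain ⟨l', hl', e⟩ := closed l hl i (by fin_cases i <;> simp)
    exact ⟨l', hl', by rw [← e, cs.wordProd_cons]⟩

include cs in
theorem finite_group : Finite W :=
  Set.finite_univ_iff.mp <| (List.finite_toSet (words.map cs.wordProd)).subset fun w _ => by
    simpa using exists_mem_words cs w

theorem sum_eq_sum_words [Fintype W] {N : Type*} [AddCommMonoid N] (F : W → N) :
    ∑ w, F w = (words.map fun l => F (cs.wordProd l)).sum := by
  classical
  have h : (Finset.univ : Finset W) = (words.map cs.wordProd).toFinset := by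
    ext w
    simpa using exists_mem_words cs w
  rw [h, List.sum_toFinset _ (nodup_map_wordProd_words cs), List.map_map]
  rfl

/-! ## Parabolic subgroups and their longest elements -/

open Descent hiding act

/-- The subset of the generators given by the binary digits of `k`. -/
def maskSet (k : ℕ) : Finset (Fin 4) := Finset.univ.filter fun i : Fin 4 => k.testBit i

theorem mem_maskSet {k : ℕ} {i : Fin 4} : i ∈ maskSet k ↔ k.testBit i := by
  simp [maskSet]

theorem exists_maskSet_eq : ∀ J : Finset (Fin 4), ∃ k < 16, maskSet k = J := by
  decide +kernel

/-- Words for the longest elements of the parabolic subgroups. -/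
def longestWords : List (List (Fin 4)) :=
  [[], [0], [1], [0, 1, 0], [2], [2, 0], [2, 1, 2, 1], [2, 1, 2, 0, 1, 2, 0, 1, 0], [3], [3, 0],
    [3, 1], [3, 0, 1, 0], [2, 3, 2], [2, 3, 2, 0], [3, 2, 1, 2, 3, 2, 1, 2, 1],
    [3, 2, 1, 2, 0, 1, 2, 3, 2, 1, 2, 0, 1, 2, 3, 2, 1, 2, 0, 1, 2, 0, 1, 0]]

/-- A word for the longest element of the parabolic subgroup of `maskSet k`. -/
def longestWord (k : ℕ) : List (Fin 4) := longestWords.getD k []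

theorem mem_of_mem_longestWord : ∀ k < 16, ∀ i ∈ longestWord k, i ∈ maskSet k := by
  decide +kernel

theorem acts_longestWord_longestWord : ∀ k < 16,
    acts (longestWord k ++ longestWord k) rho = rho := by
  decide +kernel

theorem wordProd_mem_parabolic {J : Finset (Fin 4)} {l : List (Fin 4)} (h : ∀ i ∈ l, i ∈ J) :
    cs.wordProd l ∈ parabolic cs J := by
  induction l with
  | nil => simp
  | cons i l ih =>
    rw [cs.wordProd_cons]
    refine mul_mem (Subgroup.subset_closure ⟨i, h i (by simp), rfl⟩) (ih fun j hj => h j ?_)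
    simp [hj]

/-- The sum of the fundamental weights that do not belong to `J`. -/
def coweight (J : Finset (Fin 4)) : Weight :=
  ⟨if 0 ∈ J then 0 else 1, if 1 ∈ J then 0 else 1, if 2 ∈ J then 0 else 1,
    if 3 ∈ J then 0 else 1⟩

theorem coord_coweight (J : Finset (Fin 4)) (i : Fin 4) :
    (coweight J).coord i = if i ∈ J then 0 else 1 := by
  fin_cases i <;> rfl

theorem act_eq_self {i : Fin 4} {v : Weight} (h : v.coord i = 0) : act i v = v := by
  obtain ⟨a, b, c, d⟩ := v
  fin_cases i <;> simp [coord] at h <;> simp [act, h]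

theorem weightHom_coweight {J : Finset (Fin 4)} {u : W} (hu : u ∈ parabolic cs J) :
    weightHom cs u (coweight J) = coweight J := by
  induction hu using Subgroup.closure_induction with
  | mem x hx =>
    obtain ⟨i, hi, rfl⟩ := hx
    have := weightHom_wordProd cs [i] (coweight J)
    rw [cs.wordProd_singleton] at this
    exact this.trans (act_eq_self (by simpa [coord_coweight] using hi))
  | one => simp [Function.End.one_def]
  | mul x y _ _ hx hy =>
    rw [map_mul]
    change weightHom cs x (weightHom cs y _) = _
    rw [hy, hx]
  | inv x _ hx =>
    conv_lhs => rw [← hx]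
    change (weightHom cs x⁻¹ * weightHom cs x) _ = _
    rw [← map_mul, inv_mul_cancel, map_one]
    rfl

/-- A left descent outside `J` would make a coordinate of the image of `coweight J` nonpositive, but
`u` fixes this weight and the coordinate is `1`. -/
theorem eq_one_of_mem_parabolic {J : Finset (Fin 4)} {u : W} (hu : u ∈ parabolic cs J)
    (h : ∀ i ∈ J, cs.length u < cs.length (cs.simple i * u)) : u = 1 := by
  by_contra h1
  obtain ⟨i, hi⟩ := cs.exists_leftDescent_of_ne_one h1
  rw [CoxeterSystem.IsLeftDescent] at hi
  by_cases hiJ : i ∈ J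
  · have := h i hiJ
    omega
  · have := coord_weightHom_nonpos cs (v := coweight J)
      (fun j => by rw [coord_coweight]; split <;> simp) u i hi
    rw [weightHom_coweight cs hu, coord_coweight, if_neg hiJ] at this
    omega

/-- The longest element of a parabolic subgroup permutes its simple roots up to sign. -/
theorem exists_coord_acts_longestWord {k : ℕ} (hk : k < 16) {i : Fin 4} (hi : i ∈ maskSet k) :
    ∃ j ∈ maskSet k, ∀ v, (acts (longestWord k) v).coord i = -v.coord j := by
  have key : ∀ k < 16, ∀ i ∈ maskSet k, ∃ j ∈ maskSet k, ∀ m,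
      (acts (longestWord k) (fundamental m)).coord i = if m = j then -1 else 0 := by
    decide +kernel
  obtain ⟨j, hj, h⟩ := key k hk i hi
  refine ⟨j, hj, fun v => ?_⟩
  rw [coord_acts, Finset.sum_congr rfl fun m _ => by rw [h m]]
  simp

theorem wordProd_longestWord_mul_self {k : ℕ} (hk : k < 16) :
    cs.wordProd (longestWord k) * cs.wordProd (longestWord k) = 1 := by
  rw [← cs.wordProd_append, ← cs.wordProd_nil, wordProd_eq_iff cs]
  exact acts_longestWord_longestWord k hk

theorem longest_maskSet {k : ℕ} (hk : k < 16) :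
    longest cs (maskSet k) = cs.wordProd (longestWord k) := by
  have := finite_group cs
  have hex : ∃ w, w ∈ parabolic cs (maskSet k) ∧
      ∀ u ∈ parabolic cs (maskSet k), cs.length u ≤ cs.length w :=
    Set.exists_max_image (parabolic cs (maskSet k) : Set W) cs.length (Set.toFinite _)
      ⟨1, one_mem _⟩
  obtain ⟨hmem, hmax⟩ := Classical.epsilon_spec hex
  rw [← longest] at hmem hmax
  -- By maximality every element of `J` is a left descent of the longest element. The word permutes
  -- the coordinates in `J` and changes their signs, so the product has no left descent in `J`.
  have h : cs.wordProd (longestWord k) * longest cs (maskSet k) = 1 := by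
    refine eq_one_of_mem_parabolic cs (J := maskSet k)
      (mul_mem (wordProd_mem_parabolic cs (mem_of_mem_longestWord k hk)) hmem) fun i hi => ?_
    rw [lt_length_simple_mul_iff, map_mul]
    change ¬ ((weightHom cs (cs.wordProd _)) (weightHom cs (longest cs _) rho)).coord i < 0
    rw [weightHom_wordProd]
    obtain ⟨j, hj, e⟩ := exists_coord_acts_longestWord hk hi
    rw [e, neg_lt_zero, not_lt]
    refine le_of_lt ?_
    rw [← length_simple_mul_lt_iff]
    have h1 := hmax _ (mul_mem (Subgroup.subset_closure ⟨j, hj, rfl⟩) hmem :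
      cs.simple j * longest cs (maskSet k) ∈ parabolic cs (maskSet k))
    have h2 := cs.length_simple_mul_ne (longest cs (maskSet k)) j
    omega
  exact mul_left_cancel (h.trans (wordProd_longestWord_mul_self cs hk).symm)

theorem longest_univ_commute (w : W) : Commute (longest cs Finset.univ) w := by
  rw [show (Finset.univ : Finset (Fin 4)) = maskSet 15 by decide, longest_maskSet cs (by norm_num)]
  induction w using cs.simple_induction_left with
  | one => exact Commute.one_right _
  | mul_simple_left w i ih =>
    refine Commute.mul_right ?_ ih
    rw [commute_iff_eq, ← cs.wordProd_singleton i, ← cs.wordProd_append, ← cs.wordProd_append,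
      wordProd_eq_iff]
    revert i
    decide +kernel

end Coxeter

end TypeF4

namespace TypeF4

open Weight

/-! ## Descent sets -/

/-- Whether an integer is negative. -/
def isNeg : ℤ → Bool
  | .ofNat _ => false
  | .negSucc _ => true

theorem isNeg_eq (x : ℤ) : isNeg x = decide (x < 0) := by
  cases x <;> simp [isNeg, Int.negSucc_lt_zero]

/-- The set of indices of the negative coordinates of a weight, as a binary number. -/
def negMask (v : Weight) : ℕ :=
  (isNeg v.a).toNat + 2 * (isNeg v.b).toNat + 4 * (isNeg v.c).toNat + 8 * (isNeg v.d).toNat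

theorem negMask_lt (v : Weight) : negMask v < 16 := by
  have h : ∀ b : Bool, b.toNat ≤ 1 := by decide
  have := h (isNeg v.a)
  have := h (isNeg v.b)
  have := h (isNeg v.c)
  have := h (isNeg v.d)
  unfold negMask
  omega

theorem testBit_negMask (v : Weight) (i : Fin 4) :
    (negMask v).testBit i = decide (v.coord i < 0) := by
  have h : ∀ b0 b1 b2 b3 : Bool, ∀ i : Fin 4,
      (b0.toNat + 2 * b1.toNat + 4 * b2.toNat + 8 * b3.toNat).testBit i =
        (![b0, b1, b2, b3] : Fin 4 → Bool) i := by decide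
  rw [negMask, h]
  fin_cases i <;> exact isNeg_eq _

theorem eq_of_testBit_eq {k k' : ℕ} (hk : k < 16) (hk' : k' < 16)
    (h : ∀ i : Fin 4, k.testBit i = k'.testBit i) : k = k' := by
  have key : ∀ k < 16, ∀ k' < 16, (∀ i : Fin 4, k.testBit i = k'.testBit i) → k = k' := by
    decide +kernel
  exact key k hk k' hk' h

/-! ### Exchange properties of descent sets. -/

section Coxeter

variable {W : Type*} [Group W] (cs : CoxeterSystem CoxeterMatrix.F₄ W)

/-- The left descent set of an element, as a binary number. -/
def leftMask (w : W) : ℕ := negMask (weightHom cs w rho)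

theorem leftMask_lt (w : W) : leftMask cs w < 16 := negMask_lt _

theorem testBit_leftMask (w : W) (i : Fin 4) :
    (leftMask cs w).testBit i ↔ cs.length (cs.simple i * w) < cs.length w := by
  rw [leftMask, testBit_negMask, decide_eq_true_iff, length_simple_mul_lt_iff]

theorem leftMask_eq_iff {w w' : W} : leftMask cs w = leftMask cs w' ↔
    ∀ i, cs.length (cs.simple i * w) < cs.length w ↔
      cs.length (cs.simple i * w') < cs.length w' := by
  constructor
  · intro h i
    rw [← testBit_leftMask, ← testBit_leftMask, h]
  · intro h
    refine eq_of_testBit_eq (leftMask_lt cs _) (leftMask_lt cs _) fun i => ?_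
    rw [Bool.eq_iff_iff, testBit_leftMask, testBit_leftMask]
    exact h i

theorem weightHom_mul (w w' : W) (v : Weight) :
    weightHom cs (w * w') v = weightHom cs w (weightHom cs w' v) := by
  rw [map_mul]
  rfl

theorem weightHom_one (v : Weight) : weightHom cs 1 v = v := by
  rw [map_one]
  rfl

theorem weightHom_simple (i : Fin 4) (v : Weight) : weightHom cs (cs.simple i) v = act i v := by
  have := weightHom_simple_mul cs i 1 v
  rwa [mul_one, weightHom_one] at this

theorem coweight_nonneg (J : Finset (Fin 4)) (i : Fin 4) : 0 ≤ (coweight J).coord i := by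
  rw [coord_coweight]
  split <;> simp

theorem act_eq_self_iff {i : Fin 4} {v : Weight} : act i v = v ↔ v.coord i = 0 := by
  refine ⟨fun h => ?_, act_eq_self⟩
  have := coord_act_self i v
  rw [h] at this
  omega

/-- The stabiliser of a dominant weight is parabolic: a left descent of an element that fixes
`coweight J` has to lie in `J`, and it can be split off. -/
theorem mem_parabolic_iff {J : Finset (Fin 4)} {u : W} :
    u ∈ Descent.parabolic cs J ↔ weightHom cs u (coweight J) = coweight J := by
  refine ⟨weightHom_coweight cs, fun h => ?_⟩
  induction hn : cs.length u using Nat.strong_induction_on generalizing u with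
  | _ n ih =>
  subst hn
  by_cases h1 : u = 1
  · exact h1 ▸ one_mem _
  obtain ⟨i, hi⟩ := cs.exists_leftDescent_of_ne_one h1
  rw [CoxeterSystem.IsLeftDescent] at hi
  have hle := coord_weightHom_nonpos cs (coweight_nonneg J) u i hi
  have hiJ : i ∈ J := by
    by_contra hiJ
    rw [h, coord_coweight, if_neg hiJ] at hle
    omega
  have hmem : cs.simple i ∈ Descent.parabolic cs J := Subgroup.subset_closure ⟨i, hiJ, rfl⟩
  have := ih _ hi (u := cs.simple i * u)
    (by rw [weightHom_mul, h, weightHom_coweight cs hmem]) rfl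
  exact (Subgroup.mul_mem_cancel_left _ hmem).mp this

theorem mem_parabolic_singleton {i : Fin 4} {u : W}
    (hu : u ∈ Descent.parabolic cs ({i} : Finset (Fin 4))) : u = 1 ∨ u = cs.simple i := by
  rw [Descent.parabolic, Finset.coe_singleton, Set.image_singleton] at hu
  obtain ⟨n, rfl⟩ := Subgroup.mem_closure_singleton.mp hu
  obtain ⟨m, rfl | rfl⟩ := Int.even_or_odd' n
  · left
    rw [zpow_mul]
    simp
  · right
    rw [zpow_add, zpow_mul]
    simp

theorem length_mul_simple_lt_iff (w : W) (i : Fin 4) :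
    cs.length (w * cs.simple i) < cs.length w ↔
      cs.length (cs.simple i * w⁻¹) < cs.length w⁻¹ := by
  rw [← cs.length_inv (w * cs.simple i), ← cs.length_inv w, mul_inv_rev, cs.inv_simple]

/-- If `b s` were shorter than `b`, then `t b s` would have length `ℓ(b) - 2`; but this length
differs by one from `ℓ(t b) = ℓ(b) + 1`. -/
theorem length_mul_simple_lt_of_lt {b : W} {s t : Fin 4}
    (h : cs.length b < cs.length (cs.simple t * b))
    (h' : cs.length (cs.simple t * (b * cs.simple s)) < cs.length (b * cs.simple s)) :
    cs.length b < cs.length (b * cs.simple s) := by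
  have h1 := cs.length_mul_simple b s
  have h2 := cs.length_simple_mul b t
  have h3 := cs.length_simple_mul (b * cs.simple s) t
  have h4 := cs.length_mul_simple (cs.simple t * b) s
  rw [mul_assoc] at h4
  omega

/-- Since `s` fixes `coweight {s}`, the hypotheses on `b` and on `b s` bound the `t`-coordinate of
one and the same weight from both sides by `0`. Hence `b⁻¹ t b` stabilises `coweight {s}` and is `1`
or `s`. -/
theorem simple_mul_eq_mul_simple_of_lt {b : W} {s t : Fin 4}
    (h : cs.length b < cs.length (cs.simple t * b))
    (h' : cs.length (cs.simple t * (b * cs.simple s)) < cs.length (b * cs.simple s)) :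
    cs.simple t * b = b * cs.simple s := by
  have h1 := le_coord_weightHom cs le_rfl (coweight_nonneg {s}) b t h
  have h2 := coord_weightHom_nonpos cs (coweight_nonneg {s}) _ t h'
  have hs : act s (coweight {s}) = coweight {s} :=
    act_eq_self (by rw [coord_coweight, if_pos (Finset.mem_singleton_self s)])
  rw [weightHom_mul, weightHom_simple, hs] at h2
  have hfix : b⁻¹ * (cs.simple t * b) ∈ Descent.parabolic cs {s} := by
    rw [mem_parabolic_iff, weightHom_mul, weightHom_mul, weightHom_simple,
      act_eq_self (le_antisymm h2 h1), ← weightHom_mul, inv_mul_cancel, weightHom_one]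
  rcases mem_parabolic_singleton cs hfix with h3 | h3
  · rw [inv_mul_eq_one] at h3
    rw [← h3] at h
    exact absurd h (lt_irrefl _)
  · exact inv_mul_eq_iff_eq_mul.mp h3

theorem exists_simple_mul_eq_mul_simple {b : W} {s : Fin 4}
    (h : leftMask cs (b * cs.simple s) ≠ leftMask cs b) :
    ∃ t, cs.simple t * b = b * cs.simple s := by
  rw [Ne, leftMask_eq_iff, not_forall] at h
  obtain ⟨t, ht⟩ := h
  refine ⟨t, ?_⟩
  have hne := cs.length_simple_mul_ne b t
  have hne' := cs.length_simple_mul_ne (b * cs.simple s) t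
  by_cases h1 : cs.length b < cs.length (cs.simple t * b)
  · refine simple_mul_eq_mul_simple_of_lt cs h1 ?_
    by_contra h2
    exact ht ⟨fun h => absurd h h2, fun h => absurd h (by omega)⟩
  · have := simple_mul_eq_mul_simple_of_lt cs (b := b * cs.simple s) (s := s) (t := t)
      (by
        by_contra h2
        exact ht ⟨fun h => by omega, fun h => by omega⟩) (by simpa using by omega)
    have h3 := congrArg (· * cs.simple s) this
    simp only [← mul_assoc, cs.simple_mul_simple_cancel_right] at h3
    exact h3

theorem leftMask_simple_mul_ne (w : W) (i : Fin 4) : leftMask cs (cs.simple i * w) ≠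
    leftMask cs w := by
  intro h
  have := (leftMask_eq_iff cs).mp h i
  rw [cs.simple_mul_simple_cancel_left] at this
  have := cs.length_simple_mul_ne w i
  omega

theorem mem_maskSet_leftMask {w : W} {i : Fin 4} : i ∈ maskSet (leftMask cs w) ↔
    cs.length (cs.simple i * w) < cs.length w := by
  rw [mem_maskSet, testBit_leftMask]

/-- An element `z` different from the longest element of the parabolic subgroup of its left
descent set has the same left descent set as some `z s` nearer to that element. -/
theorem exists_leftMask_mul_simple_eq {z : W}
    (hz : cs.wordProd (longestWord (leftMask cs z)) * z ≠ 1) :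
    ∃ s, leftMask cs (z * cs.simple s) = leftMask cs z ∧
      cs.length (cs.wordProd (longestWord (leftMask cs z)) * (z * cs.simple s)) <
        cs.length (cs.wordProd (longestWord (leftMask cs z)) * z) := by
  have hk := leftMask_lt cs z
  have hmask : ∀ i, i ∈ maskSet (leftMask cs z) ↔
    cs.length (cs.simple i * z) < cs.length z := fun i => mem_maskSet_leftMask cs
  generalize leftMask cs z = k at hz hk hmask ⊢
  obtain ⟨s, hs⟩ := cs.exists_rightDescent_of_ne_one hz
  rw [CoxeterSystem.IsRightDescent] at hs
  set y := cs.wordProd (longestWord k) * z with hy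
  have hzy : z = cs.wordProd (longestWord k) * y := by
    rw [hy, ← mul_assoc, wordProd_longestWord_mul_self cs hk, one_mul]
  have hyk : ∀ i ∈ maskSet k, cs.length y < cs.length (cs.simple i * y) := by
    intro i hi
    rw [lt_length_simple_mul_iff, hy, weightHom_mul, weightHom_wordProd]
    obtain ⟨j, hj, e⟩ := exists_coord_acts_longestWord hk hi
    rw [e, neg_lt_zero, not_lt]
    refine le_of_lt ?_
    rw [← length_simple_mul_lt_iff]
    exact (hmask j).mp hj
  have hysk : ∀ i ∈ maskSet k, cs.length (y * cs.simple s) <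
      cs.length (cs.simple i * (y * cs.simple s)) := by
    intro i hi
    by_contra h
    have h1 := cs.length_simple_mul_ne (y * cs.simple s) i
    have := length_mul_simple_lt_of_lt cs (hyk i hi) (s := s) (by omega)
    omega
  refine ⟨s, ?_, by rwa [← mul_assoc]⟩
  -- Write `K` for `maskSet k`. The element `z s` is the product of the longest element of `K` and
  -- `y s`. Since `y s` has no left descent in `K`, all of `K` are left descents of `z s`.
  have hzs : ∀ i ∈ maskSet k, cs.length (cs.simple i * (z * cs.simple s)) <
      cs.length (z * cs.simple s) := by
    intro i hi
    obtain ⟨j, hj, e⟩ := exists_coord_acts_longestWord hk hi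
    rw [length_simple_mul_lt_iff, hzy, mul_assoc, weightHom_mul, weightHom_wordProd, e,
      neg_lt_zero]
    have := hysk j hj
    have h0 := le_coord_weightHom cs zero_le_one one_le_coord_rho _ j this
    omega
  refine eq_of_testBit_eq (leftMask_lt cs _) hk fun i => ?_
  rw [Bool.eq_iff_iff, testBit_leftMask, ← mem_maskSet]
  refine ⟨fun h => ?_, hzs i⟩
  -- A new left descent `i` forces `i z = z s`. The elements `y⁻¹` and `z⁻¹` send the coweight of
  -- `K` to the same weight. As `s` shortens `y` and lengthens `z` from the right, the
  -- `s`-coordinate of this weight is `0`. Thus `z s z⁻¹ = i` fixes the coweight, contrary to `i ∉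
  -- K`.
  by_contra hi
  have hiz : cs.length z < cs.length (cs.simple i * z) := by
    have h1 := cs.length_simple_mul_ne z i
    have h2 := (hmask i).not.mp hi
    omega
  have hlt := length_mul_simple_lt_of_lt cs hiz h
  have hcomm := simple_mul_eq_mul_simple_of_lt cs hiz h
  have hwk : weightHom cs (cs.wordProd (longestWord k)) (coweight (maskSet k)) =
      coweight (maskSet k) :=
    weightHom_coweight cs (wordProd_mem_parabolic cs (mem_of_mem_longestWord k hk))
  have hyz : weightHom cs y⁻¹ (coweight (maskSet k)) =
      weightHom cs z⁻¹ (coweight (maskSet k)) := by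
    have : y⁻¹ * cs.wordProd (longestWord k) = z⁻¹ := by rw [hy]; group
    rw [← this, weightHom_mul, hwk]
  have h1 := coord_weightHom_nonpos cs (coweight_nonneg (maskSet k)) y⁻¹ s
    ((length_mul_simple_lt_iff cs y s).mp hs)
  have h2 := le_coord_weightHom cs le_rfl (coweight_nonneg (maskSet k)) z⁻¹ s
    (by
      have h3 := cs.length_simple_mul_ne z⁻¹ s
      have h4 := (length_mul_simple_lt_iff cs z s).not.mp (by omega)
      omega)
  rw [hyz] at h1
  have h3 : weightHom cs (cs.simple i) (coweight (maskSet k)) = coweight (maskSet k) := by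
    rw [eq_mul_inv_of_mul_eq hcomm, weightHom_mul, weightHom_mul, weightHom_simple,
      act_eq_self (le_antisymm h1 h2), ← weightHom_mul, mul_inv_cancel, weightHom_one]
  rw [weightHom_simple, act_eq_self_iff, coord_coweight, if_neg hi] at h3
  exact one_ne_zero h3

/-! ## Products of functions of the descent set -/

/-- The right descent set of an element, as a binary number. -/
def rightMask (w : W) : ℕ := leftMask cs w⁻¹

open Classical in
/-- The involution in Atkinson's proof of Solomon's theorem. -/
noncomputable def atkinson (s : Fin 4) (b : W) : W :=
  if ∃ t, cs.simple t * b = b * cs.simple s then b else b * cs.simple s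

theorem atkinson_involutive (s : Fin 4) : Function.Involutive (atkinson cs s) := by
  intro b
  by_cases h : ∃ t, cs.simple t * b = b * cs.simple s
  · simp [atkinson, h]
  · have h' : ¬ ∃ t, cs.simple t * (b * cs.simple s) = b * cs.simple s * cs.simple s := by
      rintro ⟨t, ht⟩
      refine h ⟨t, ?_⟩
      have h3 := congrArg (· * cs.simple s) ht
      simpa only [← mul_assoc, cs.simple_mul_simple_cancel_right] using h3
    rw [atkinson, atkinson, if_neg h, if_neg h', cs.simple_mul_simple_cancel_right]

section Sum

variable [Fintype W] {R : Type*} [CommSemiring R] (f g : ℕ → R)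

/-- Reindex by Atkinson's involution. If `b` is moved to `b s`, its left descent set does not
change. If `b s = t b`, then `b s w = t b w` has the same right descent set as `b w`; otherwise `(b
w)⁻¹ t = r (b w)⁻¹` for some `r`, so `w⁻¹ s = r w⁻¹`, and the right descent sets of `s w` and `w`
would differ. -/
theorem sum_simple_mul {w : W} {s : Fin 4}
    (h : rightMask cs (cs.simple s * w) = rightMask cs w) :
    ∑ b, f (leftMask cs b) * g (rightMask cs (b * (cs.simple s * w))) =
      ∑ b, f (leftMask cs b) * g (rightMask cs (b * w)) := by
  rw [← Equiv.sum_comp (atkinson_involutive cs s).toPerm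
    fun b => f (leftMask cs b) * g (rightMask cs (b * w))]
  refine Finset.sum_congr rfl fun b _ => ?_
  change _ = f (leftMask cs (atkinson cs s b)) * g (rightMask cs (atkinson cs s b * w))
  by_cases hb : ∃ t, cs.simple t * b = b * cs.simple s
  · rw [atkinson, if_pos hb]
    obtain ⟨t, ht⟩ := hb
    congr 2
    by_contra hne
    rw [rightMask, rightMask, ← mul_assoc, ← ht, mul_assoc, mul_inv_rev, cs.inv_simple] at hne
    obtain ⟨r, hr⟩ := exists_simple_mul_eq_mul_simple cs hne
    have hr' : cs.simple r * w⁻¹ = (cs.simple s * w)⁻¹ := by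
      have h1 : cs.simple t = b * cs.simple s * b⁻¹ := eq_mul_inv_of_mul_eq ht
      rw [h1, mul_inv_rev] at hr
      have h2 := congrArg (· * b) hr
      simpa [mul_assoc] using h2
    rw [rightMask, rightMask, ← hr'] at h
    exact leftMask_simple_mul_ne cs _ _ h
  · rw [atkinson, if_neg hb, mul_assoc]
    congr 2
    by_contra hne
    exact hb (exists_simple_mul_eq_mul_simple cs (Ne.symm hne))

/-- The coefficients of a product of two elements of the descent algebra depend only on the
descent set. -/
theorem sum_eq_sum_longest (w : W) :
    ∑ b, f (leftMask cs b) * g (rightMask cs (b * w)) =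
      ∑ b, f (leftMask cs b) *
        g (rightMask cs (b * cs.wordProd (longestWord (rightMask cs w)))) := by
  induction hn : cs.length (cs.wordProd (longestWord (rightMask cs w)) * w⁻¹) using
    Nat.strong_induction_on generalizing w with
  | _ n ih =>
  subst hn
  have hk : rightMask cs w < 16 := leftMask_lt cs _
  by_cases h1 : cs.wordProd (longestWord (rightMask cs w)) * w⁻¹ = 1
  · rw [mul_inv_eq_one.mp h1]
  · obtain ⟨s, hs, hlt⟩ := exists_leftMask_mul_simple_eq cs h1
    have hinv : (cs.simple s * w)⁻¹ = w⁻¹ * cs.simple s := by rw [mul_inv_rev, cs.inv_simple]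
    rw [← hinv] at hs hlt
    have hmask : rightMask cs (cs.simple s * w) = rightMask cs w := hs
    rw [← sum_simple_mul cs f g hmask]
    have := ih _ (by rw [hmask]; exact hlt) (cs.simple s * w) rfl
    rwa [hmask] at this

/-- The right descents of `b w_K` are the left descents of `w_K b⁻¹`, whose word is visible. -/
theorem sum_longest_eq {k : ℕ} (hk : k < 16) :
    ∑ b, f (leftMask cs b) * g (rightMask cs (b * cs.wordProd (longestWord k))) =
      (words.map fun l => f (negMask (acts l rho)) *
        g (negMask (acts (longestWord k ++ l.reverse) rho))).sum := by
  rw [sum_eq_sum_words cs]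
  congr 1
  refine List.map_congr_left fun l _ => ?_
  rw [leftMask, weightHom_wordProd, rightMask, mul_inv_rev, leftMask,
    inv_eq_of_mul_eq_one_left (wordProd_longestWord_mul_self cs hk), ← cs.wordProd_reverse,
    ← cs.wordProd_append, weightHom_wordProd]

end Sum

end Coxeter

end TypeF4

namespace TypeF4

open Weight

/-! ## Tables -/

/-- Row `K` contains the numbers `|X_K ∩ X_L^♯|` for `L ⊆ K`. -/
def multTable : List (List ℤ) :=
  [[1152],
   [576, 96],
   [576, 0, 96],
   [192, 48, 48, 12],
   [576, 0, 0, 0, 96],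
   [288, 48, 0, 0, 48, 12],
   [144, 0, 48, 0, 48, 0, 8],
   [24, 10, 14, 6, 12, 6, 4, 2],
   [576, 0, 0, 0, 0, 0, 0, 0, 96],
   [288, 48, 0, 0, 0, 0, 0, 0, 48, 12],
   [288, 0, 48, 0, 0, 0, 0, 0, 48, 0, 12],
   [96, 24, 24, 6, 0, 0, 0, 0, 16, 6, 6, 2],
   [192, 0, 0, 0, 48, 0, 0, 0, 48, 0, 0, 0, 12],
   [96, 16, 0, 0, 24, 6, 0, 0, 24, 6, 0, 0, 6, 2],
   [24, 0, 12, 0, 14, 0, 4, 0, 10, 0, 6, 0, 6, 0, 2],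
   [1, 1, 1, 1, 1, 1, 1, 1, 1, 1, 1, 1, 1, 1, 1, 1]]

/-- Row `L` contains the values of `1152 e_L` on the elements with a given right descent set. -/
def eTable : List (List ℤ) :=
  [[1, 1, 1, 1, 1, 1, 1, 1, 1, 1, 1, 1, 1, 1, 1, 1],
   [6, -6, 6, -6, 6, -6, 6, -6, 6, -6, 6, -6, 6, -6, 6, -6],
   [6, 6, -6, -6, 6, 6, -6, -6, 6, 6, -6, -6, 6, 6, -6, -6],
   [32, -16, -16, 32, 32, -16, -16, 32, 32, -16, -16, 32, 32, -16, -16, 32],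
   [6, 6, 6, 6, -6, -6, -6, -6, 6, 6, 6, 6, -6, -6, -6, -6],
   [24, -24, 24, -24, -24, 24, -24, 24, 24, -24, 24, -24, -24, 24, -24, 24],
   [54, 54, -18, -18, -18, -18, 54, 54, 54, 54, -18, -18, -18, -18, 54, 54],
   [180, -48, -24, 36, -36, 24, 48, -180, 180, -48, -24, 36, -36, 24, 48, -180],
   [6, 6, 6, 6, 6, 6, 6, 6, -6, -6, -6, -6, -6, -6, -6, -6],
   [24, -24, 24, -24, 24, -24, 24, -24, -24, 24, -24, 24, -24, 24, -24, 24],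
   [24, 24, -24, -24, 24, 24, -24, -24, -24, -24, 24, 24, -24, -24, 24, 24],
   [96, -48, -48, 96, 96, -48, -48, 96, -96, 48, 48, -96, -96, 48, 48, -96],
   [32, 32, 32, 32, -16, -16, -16, -16, -16, -16, -16, -16, 32, 32, 32, 32],
   [96, -96, 96, -96, -48, 48, -48, 48, -48, 48, -48, 48, 96, -96, 96, -96],
   [180, 180, -36, -36, -24, -24, 48, 48, -48, -48, 24, 24, 36, 36, -180, -180],
   [385, -47, -23, 25, -23, 25, 1, -47, -47, 1, 25, -23, 25, -23, -47, 385]]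

/-- The value of `1152 e_L` on the elements with right descent set `m`. -/
def eValue (k m : ℕ) : ℤ := (eTable.getD k []).getD m 0

/-- The edges of the quiver. -/
inductive Arrow
  | a₁ | a₂ | b' | b''
  deriving DecidableEq

instance : Fintype Arrow where
  elems := {.a₁, .a₂, .b', .b''}
  complete a := by cases a <;> decide

namespace Arrow

/-- The source of an edge. -/
def src : Arrow → Vertex
  | a₁ | a₂ => .A11
  | b' => .A1'
  | b'' => .A1''

/-- The target of an edge. -/
def tgt : Arrow → Vertex
  | a₁ | a₂ => .F4
  | b' => .B3'
  | b'' => .B3''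

/-- An edge as an edge of the quiver. -/
def edge : (a : Arrow) → a.src ⟶ a.tgt
  | a₁ => Edge.a₁
  | a₂ => Edge.a₂
  | b' => Edge.b'
  | b'' => Edge.b''

end Arrow

/-- The index set of the basis of paths. -/
abbrev Basis := Vertex ⊕ Arrow

/-- The expansions of the images of the paths in terms of the elements `e_L`. -/
def expansion : Basis → List (ℤ × ℕ)
  | .inl .empty => [(1, 0)]
  | .inl .A1' => [(1, 1), (1, 2)]
  | .inl .A1'' => [(1, 4), (1, 8)]
  | .inl .A11 => [(1, 5), (1, 9), (1, 10)]
  | .inl .A2' => [(1, 3)]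
  | .inl .A2'' => [(1, 12)]
  | .inl .B2 => [(1, 6)]
  | .inl .A21' => [(1, 11)]
  | .inl .A21'' => [(1, 13)]
  | .inl .B3' => [(1, 7)]
  | .inl .B3'' => [(1, 14)]
  | .inl .F4 => [(1, 15)]
  | .inr .a₁ => [(2, 9), (-2, 5)]
  | .inr .a₂ => [(2, 10), (-2, 9)]
  | .inr .b' => [(2, 2), (-2, 1)]
  | .inr .b'' => [(2, 8), (-2, 4)]

/-- The value of `1152` times the image of a path on the elements with right descent set `m`. -/
def value (b : Basis) (m : ℕ) : ℤ := (expansion b).foldr (fun x n => x.1 * eValue x.2 m + n) 0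

/-- The product of paths, if it is not zero. -/
def composite : Basis → Basis → Option Basis
  | .inl v, .inl w => if v = w then some (.inl v) else none
  | .inl v, .inr a => if v = a.src then some (.inr a) else none
  | .inr a, .inl v => if v = a.tgt then some (.inr a) else none
  | .inr _, .inr _ => none

/-- A list of the paths. -/
def basisList : List Basis :=
  [.inl .empty, .inl .A1', .inl .A1'', .inl .A11, .inl .A2', .inl .A2'', .inl .B2, .inl .A21',
    .inl .A21'', .inl .B3', .inl .B3'', .inl .F4, .inr .a₁, .inr .a₂, .inr .b', .inr .b'']

/-! ### Kronecker substitution: many integer identities packed into one. -/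

/-- The integer with the given digits. -/
def pack {ι : Type*} (B : ℤ) (f : ι → ℤ) : List ι → ℤ
  | [] => 0
  | i :: l => f i + B * pack B f l

theorem pack_sub {ι : Type*} (B : ℤ) (f g : ι → ℤ) (L : List ι) :
    pack B f L - pack B g L = pack B (fun i => f i - g i) L := by
  induction L with
  | nil => simp [pack]
  | cons i L ih => rw [pack, pack, pack, ← ih]; ring

theorem pack_mul {ι : Type*} (B c : ℤ) (f : ι → ℤ) (L : List ι) :
    pack B f L * c = pack B (fun i => f i * c) L := by
  induction L with
  | nil => simp [pack]
  | cons i L ih => rw [pack, pack, ← ih]; ring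

theorem mul_pack {ι : Type*} (B c : ℤ) (f : ι → ℤ) (L : List ι) :
    c * pack B f L = pack B (fun i => c * f i) L := by
  induction L with
  | nil => simp [pack]
  | cons i L ih => rw [pack, pack, ← ih]; ring

theorem foldr_pack_add {α ι : Type*} (B : ℤ) (f : α → ι → ℤ) (L : List ι) (M : List α) :
    M.foldr (fun a n => pack B (f a) L + n) 0 =
      pack B (fun i => (M.map fun a => f a i).sum) L := by
  induction M with
  | nil =>
    induction L with
    | nil => rfl
    | cons i L ih =>
      rw [pack, ← ih]
      simp
  | cons a M ihM =>
    rw [List.foldr_cons, ihM]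
    clear ihM
    induction L with
    | nil => rfl
    | cons i L ih =>
      rw [pack, pack, pack, ← ih, List.map_cons, List.sum_cons]
      ring

theorem abs_pack_lt {ι : Type*} {B : ℤ} (hB : 0 < B) {f : ι → ℤ} {L : List ι}
    (h : ∀ i ∈ L, |f i| < B) : |pack B f L| < B ^ L.length := by
  induction L with
  | nil => simp [pack]
  | cons i L ih =>
    have h1 := abs_lt.mp (h i (by simp))
    have h2 := abs_lt.mp (ih fun j hj => h j (by simp [hj]))
    rw [pack, List.length_cons, pow_succ, abs_lt]
    constructor <;> nlinarith

/-- Digits are unique: reduction modulo `B` yields the first one, and small differences exclude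
carries. -/
theorem eq_of_pack_eq {ι : Type*} {B : ℤ} {f g : ι → ℤ} {L : List ι}
    (h : ∀ i ∈ L, |f i - g i| < B) (e : pack B f L = pack B g L) : ∀ i ∈ L, f i = g i := by
  induction L with
  | nil => simp
  | cons i L ih =>
    rw [pack, pack] at e
    have hd : B ∣ f i - g i := ⟨pack B g L - pack B f L, by linear_combination e⟩
    have h0 : f i = g i := sub_eq_zero.mp (Int.eq_zero_of_abs_lt_dvd hd (h i (by simp)))
    have hB : 0 < B := lt_of_le_of_lt (abs_nonneg _) (h i (by simp))
    have e' : pack B f L = pack B g L := by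
      rw [h0, add_right_inj] at e
      exact mul_left_cancel₀ hB.ne' e
    intro j hj
    rcases List.mem_cons.mp hj with rfl | hj
    · exact h0
    · exact ih (fun j hj => h j (by simp [hj])) e' j hj

theorem abs_sum_map_le {α : Type*} {f : α → ℤ} {C : ℤ} {M : List α} (h : ∀ a ∈ M, |f a| ≤ C) :
    |(M.map f).sum| ≤ M.length * C := by
  induction M with
  | nil => simp
  | cons a M ih =>
    rw [List.map_cons, List.sum_cons, List.length_cons]
    have h1 := h a (by simp)
    have h2 := ih fun b hb => h b (by simp [hb])
    have h3 := abs_add_le (f a) (M.map f).sum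
    push_cast
    linarith

theorem length_words : words.length = 1152 := by decide +kernel

/-! ## Products of the images of the paths -/

/-- The values of all paths, packed with a large base. -/
def outerValues : List ℤ :=
  (List.range 16).map fun m => pack (2 ^ 512) (fun b => value b m) basisList

/-- The values of all paths, packed with a small base. -/
def innerValues : List ℤ :=
  (List.range 16).map fun m => pack (2 ^ 32) (fun b => value b m) basisList

/-- The value of the product of two paths. -/
def productValue (b b' : Basis) (m : ℕ) : ℤ := (composite b b').elim 0 fun c => value c m

theorem abs_value_le : ∀ m < 16, ∀ b ∈ basisList, |value b m| ≤ 512 := by decide +kernel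

theorem abs_productValue_le : ∀ m < 16, ∀ b ∈ basisList, ∀ b' ∈ basisList,
    |productValue b b' m| ≤ 512 := by decide +kernel

theorem mem_basisList (b : Basis) : b ∈ basisList := by
  rcases b with b | b <;> cases b <;> simp [basisList]

-- For each `k`, all 256 products of two paths are computed at once. The inner base has room for one
-- convolution, and `2 ^ 512 = (2 ^ 32) ^ 16` for a whole row of 16.
set_option maxHeartbeats 4000000 in
theorem foldr_values_eq : ∀ k < 16,
    words.foldr (fun l n => outerValues.getD (negMask (acts l rho)) 0 *
      innerValues.getD (negMask (acts (longestWord k ++ l.reverse) rho)) 0 + n) 0 =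
    pack (2 ^ 512) (fun b => pack (2 ^ 32) (fun b' => 1152 * productValue b b' k) basisList)
      basisList := by
  intro k hk
  interval_cases k <;> decide +kernel

theorem sum_value_mul_value {k : ℕ} (hk : k < 16) (b b' : Basis) :
    (words.map fun l => value b (negMask (acts l rho)) *
      value b' (negMask (acts (longestWord k ++ l.reverse) rho))).sum =
      1152 * productValue b b' k := by
  have h := foldr_values_eq k hk
  have hmap : ∀ (B : ℤ) (v : Weight),
      ((List.range 16).map fun m => pack B (fun b => value b m) basisList).getD (negMask v) 0 =
        pack B (fun b => value b (negMask v)) basisList := by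
    intro B v
    rw [List.getD_eq_getElem _ _ (by simpa using negMask_lt v)]
    simp
  simp only [outerValues, innerValues, hmap, pack_mul] at h
  rw [foldr_pack_add] at h
  simp only [mul_pack] at h
  have hsum : ∀ b : Basis, (words.map fun l =>
      pack (2 ^ 32) (fun b' => value b (negMask (acts l rho)) *
      value b' (negMask (acts (longestWord k ++ l.reverse) rho))) basisList).sum =
      pack (2 ^ 32) (fun b' => (words.map fun l => value b (negMask (acts l rho)) *
        value b' (negMask (acts (longestWord k ++ l.reverse) rho))).sum) basisList := by
    intro b
    rw [← foldr_pack_add, List.sum, List.foldr_map]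
  simp only [hsum] at h
  have bound : ∀ b ∈ basisList, ∀ b' ∈ basisList,
      |(words.map fun l => value b (negMask (acts l rho)) *
        value b' (negMask (acts (longestWord k ++ l.reverse) rho))).sum -
        1152 * productValue b b' k| < 2 ^ 32 := by
    intro b hb b' hb'
    -- The base suffices because `1152 * 512 ^ 2 + 1152 * 512 < 2 ^ 32`.
    have h1 := abs_sum_map_le (M := words) (C := 512 * 512)
      (f := fun l => value b (negMask (acts l rho)) *
        value b' (negMask (acts (longestWord k ++ l.reverse) rho))) fun l _ => by
      rw [abs_mul]
      exact mul_le_mul (abs_value_le _ (negMask_lt _) b hb) (abs_value_le _ (negMask_lt _) b' hb')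
        (abs_nonneg _) (by norm_num)
    have h2 := abs_productValue_le k hk b hb b' hb'
    rw [length_words] at h1
    rw [abs_le] at h1 h2
    rw [abs_lt]
    constructor <;> push_cast at h1 <;> linarith
  have h' := eq_of_pack_eq (fun b hb => ?_) h b (mem_basisList b)
  · exact eq_of_pack_eq (bound b (mem_basisList b)) h' b' (mem_basisList b')
  · rw [pack_sub]
    refine (abs_pack_lt (by norm_num) (bound b hb)).trans_le (le_of_eq ?_)
    rw [← pow_mul]
    rfl

/-! ## The numbers `|X_K ∩ X_L^♯|` -/

/-- Whether the element of a word conjugates `s` to a simple reflection and does not have `s` as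
a left descent. -/
def conjBit (l : List (Fin 4)) (s : Fin 4) : Bool :=
  !isNeg ((acts l rho).coord s) &&
    [0, 1, 2, 3].any fun t => decide (acts l.reverse (act s rho) = act t (acts l.reverse rho))

/-- The set of the indices that satisfy `conjBit`, as a binary number. -/
def conjMask (l : List (Fin 4)) : ℕ :=
  (conjBit l 0).toNat + 2 * (conjBit l 1).toNat + 4 * (conjBit l 2).toNat +
    8 * (conjBit l 3).toNat

/-- The indicator functions of the sets of subsets of a given set, packed. -/
def subsetRows : List ℤ := (List.range 16).map fun c =>
  pack (2 ^ 16) (fun j => if j &&& c = j then 1 else 0) (List.range 16)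

/-- The entry of `multTable` at `K`, `L`. -/
def multValue (k j : ℕ) : ℤ := (multTable.getD k []).getD j 0

/-- One pass over the group counts all 256 entries. A word contributes to row `k` if its element
lies in `X_K`, namely the indicators of those subsets of `K` that it conjugates into the set of
simple reflections. Counts are at most 1152, so base `2 ^ 16` suffices, and `2 ^ 256 = (2 ^ 16) ^
16` holds a row. -/
theorem foldr_subsetRows_eq : words.foldr (fun l n => pack (2 ^ 256) (fun k =>
      if k &&& negMask (acts l rho) = 0 then subsetRows.getD (conjMask l &&& k) 0 else 0)
        (List.range 16) + n) 0 =
    pack (2 ^ 256) (fun k => pack (2 ^ 16) (fun j => multValue k j) (List.range 16))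
      (List.range 16) := by
  decide +kernel

theorem multValue_bound : ∀ k < 16, ∀ j < 16, 0 ≤ multValue k j ∧ multValue k j ≤ 1152 := by
  decide +kernel

theorem testBit_conjMask (l : List (Fin 4)) (i : Fin 4) :
    (conjMask l).testBit i = conjBit l i := by
  have h : ∀ b0 b1 b2 b3 : Bool, ∀ i : Fin 4,
      (b0.toNat + 2 * b1.toNat + 4 * b2.toNat + 8 * b3.toNat).testBit i =
        (![b0, b1, b2, b3] : Fin 4 → Bool) i := by decide
  rw [conjMask, h]
  fin_cases i <;> rfl

theorem sum_indicator_eq {k j : ℕ} (hk : k < 16) (hj : j < 16) :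
    (words.map fun l => if k &&& negMask (acts l rho) = 0 ∧ j &&& (conjMask l &&& k) = j
      then (1 : ℤ) else 0).sum = multValue k j := by
  have h := foldr_subsetRows_eq
  have hrow : ∀ (l : List (Fin 4)) (k : ℕ),
      (if k &&& negMask (acts l rho) = 0 then subsetRows.getD (conjMask l &&& k) 0 else 0) =
        pack (2 ^ 16) (fun j => if k &&& negMask (acts l rho) = 0 ∧ j &&& (conjMask l &&& k) = j
          then 1 else 0) (List.range 16) := by
    intro l k
    have hlt : conjMask l &&& k < 16 := by
      have h : ∀ b : Bool, b.toNat ≤ 1 := by decide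
      have := h (conjBit l 0)
      have := h (conjBit l 1)
      have := h (conjBit l 2)
      have := h (conjBit l 3)
      refine Nat.and_le_left.trans_lt ?_
      unfold conjMask
      omega
    by_cases h0 : k &&& negMask (acts l rho) = 0
    · rw [if_pos h0, subsetRows, List.getD_eq_getElem _ _ (by simpa using hlt)]
      simp only [h0, true_and, List.getElem_map, List.getElem_range]
    · simp only [h0, if_false, false_and]
      rfl
  simp only [hrow] at h
  rw [foldr_pack_add] at h
  have hsum : ∀ k : ℕ, (words.map fun l => pack (2 ^ 16)
      (fun j => if k &&& negMask (acts l rho) = 0 ∧ j &&& (conjMask l &&& k) = j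
        then (1 : ℤ) else 0) (List.range 16)).sum =
      pack (2 ^ 16) (fun j => (words.map fun l => if k &&& negMask (acts l rho) = 0 ∧
        j &&& (conjMask l &&& k) = j then (1 : ℤ) else 0).sum) (List.range 16) := by
    intro k
    rw [← foldr_pack_add, List.sum, List.foldr_map]
  simp only [hsum] at h
  have bound : ∀ k < 16, ∀ j < 16,
      |(words.map fun l => if k &&& negMask (acts l rho) = 0 ∧ j &&& (conjMask l &&& k) = j
        then (1 : ℤ) else 0).sum - multValue k j| < 2 ^ 16 := by
    intro k hk j hj
    have h1 := abs_sum_map_le (M := words) (C := 1)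
      (f := fun l => if k &&& negMask (acts l rho) = 0 ∧ j &&& (conjMask l &&& k) = j
        then (1 : ℤ) else 0) fun l _ => by split <;> simp
    have h2 := multValue_bound k hk j hj
    rw [length_words, abs_le] at h1
    rw [abs_lt]
    constructor <;> push_cast at h1 <;> linarith
  have h' := eq_of_pack_eq (fun k hk => ?_) h k (List.mem_range.mpr hk)
  · exact eq_of_pack_eq (fun j hj => bound k hk j (List.mem_range.mp hj)) h' j
      (List.mem_range.mpr hj)
  · rw [pack_sub]
    refine (abs_pack_lt (by norm_num)
      fun j hj => bound k (List.mem_range.mp hk) j (List.mem_range.mp hj)).trans_le (le_of_eq ?_)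
    rw [← pow_mul]
    rfl

/-- The elements `e_L` solve the equations that define them. -/
theorem sum_multValue_mul_eValue : ∀ k < 16, ∀ m < 16,
    (List.range 16).foldr (fun j n => multValue k j * eValue j m + n) 0 =
      if k &&& m = 0 then 1152 else 0 := by
  decide +kernel

end TypeF4

namespace TypeF4

open Weight
open Descent hiding act

/-! ## Elements of the group algebra with coefficients that depend on the descent set -/

section Coxeter

variable {W : Type*} [Group W] (cs : CoxeterSystem CoxeterMatrix.F₄ W)

theorem rightMask_lt (w : W) : rightMask cs w < 16 := leftMask_lt cs _

theorem mem_X_maskSet {k : ℕ} (hk : k < 16) {x : W} :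
    x ∈ X cs (maskSet k) ↔ k &&& leftMask cs x = 0 := by
  have key : ∀ k < 16, ∀ m < 16,
      k &&& m = 0 ↔ ∀ i : Fin 4, k.testBit i → ¬ m.testBit i := by decide +kernel
  rw [key k hk _ (leftMask_lt cs x)]
  refine forall_congr' fun i => ?_
  rw [mem_maskSet, testBit_leftMask]
  have := cs.length_simple_mul_ne x i
  exact imp_congr_right fun _ => by omega

theorem rightMask_wordProd_longestWord {k : ℕ} (hk : k < 16) :
    rightMask cs (cs.wordProd (longestWord k)) = k := by
  have key : ∀ k < 16, negMask (acts (longestWord k).reverse rho) = k := by decide +kernel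
  rw [rightMask, leftMask, ← cs.wordProd_reverse, weightHom_wordProd, key k hk]

theorem conjBit_iff (l : List (Fin 4)) (s : Fin 4) : conjBit l s ↔
    cs.length (cs.wordProd l) < cs.length (cs.simple s * cs.wordProd l) ∧
      ∃ t, cs.simple t = (cs.wordProd l)⁻¹ * cs.simple s * cs.wordProd l := by
  have h : ∀ t, acts l.reverse (act s rho) = act t (acts l.reverse rho) ↔
      cs.simple t = (cs.wordProd l)⁻¹ * cs.simple s * cs.wordProd l := by
    intro t
    have h1 : acts l.reverse (act s rho) = acts (l.reverse ++ [s]) rho := by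
      rw [acts_append]
      rfl
    have h2 : act t (acts l.reverse rho) = acts (t :: l.reverse) rho := rfl
    rw [h1, h2, ← wordProd_eq_iff cs, cs.wordProd_cons, cs.wordProd_append, cs.wordProd_singleton,
      cs.wordProd_reverse, eq_comm, mul_inv_eq_iff_eq_mul]
  rw [lt_length_simple_mul_iff, weightHom_wordProd, conjBit, isNeg_eq, Bool.and_eq_true,
    Bool.not_eq_true', decide_eq_false_iff_not]
  refine and_congr_right fun _ => ?_
  simp only [List.any_cons, List.any_nil, Bool.or_eq_true, decide_eq_true_eq, h, Bool.or_false,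
    Fin.exists_fin_succ, Fin.exists_fin_zero, or_false]
  rfl

theorem mem_XSharp_maskSet {j : ℕ} (l : List (Fin 4)) :
    cs.wordProd l ∈ XSharp cs (maskSet j) ↔ ∀ i : Fin 4, j.testBit i → conjBit l i := by
  simp only [conjBit_iff cs, ← mem_maskSet]
  exact ⟨fun h i hi => ⟨h.1 i hi, h.2 i hi⟩, fun h => ⟨fun i hi => (h i hi).1,
    fun i hi => (h i hi).2⟩⟩

variable [Fintype W]

/-- The element of the group algebra whose coefficients are given by a function of the right
descent set. -/
noncomputable def descentElt (f : ℕ → ℚ) : MonoidAlgebra ℚ W :=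
  ∑ w : W, MonoidAlgebra.single w (f (rightMask cs w))

theorem descentElt_congr {f g : ℕ → ℚ} (h : ∀ m < 16, f m = g m) :
    descentElt cs f = descentElt cs g :=
  Finset.sum_congr rfl fun w _ => by rw [h _ (rightMask_lt cs w)]

theorem descentElt_add (f g : ℕ → ℚ) :
    descentElt cs (fun m => f m + g m) = descentElt cs f + descentElt cs g := by
  rw [descentElt, descentElt, descentElt, ← Finset.sum_add_distrib]
  exact Finset.sum_congr rfl fun w _ => MonoidAlgebra.single_add _ _ _

theorem descentElt_smul (c : ℚ) (f : ℕ → ℚ) :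
    descentElt cs (fun m => c * f m) = c • descentElt cs f := by
  rw [descentElt, descentElt, Finset.smul_sum]
  exact Finset.sum_congr rfl fun w _ => by rw [MonoidAlgebra.smul_single, smul_eq_mul]

theorem descentElt_zero : descentElt cs (fun _ => 0) = 0 := by
  simp [descentElt]

theorem descentElt_sum {ι : Type*} (s : Finset ι) (f : ι → ℕ → ℚ) :
    descentElt cs (fun m => ∑ i ∈ s, f i m) = ∑ i ∈ s, descentElt cs (f i) := by
  classical
  induction s using Finset.induction_on with
  | empty => simpa using descentElt_zero cs
  | insert i s hi ih =>
    rw [Finset.sum_insert hi, ← ih, ← descentElt_add]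
    simp only [Finset.sum_insert hi]

theorem coeff_descentElt (f : ℕ → ℚ) (w : W) :
    (descentElt cs f).coeff w = f (rightMask cs w) := by
  classical
  rw [descentElt, MonoidAlgebra.coeff_sum, Finsupp.finsetSum_apply]
  simp [Finsupp.single_apply]

theorem eq_of_descentElt_eq {f g : ℕ → ℚ} (h : descentElt cs f = descentElt cs g) {k : ℕ}
    (hk : k < 16) : f k = g k := by
  have := coeff_descentElt cs f (cs.wordProd (longestWord k))
  rwa [h, coeff_descentElt, rightMask_wordProd_longestWord cs hk, eq_comm] at this

/-- The coefficient of the product at `w` depends only on the right descent set of `w`, so the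
hypothesis need only speak of the 16 longest elements. -/
theorem descentElt_mul {f g h : ℕ → ℚ}
    (e : ∀ k < 16, (words.map fun l => f (negMask (acts l rho)) *
      g (negMask (acts (longestWord k ++ l.reverse) rho))).sum = h k) :
    descentElt cs f * descentElt cs g = descentElt cs h := by
  have e' : ∀ w : W, h (rightMask cs w) =
      ∑ a, f (rightMask cs a) * g (rightMask cs (a⁻¹ * w)) := by
    intro w
    rw [← e _ (rightMask_lt cs w), ← sum_longest_eq cs f g (rightMask_lt cs w),
      ← sum_eq_sum_longest, ← Equiv.sum_comp (Equiv.inv W)]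
    exact Finset.sum_congr rfl fun a _ => by
      rfl
  simp only [descentElt, e', Finset.sum_mul_sum, MonoidAlgebra.single_mul_single]
  have single_sum : ∀ (w : W) (F : W → ℚ),
      MonoidAlgebra.single w (∑ a, F a) = ∑ a, MonoidAlgebra.single w (F a) :=
    fun w F => map_sum (MonoidAlgebra.singleAddHom w) F Finset.univ
  simp only [single_sum]
  rw [Finset.sum_comm (γ := W) (f := fun w a =>
    MonoidAlgebra.single w (f (rightMask cs a) * g (rightMask cs (a⁻¹ * w))))]
  refine Finset.sum_congr rfl fun a _ => ?_
  rw [← Equiv.sum_comp (Equiv.mulLeft a) fun w =>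
    MonoidAlgebra.single w (f (rightMask cs a) * g (rightMask cs (a⁻¹ * w)))]
  exact Finset.sum_congr rfl fun c _ => by simp

theorem xElt_maskSet {k : ℕ} (hk : k < 16) :
    xElt cs (maskSet k) = descentElt cs fun m => if k &&& m = 0 then 1 else 0 := by
  classical
  rw [xElt, finsum_mem_def, finsum_eq_sum_of_fintype, ← Equiv.sum_comp (Equiv.inv W), descentElt]
  refine Finset.sum_congr rfl fun w _ => ?_
  rw [Equiv.inv_apply, rightMask]
  by_cases h : k &&& leftMask cs w⁻¹ = 0
  · rw [if_pos h, Set.indicator_of_mem ((mem_X_maskSet cs hk).mpr h), inv_inv]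
    rfl
  · rw [if_neg h, Set.indicator_of_notMem (mt (mem_X_maskSet cs hk).mp h),
      MonoidAlgebra.single_zero]

/-! ## The images of the paths -/

/-- The image of a path in the group algebra. -/
noncomputable def pathElt (b : Basis) : MonoidAlgebra ℚ W :=
  descentElt cs fun m => (1 / 1152 : ℚ) * value b m

theorem pathElt_mul (b b' : Basis) :
    pathElt cs b * pathElt cs b' = (composite b b').elim 0 (pathElt cs) := by
  have h : pathElt cs b * pathElt cs b' =
      descentElt cs fun m => (1 / 1152 : ℚ) * productValue b b' m := by
    refine descentElt_mul cs fun k hk => ?_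
    have := congrArg (Int.cast (R := ℚ)) (sum_value_mul_value hk b b')
    rw [Int.cast_list_sum, List.map_map] at this
    have e : ∀ l : List (Fin 4), (1 / 1152 : ℚ) * value b (negMask (acts l rho)) *
        ((1 / 1152 : ℚ) * value b' (negMask (acts (longestWord k ++ l.reverse) rho))) =
        (1 / 1152 * (1 / 1152)) * (Int.cast ∘ fun l => value b (negMask (acts l rho)) *
          value b' (negMask (acts (longestWord k ++ l.reverse) rho))) l := by
      intro l
      simp only [Function.comp, Int.cast_mul]
      ring
    simp only [e]
    rw [List.sum_map_mul_left, this]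
    push_cast
    ring
  rw [h]
  unfold productValue
  cases composite b b' with
  | none => simpa using descentElt_zero cs
  | some c => rfl

/-- The identity of the group algebra is $x_S$, since only the identity of the group has no
descents. -/
theorem sum_pathElt_vertex : ∑ v, pathElt cs (.inl v) = 1 := by
  have key : ∀ m < 16, ∑ v, value (.inl v) m = if 15 &&& m = 0 then 1152 else 0 := by
    decide +kernel
  have h1 : (1 : MonoidAlgebra ℚ W) = xElt cs (maskSet 15) := by
    rw [xElt_maskSet cs (by norm_num), descentElt, Finset.sum_eq_single 1]
    · have : rightMask cs (1 : W) = 0 := by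
        rw [rightMask, leftMask, inv_one, weightHom_one]
        rfl
      rw [this]
      rfl
    · intro w _ hw
      rw [if_neg, MonoidAlgebra.single_zero]
      intro h
      refine hw (inv_eq_one.mp ?_)
      by_contra hne
      obtain ⟨i, hi⟩ := cs.exists_leftDescent_of_ne_one hne
      rw [CoxeterSystem.IsLeftDescent, ← testBit_leftMask] at hi
      have key : ∀ m < 16, 15 &&& m = 0 → m = 0 := by decide +kernel
      rw [← rightMask, key _ (rightMask_lt cs w) h, Nat.zero_testBit] at hi
      exact absurd hi (by simp)
    · simp
  rw [h1, xElt_maskSet cs (by norm_num)]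
  simp only [pathElt]
  rw [← descentElt_sum]
  refine descentElt_congr cs fun m hm => ?_
  rw [← Finset.mul_sum, ← Int.cast_sum, key m hm]
  split <;> norm_num

/-! ## The elements `e_L` -/

theorem mMat_maskSet {k j : ℕ} (hk : k < 16) (hj : j < 16) :
    mMat cs (maskSet k) (maskSet j) = multValue k j := by
  classical
  have hsub : maskSet j ⊆ maskSet k ↔ ∀ i : Fin 4, j.testBit i → k.testBit i := by
    simp only [Finset.subset_iff, mem_maskSet]
  have key : ∀ j < 16, ∀ c < 16, j &&& c = j ↔ ∀ i : Fin 4, j.testBit i → c.testBit i := by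
    decide +kernel
  have hcond : ∀ l : List (Fin 4), (k &&& negMask (acts l rho) = 0 ∧ j &&& (conjMask l &&& k) = j) ↔
      maskSet j ⊆ maskSet k ∧ cs.wordProd l ∈ X cs (maskSet k) ∩ XSharp cs (maskSet j) := by
    intro l
    have hlt : conjMask l &&& k < 16 := Nat.and_le_right.trans_lt hk
    rw [Set.mem_inter_iff, mem_XSharp_maskSet cs, mem_X_maskSet cs hk, leftMask,
      weightHom_wordProd, hsub, key j hj _ hlt]
    simp only [Nat.testBit_and, testBit_conjMask, Bool.and_eq_true, imp_and, forall_and]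
    tauto
  have h := congrArg (Int.cast (R := ℚ)) (sum_indicator_eq hk hj)
  rw [← h, Int.cast_list_sum, List.map_map, mMat, Matrix.of_apply]
  simp only [hcond, Function.comp_def]
  rw [← sum_eq_sum_words cs fun w => (((if maskSet j ⊆ maskSet k ∧
    w ∈ X cs (maskSet k) ∩ XSharp cs (maskSet j) then (1 : ℤ) else 0 : ℤ)) : ℚ)]
  by_cases hjk : maskSet j ⊆ maskSet k
  · simp only [hjk, true_and, if_true]
    rw [Nat.card_eq_fintype_card, Fintype.card_subtype]
    push_cast
    rw [Finset.sum_boole]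
  · simp [hjk]

/-- The matrix is triangular for inclusion, and its diagonal is nonzero because `1` lies in $X_K\cap
X_K^\sharp$. -/
theorem isUnit_mMat : IsUnit (mMat cs) := by
  rw [← Matrix.mulVec_injective_iff_isUnit, ← Matrix.coe_mulVecLin,
    ← LinearMap.ker_eq_bot, LinearMap.ker_eq_bot']
  intro v hv
  funext K
  induction K using Finset.strongInduction with
  | _ K ih =>
  have h := congrFun hv K
  rw [Matrix.mulVecLin_apply, Matrix.mulVec, dotProduct, Finset.sum_eq_single K] at h
  · rcases mul_eq_zero.mp h with h | h
    · rw [mMat, Matrix.of_apply, if_pos subset_rfl, Nat.cast_eq_zero, Nat.card_eq_zero] at h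
      have h1 : (1 : W) ∈ X cs K ∩ XSharp cs K := by
        have hX : (1 : W) ∈ X cs K := fun s _ => by simp
        exact ⟨hX, hX, fun s _ => ⟨s, by simp⟩⟩
      rcases h with h | h
      · exact (h.false ⟨1, h1⟩).elim
      · exact (not_finite (α := ↥(X cs K ∩ XSharp cs K))).elim
    · exact h
  · intro L _ hLK
    by_cases hsub : L ⊆ K
    · rw [ih L (hsub.ssubset_of_ne hLK), Pi.zero_apply, mul_zero]
    · rw [mMat, Matrix.of_apply, if_neg hsub, zero_mul]
  · simp

theorem sum_maskSet {N : Type*} [AddCommMonoid N] (F : Finset (Fin 4) → N) :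
    ∑ J, F J = ∑ k ∈ Finset.range 16, F (maskSet k) := by
  rw [← Finset.sum_image (g := maskSet) (f := F)]
  · congr 1
  · have : ∀ k < 16, ∀ k' < 16, maskSet k = maskSet k' → k = k' := by decide +kernel
    intro k hk k' hk' h
    exact this k (by simpa using hk) k' (by simpa using hk') h

/-- Any solution of the defining system is the solution, so the inverse matrix need not be computed.
-/
theorem eElt_eq_of_forall {G : Finset (Fin 4) → MonoidAlgebra ℚ W}
    (h : ∀ K, ∑ L, mMat cs K L • G L = xElt cs K) (L : Finset (Fin 4)) : eElt cs L = G L := by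
  rw [eElt]
  simp only [← h, Finset.smul_sum, smul_smul]
  rw [Finset.sum_comm]
  simp only [← Finset.sum_smul]
  have := (Matrix.isUnit_iff_isUnit_det _).mp (isUnit_mMat cs)
  have hinv : ∀ L', ∑ K, (mMat cs)⁻¹ L K * mMat cs K L' = if L = L' then 1 else 0 := fun L' => by
    rw [← Matrix.mul_apply, Matrix.nonsing_inv_mul _ this, Matrix.one_apply]
  simp [hinv]

theorem eElt_maskSet {j : ℕ} (hj : j < 16) :
    eElt cs (maskSet j) = descentElt cs fun m => (1 / 1152 : ℚ) * eValue j m := by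
  have hinj : ∀ k < 16, ∀ k' < 16, maskSet k = maskSet k' → k = k' := by decide +kernel
  choose idx hlt hidx using exists_maskSet_eq
  have hid : ∀ k < 16, idx (maskSet k) = k := fun k hk => hinj _ (hlt _) _ hk (hidx _)
  rw [eElt_eq_of_forall cs (G := fun L => descentElt cs fun m => (1 / 1152 : ℚ) * eValue (idx L) m),
    hid j hj]
  intro K
  obtain ⟨k, hk, rfl⟩ := exists_maskSet_eq K
  rw [sum_maskSet, xElt_maskSet cs hk]
  have : ∀ i ∈ Finset.range 16, mMat cs (maskSet k) (maskSet i) •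
      (descentElt cs fun m => (1 / 1152 : ℚ) * eValue (idx (maskSet i)) m) =
      descentElt cs fun m => multValue k i * ((1 / 1152 : ℚ) * eValue i m) := by
    intro i hi
    rw [Finset.mem_range] at hi
    rw [mMat_maskSet cs hk hi, hid i hi]
    exact (descentElt_smul cs _ _).symm
  rw [Finset.sum_congr rfl this, ← descentElt_sum]
  refine descentElt_congr cs fun m hm => ?_
  have h := congrArg (Int.cast (R := ℚ)) (sum_multValue_mul_eValue k hk m hm)
  have h2 : (List.range 16).foldr (fun j n => multValue k j * eValue j m + n) 0 =
      ∑ j ∈ Finset.range 16, multValue k j * eValue j m := by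
    rfl
  rw [h2] at h
  push_cast at h
  have h3 : ∑ i ∈ Finset.range 16, (multValue k i : ℚ) * (1 / 1152 * eValue i m) =
      1 / 1152 * ∑ j ∈ Finset.range 16, (multValue k j : ℚ) * eValue j m := by
    rw [Finset.mul_sum]
    exact Finset.sum_congr rfl fun i _ => by ring
  rw [h3, h]
  split <;> norm_num

end Coxeter

end TypeF4

namespace TypeF4

open Weight
open Descent hiding act

/-! ## Classes of subsets of the generators -/

/-- The class of a subset of the generators. -/
def classes : ℕ → List ℕ
  | 1 | 2 => [1, 2]
  | 4 | 8 => [4, 8]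
  | 5 | 9 | 10 => [5, 9, 10]
  | k => [k]

/-- The representative of a vertex. -/
def repMask : Vertex → ℕ
  | .empty => 0
  | .A1' => 1
  | .A1'' => 4
  | .A11 => 5
  | .A2' => 3
  | .A2'' => 12
  | .B2 => 6
  | .A21' => 11
  | .A21'' => 13
  | .B3' => 7
  | .B3'' => 14
  | .F4 => 15

theorem repMask_lt (v : Vertex) : repMask v < 16 := by cases v <;> decide

theorem maskSet_repMask (v : Vertex) : maskSet (repMask v) = rep v := by cases v <;> decide

theorem classes_lt : ∀ k < 16, ∀ j ∈ classes k, j < 16 := by decide +kernel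

theorem maskSet_injOn : ∀ k < 16, ∀ k' < 16, maskSet k = maskSet k' → k = k' := by decide +kernel

/-- The index of the simple reflection `s^x` if `x` is given by the word `l`. -/
def wordConj (l : List (Fin 4)) (s : Fin 4) : Fin 4 :=
  ([0, 1, 2, 3].find? fun t =>
    decide (acts (t :: l.reverse) rho = acts (l.reverse ++ [s]) rho)).getD s

/-- The orders of the products of two simple reflections. -/
def bond (i j : Fin 4) : ℕ := CoxeterMatrix.F₄ i j

section Coxeter

variable {W : Type*} [Group W] (cs : CoxeterSystem CoxeterMatrix.F₄ W)

include cs in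
theorem simple_injective : Function.Injective cs.simple := by
  intro i j h
  rw [← cs.wordProd_singleton, ← cs.wordProd_singleton, wordProd_eq_iff] at h
  revert i j
  decide +kernel

theorem simple_eq_conj_iff {l : List (Fin 4)} {s t : Fin 4} :
    cs.simple t = (cs.wordProd l)⁻¹ * cs.simple s * cs.wordProd l ↔
      acts (t :: l.reverse) rho = acts (l.reverse ++ [s]) rho := by
  rw [← wordProd_eq_iff cs, cs.wordProd_cons, cs.wordProd_append, cs.wordProd_singleton,
    cs.wordProd_reverse, mul_inv_eq_iff_eq_mul]

theorem simple_conjIndex {x : W} {s : Fin 4} (h : ∃ t, cs.simple t = x⁻¹ * cs.simple s * x) :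
    cs.simple (conjIndex cs x s) = x⁻¹ * cs.simple s * x := by
  have : @Classical.epsilon (Fin 4) ⟨s⟩ (fun t => cs.simple t = x⁻¹ * cs.simple s * x) =
    conjIndex cs x s := rfl
  rw [← this]
  exact @Classical.epsilon_spec_aux (Fin 4) ⟨s⟩ _ h

theorem conjIndex_wordProd {l : List (Fin 4)} {s t : Fin 4}
    (h : acts (t :: l.reverse) rho = acts (l.reverse ++ [s]) rho) :
    conjIndex cs (cs.wordProd l) s = t := by
  have h' := (simple_eq_conj_iff cs).mpr h
  exact simple_injective cs ((simple_conjIndex cs ⟨t, h'⟩).trans h'.symm)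

/-- The exact order, not merely a multiple of it, is what makes the bond a conjugation invariant. -/
theorem orderOf_simple_mul_simple (i j : Fin 4) :
    orderOf (cs.simple i * cs.simple j) = bond i j := by
  have hpow : ∀ n : ℕ, (cs.simple i * cs.simple j) ^ n =
      cs.wordProd (List.replicate n [i, j]).flatten := by
    intro n
    induction n with
    | zero => simp
    | succ n ih =>
      rw [pow_succ', ih, List.replicate_succ, List.flatten_cons, cs.wordProd_append,
        cs.wordProd_cons, cs.wordProd_singleton]
  have key : ∀ i j : Fin 4, 0 < bond i j ∧ ∀ m < bond i j, 0 < m →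
      acts (List.replicate m [i, j]).flatten rho ≠ acts [] rho := by
    decide +kernel
  rw [orderOf_eq_iff (key i j).1]
  refine ⟨cs.simple_mul_simple_pow i j, fun m hm hm0 => ?_⟩
  rw [hpow, ← cs.wordProd_nil, Ne, wordProd_eq_iff]
  exact (key i j).2 m hm hm0

/-- The linear character that distinguishes the two classes of reflections. -/
def color : W →* ℤˣ := cs.lift ⟨![-1, -1, 1, 1], by
  have : ∀ i j : Fin 4, ((![-1, -1, 1, 1] : Fin 4 → ℤˣ) i * (![-1, -1, 1, 1] : Fin 4 → ℤˣ) j) ^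
      CoxeterMatrix.F₄ i j = 1 := by decide
  exact this⟩

theorem color_simple (i : Fin 4) : color cs (cs.simple i) = (![-1, -1, 1, 1] : Fin 4 → ℤˣ) i :=
  cs.lift_apply_simple _ i

/-- Conjugation by `x` preserves the sign character `color` and the orders of products of two
reflections. A search through all maps of the four generators shows that these invariants leave only
the listed subsets. -/
theorem cls_maskSet {k : ℕ} (hk : k < 16) (K : Finset (Fin 4)) :
    K ∈ cls cs (maskSet k) ↔ ∃ j ∈ classes k, K = maskSet j := by
  constructor
  · rintro ⟨x, ⟨-, hx⟩, rfl⟩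
    have hσ : ∀ s ∈ maskSet k, cs.simple (conjIndex cs x s) = x⁻¹ * cs.simple s * x :=
      fun s hs => simple_conjIndex cs (hx s hs)
    have hcolor : ∀ s ∈ maskSet k, (conjIndex cs x s < 2 ↔ s < 2) := by
      intro s hs
      have h := congrArg (color cs) (hσ s hs)
      rw [map_mul, map_mul, map_inv, mul_comm, mul_inv_cancel_left, color_simple,
        color_simple] at h
      have key : ∀ i j : Fin 4, (![-1, -1, 1, 1] : Fin 4 → ℤˣ) i =
        (![-1, -1, 1, 1] : Fin 4 → ℤˣ) j → (i < 2 ↔ j < 2) := by decide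
      exact key _ _ h
    have horder : ∀ s ∈ maskSet k, ∀ s' ∈ maskSet k,
        bond (conjIndex cs x s) (conjIndex cs x s') = bond s s' := by
      intro s hs s' hs'
      rw [← orderOf_simple_mul_simple cs, ← orderOf_simple_mul_simple cs, hσ s hs, hσ s' hs']
      rw [← (MulAut.conj x⁻¹).orderOf_eq (cs.simple s * cs.simple s')]
      congr 1
      simp [mul_assoc]
    have key : ∀ k : Fin 16, ∀ σ : Fin 4 → Fin 4, (∀ s ∈ maskSet k, (σ s < 2 ↔ s < 2)) →
        (∀ s s' : Fin 4, s ∈ maskSet k → s' ∈ maskSet k → bond (σ s) (σ s') = bond s s') →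
        ∃ j ∈ classes k, (maskSet k).image σ = maskSet j := by
      decide +kernel
    exact key ⟨k, hk⟩ _ hcolor fun s s' hs hs' => horder s hs s' hs'
  · rintro ⟨j, hj, rfl⟩
    -- These words exchange reflections inside the two components `{0, 1}` and `{2, 3}` of type
    -- $A_2$, separately or together.
    have key : ∀ k < 16, ∀ j ∈ classes k, ∃ l ∈ [[], [1, 0], [0, 1], [3, 2], [2, 3], [3, 2, 1, 0],
        [0, 1, 2, 3]], (∀ i ∈ maskSet k, conjBit l i ∧
          acts (wordConj l i :: l.reverse) rho = acts (l.reverse ++ [i]) rho) ∧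
        maskSet j = (maskSet k).image (wordConj l) := by
      decide +kernel
    obtain ⟨l, -, hl, hjk⟩ := key k hk j hj
    refine ⟨cs.wordProd l, (mem_XSharp_maskSet cs l).mpr fun i hi =>
      (hl i (mem_maskSet.mpr hi)).1, ?_⟩
    rw [hjk]
    exact Finset.image_congr fun i hi => (conjIndex_wordProd cs (hl i hi).2).symm

theorem mem_classes_iff {k j : ℕ} (hk : k < 16) (hj : j < 16) :
    maskSet j ∈ cls cs (maskSet k) ↔ j ∈ classes k := by
  rw [cls_maskSet cs hk]
  constructor
  · rintro ⟨j', hj', h⟩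
    rwa [maskSet_injOn j hj j' (classes_lt k hk j' hj') h]
  · exact fun h => ⟨j, h, rfl⟩

theorem vertex_eq_of_cls_eq {v w : Vertex} (h : cls cs (rep v) = cls cs (rep w)) : v = w := by
  rw [← maskSet_repMask, ← maskSet_repMask] at h
  have h1 := (mem_classes_iff cs (repMask_lt v) (repMask_lt v)).mpr (by cases v <;> decide)
  rw [h, mem_classes_iff cs (repMask_lt w) (repMask_lt v)] at h1
  have key : ∀ v w, repMask v ∈ classes (repMask w) → v = w := by decide +kernel
  exact key v w h1

theorem exists_vertex_cls_eq (J : Finset (Fin 4)) : ∃ v, cls cs J = cls cs (rep v) := by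
  obtain ⟨k, hk, rfl⟩ := exists_maskSet_eq J
  have key : ∀ k < 16, ∃ v, classes k = classes (repMask v) := by decide +kernel
  obtain ⟨v, hv⟩ := key k hk
  refine ⟨v, Set.ext fun K => ?_⟩
  rw [cls_maskSet cs hk, ← maskSet_repMask, cls_maskSet cs (repMask_lt v), hv]

theorem eClass_rep [Fintype W] (v : Vertex) : eClass cs (rep v) = pathElt cs (.inl v) := by
  classical
  rw [← maskSet_repMask, eClass, Finset.sum_filter, sum_maskSet]
  have h : ∀ j ∈ Finset.range 16, (if maskSet j ∈ cls cs (maskSet (repMask v)) then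
      eElt cs (maskSet j) else 0) = descentElt cs fun m =>
        (1 / 1152 : ℚ) * (if j ∈ classes (repMask v) then eValue j m else 0 : ℤ) := by
    intro j hj
    rw [Finset.mem_range] at hj
    rw [mem_classes_iff cs (repMask_lt v) hj]
    split
    · exact eElt_maskSet cs hj
    · simpa using (descentElt_zero cs).symm
  rw [Finset.sum_congr rfl h, ← descentElt_sum, pathElt]
  refine descentElt_congr cs fun m hm => ?_
  have key : ∀ v, ∀ m < 16, ∑ j ∈ Finset.range 16,
      (if j ∈ classes (repMask v) then eValue j m else 0) = value (.inl v) m := by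
    decide +kernel
  rw [← Finset.mul_sum, ← Int.cast_sum, key v m hm]

/-! ## Streets -/

/-- Evaluates the action through a proposed map `σ`, once the weights confirm that `σ` is
conjugation by $d=w_Lw_{L\cup\{r\}}$ on `L`. The equations for `p` and `q` accommodate any way of
writing the paths. -/
theorem act_maskSet {k k' : ℕ} (hk : k < 16) (hk' : k' < 16) {r : Fin 4}
    (h : insert r (maskSet k) = maskSet k') (σ : Fin 4 → Fin 4) {ts : List (Fin 4)}
    (hts : ∀ t ∈ ts, t ∈ maskSet k) {p q : SPath (Fin 4)} (hp : p = (maskSet k, ts))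
    (hq : ((maskSet k).image σ, ts.map σ) = q)
    (hσ : ∀ s ∈ maskSet k, acts (σ s :: (longestWord k ++ longestWord k').reverse) rho =
      acts ((longestWord k ++ longestWord k').reverse ++ [s]) rho) :
    Descent.act cs p r = q := by
  subst hp hq
  have hd : longest cs (maskSet k) * longest cs (insert r (maskSet k)) =
      cs.wordProd (longestWord k ++ longestWord k') := by
    rw [h, longest_maskSet cs hk, longest_maskSet cs hk', cs.wordProd_append]
  rw [Descent.act]
  simp only [hd]
  refine Prod.ext ?_ ?_
  · exact Finset.image_congr fun s hs => conjIndex_wordProd cs (hσ s hs)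
  · exact List.map_congr_left fun t ht => conjIndex_wordProd cs (hσ t (hts t ht))

theorem street_eq_singleton {p : SPath (Fin 4)} (h : ∀ r, Descent.act cs p r = p) :
    street cs p = {p} := by
  ext q
  rw [Set.mem_singleton_iff]
  constructor
  · rintro ⟨rs, rfl⟩
    induction rs with
    | nil => rfl
    | cons r rs ih => rwa [List.foldl_cons, h]
  · rintro rfl
    exact ⟨[], rfl⟩

theorem DeltaStreet_eq_Delta {p : SPath (Fin 4)} (h : ∀ r, Descent.act cs p r = p) :
    DeltaStreet cs p = Delta cs p := by
  rw [DeltaStreet, street_eq_singleton cs h, finsum_mem_singleton]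

/-- If $r\in L$, then $d=w_L^2=1$. Otherwise $L$ has type $B_3$, and $d$ is the product of the
central longest elements of $W_L$ and $W$, so it centralises $W_L$. The paths that label the edges
are therefore alone in their streets. -/
theorem act_maskSet_eq_self {k : ℕ} (hk : k = 7 ∨ k = 14 ∨ k = 15) {ts : List (Fin 4)}
    (hts : ∀ t ∈ ts, t ∈ maskSet k) (r : Fin 4) :
    Descent.act cs (maskSet k, ts) r = (maskSet k, ts) := by
  have hk16 : k < 16 := by omega
  have key : ∀ k < 16, k = 7 ∨ k = 14 ∨ k = 15 → ∀ r : Fin 4, ∃ k' < 16,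
      insert r (maskSet k) = maskSet k' ∧ ∀ s ∈ maskSet k,
        acts (s :: (longestWord k ++ longestWord k').reverse) rho =
          acts ((longestWord k ++ longestWord k').reverse ++ [s]) rho := by
    decide +kernel
  obtain ⟨k', hk', h, hσ⟩ := key k hk16 hk r
  exact act_maskSet cs hk16 hk' h id hts rfl (by rw [Finset.image_id, List.map_id]) hσ

theorem delta_single_cons (L : Finset (Fin 4)) (s : Fin 4) (ts : List (Fin 4)) :
    delta cs (Finsupp.single (L, s :: ts) 1) =
      Finsupp.single (L.erase s, ts) 1 - Finsupp.single (Descent.act cs (L.erase s, ts) s) 1 := by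
  rw [delta, Finsupp.lift_apply, Finsupp.sum_single_index] <;> simp

theorem zeroPathMap_single (p : SPath (Fin 4)) :
    zeroPathMap cs (Finsupp.single p 1) = eElt cs p.1 := by
  rw [zeroPathMap, Finsupp.lift_apply, Finsupp.sum_single_index] <;> simp

theorem Delta_pair {L L₁ L₂ L₃ : Finset (Fin 4)} {s t t' : Fin 4}
    (h₁ : Descent.act cs (L.erase s, [t]) s = (L₁, [t']))
    (h₂ : Descent.act cs ((L.erase s).erase t, []) t = (L₂, []))
    (h₃ : Descent.act cs (L₁.erase t', []) t' = (L₃, [])) :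
    Delta cs (L, [s, t]) = eElt cs ((L.erase s).erase t) - eElt cs L₂ -
      (eElt cs (L₁.erase t') - eElt cs L₃) := by
  rw [Delta, List.length_cons, List.length_singleton, pow_two, Module.End.mul_apply,
    delta_single_cons, h₁, map_sub, delta_single_cons, delta_single_cons, h₂, h₃]
  simp only [map_sub, zeroPathMap_single]

/-- For each labelling path the two differences produced by $\delta^2$ are opposite to each other;
this is the origin of the coefficients `2` and `-2`. -/
theorem pathElt_arrow [Fintype W] {α : Arrow} {i j : ℕ} (hi : i < 16) (hj : j < 16)
    (h : expansion (.inr α) = [(2, i), (-2, j)]) :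
    eElt cs (maskSet i) - eElt cs (maskSet j) - (eElt cs (maskSet j) - eElt cs (maskSet i)) =
      pathElt cs (.inr α) := by
  have : ∀ x y : MonoidAlgebra ℚ W, x - y - (y - x) = (2 : ℚ) • x + (-2 : ℚ) • y := by
    intro x y
    rw [two_smul, neg_smul, two_smul]
    abel
  rw [this, eElt_maskSet cs hi, eElt_maskSet cs hj, ← descentElt_smul, ← descentElt_smul,
    ← descentElt_add]
  refine descentElt_congr cs fun m _ => ?_
  simp only [value, h, List.foldr]
  push_cast
  ring

theorem DeltaStreet_arrow [Fintype W] (α : Arrow) :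
    DeltaStreet cs (edgePath α.edge) = pathElt cs (.inr α) := by
  cases α with
  | a₁ =>
    change DeltaStreet cs (Finset.univ, [1, 2]) = _
    rw [show (Finset.univ : Finset (Fin 4)) = maskSet 15 by decide,
      DeltaStreet_eq_Delta cs (act_maskSet_eq_self cs (by norm_num) (by decide)),
      Delta_pair cs (L₁ := maskSet 13) (L₂ := maskSet 5) (L₃ := maskSet 9) (t' := 3)]
    · exact pathElt_arrow cs (i := 9) (j := 5) (by norm_num) (by norm_num) rfl
    · exact act_maskSet cs (r := 1) (ts := [2]) (k := 13) (k' := 15) (by norm_num) (by norm_num)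
        (by decide) ![0, 1, 3, 2] (by decide) (by decide) (by decide)
          (by decide +kernel)
    · exact act_maskSet cs (r := 2) (ts := []) (k := 9) (k' := 13) (by norm_num) (by norm_num)
        (by decide) ![0, 1, 3, 2] (by decide) (by decide) (by decide)
          (by decide +kernel)
    · exact act_maskSet cs (r := 3) (ts := []) (k := 5) (k' := 13) (by norm_num) (by norm_num)
        (by decide) ![0, 1, 3, 2] (by decide) (by decide) (by decide)
          (by decide +kernel)
  | a₂ =>
    change DeltaStreet cs (Finset.univ, [2, 0]) = _
    rw [show (Finset.univ : Finset (Fin 4)) = maskSet 15 by decide,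
      DeltaStreet_eq_Delta cs (act_maskSet_eq_self cs (by norm_num) (by decide)),
      Delta_pair cs (L₁ := maskSet 11) (L₂ := maskSet 9) (L₃ := maskSet 10) (t' := 1)]
    · exact pathElt_arrow cs (i := 10) (j := 9) (by norm_num) (by norm_num) rfl
    · exact act_maskSet cs (r := 2) (ts := [0]) (k := 11) (k' := 15) (by norm_num) (by norm_num)
        (by decide) ![1, 0, 2, 3] (by decide) (by decide) (by decide)
          (by decide +kernel)
    · exact act_maskSet cs (r := 0) (ts := []) (k := 10) (k' := 11) (by norm_num) (by norm_num)
        (by decide) ![1, 0, 2, 3] (by decide) (by decide) (by decide)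
          (by decide +kernel)
    · exact act_maskSet cs (r := 1) (ts := []) (k := 9) (k' := 11) (by norm_num) (by norm_num)
        (by decide) ![1, 0, 2, 3] (by decide) (by decide) (by decide)
          (by decide +kernel)
  | b' =>
    change DeltaStreet cs ({0, 1, 2}, [2, 0]) = _
    rw [show ({0, 1, 2} : Finset (Fin 4)) = maskSet 7 by decide,
      DeltaStreet_eq_Delta cs (act_maskSet_eq_self cs (by norm_num) (by decide)),
      Delta_pair cs (L₁ := maskSet 3) (L₂ := maskSet 1) (L₃ := maskSet 2) (t' := 1)]
    · exact pathElt_arrow cs (i := 2) (j := 1) (by norm_num) (by norm_num) rfl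
    · exact act_maskSet cs (r := 2) (ts := [0]) (k := 3) (k' := 7) (by norm_num) (by norm_num)
        (by decide) ![1, 0, 2, 3] (by decide) (by decide) (by decide)
          (by decide +kernel)
    · exact act_maskSet cs (r := 0) (ts := []) (k := 2) (k' := 3) (by norm_num) (by norm_num)
        (by decide) ![1, 0, 2, 3] (by decide) (by decide) (by decide)
          (by decide +kernel)
    · exact act_maskSet cs (r := 1) (ts := []) (k := 1) (k' := 3) (by norm_num) (by norm_num)
        (by decide) ![1, 0, 2, 3] (by decide) (by decide) (by decide)
          (by decide +kernel)
  | b'' =>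
    change DeltaStreet cs ({1, 2, 3}, [1, 2]) = _
    rw [show ({1, 2, 3} : Finset (Fin 4)) = maskSet 14 by decide,
      DeltaStreet_eq_Delta cs (act_maskSet_eq_self cs (by norm_num) (by decide)),
      Delta_pair cs (L₁ := maskSet 12) (L₂ := maskSet 4) (L₃ := maskSet 8) (t' := 3)]
    · exact pathElt_arrow cs (i := 8) (j := 4) (by norm_num) (by norm_num) rfl
    · exact act_maskSet cs (r := 1) (ts := [2]) (k := 12) (k' := 14) (by norm_num) (by norm_num)
        (by decide) ![0, 1, 3, 2] (by decide) (by decide) (by decide)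
          (by decide +kernel)
    · exact act_maskSet cs (r := 2) (ts := []) (k := 8) (k' := 12) (by norm_num) (by norm_num)
        (by decide) ![0, 1, 3, 2] (by decide) (by decide) (by decide)
          (by decide +kernel)
    · exact act_maskSet cs (r := 3) (ts := []) (k := 4) (k' := 12) (by norm_num) (by norm_num)
        (by decide) ![0, 1, 3, 2] (by decide) (by decide) (by decide)
          (by decide +kernel)

end Coxeter

end TypeF4

namespace TypeF4

open Weight
open Descent hiding act

/-! ## The types of the parabolic subgroups -/

/-- An entry of a Coxeter matrix. -/
def entry {B : Type*} (M : CoxeterMatrix B) (i j : B) : ℕ := M i j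

theorem hasType_of_injective {B ι : Type*} {M : CoxeterMatrix B} {J : Finset B}
    {N : CoxeterMatrix ι} (f : ι → B) (hf : Function.Injective f) (hJ : ∀ x, x ∈ J ↔ ∃ i, f i = x)
    (h : ∀ i j, entry M (f i) (f j) = entry N i j) : CoxType.HasType M J N :=
  ⟨Equiv.ofBijective (fun i => ⟨f i, (hJ _).mpr ⟨i, rfl⟩⟩)
    ⟨fun _ _ hij => hf (congrArg Subtype.val hij),
      fun ⟨x, hx⟩ => ((hJ x).mp hx).imp fun _ hi => Subtype.ext hi⟩, h⟩

theorem hasType_rep (v : Vertex) : CoxType.HasType CoxeterMatrix.F₄ (rep v) (type v).2 := by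
  cases v
  · exact hasType_of_injective (N := CoxeterMatrix.A 0) ![]
      (by decide) (by decide) (by decide)
  · exact hasType_of_injective (N := CoxeterMatrix.A 1) ![0]
      (by decide) (by decide) (by decide)
  · exact hasType_of_injective (N := CoxeterMatrix.A 1) ![2]
      (by decide) (by decide) (by decide)
  · exact hasType_of_injective (N := CoxType.prod (CoxeterMatrix.A 1) (CoxeterMatrix.A 1))
      (Sum.elim ![0] ![2])
      (by decide) (by decide) (by decide)
  · exact hasType_of_injective (N := CoxeterMatrix.A 2) ![0, 1]
      (by decide) (by decide) (by decide)
  · exact hasType_of_injective (N := CoxeterMatrix.A 2) ![2, 3]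
      (by decide) (by decide) (by decide)
  · exact hasType_of_injective (N := CoxeterMatrix.B 2) ![1, 2]
      (by decide) (by decide) (by decide)
  · exact hasType_of_injective (N := CoxType.prod (CoxeterMatrix.A 2) (CoxeterMatrix.A 1))
      (Sum.elim ![0, 1] ![3])
      (by decide) (by decide) (by decide)
  · exact hasType_of_injective (N := CoxType.prod (CoxeterMatrix.A 2) (CoxeterMatrix.A 1))
      (Sum.elim ![2, 3] ![0])
      (by decide) (by decide) (by decide)
  · exact hasType_of_injective (N := CoxeterMatrix.B 3) ![0, 1, 2]
      (by decide) (by decide) (by decide)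
  · exact hasType_of_injective (N := CoxeterMatrix.B 3) ![3, 2, 1]
      (by decide) (by decide) (by decide)
  · exact hasType_of_injective (N := CoxeterMatrix.F₄) id
      (by decide) (by decide) (by decide)

/-! ## The path algebra -/

open PathAlg PathAlgebra

/-- The path that is labelled by an index. -/
def basisPath : Basis → TotalPath Vertex
  | .inl v => ⟨v, v, .nil⟩
  | .inr a => ⟨a.src, a.tgt, a.edge.toPath⟩

theorem basisPath_injective : Function.Injective basisPath := by
  rintro (v | a) (w | b) h
  · exact congrArg (fun p => Sum.inl p.src) h
  · have h1 := congrArg TotalPath.src h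
    have h2 := congrArg TotalPath.tgt h
    have h3 : v = b.src := h1
    have h4 : v = b.tgt := h2
    rw [h3] at h4
    cases b <;> cases h4
  · have h1 := congrArg TotalPath.src h
    have h2 := congrArg TotalPath.tgt h
    have h3 : a.src = w := h1
    have h4 : a.tgt = w := h2
    rw [← h3] at h4
    cases a <;> cases h4
  · have h1 := congrArg TotalPath.src h
    cases a <;> cases b <;> try first
      | rfl
      | cases h1
    all_goals
      simp only [basisPath, Arrow.src, Arrow.tgt, Arrow.edge, Quiver.Hom.toPath,
        TotalPath.mk.injEq, heq_eq_eq, Quiver.Path.cons.injEq, reduceCtorEq,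
        and_false] at h

theorem basisPath_surjective : Function.Surjective basisPath := by
  rintro ⟨v, w, p⟩
  cases p with
  | nil => exact ⟨.inl v, rfl⟩
  | cons q e =>
    -- No edge ends at the source of another, so there are no paths of length two.
    have hq : ∀ {u x y : Vertex} (q : Quiver.Path v u) (e : Edge u x) (f : Edge x y), False := by
      intro u x y _ e f
      cases e <;> cases f
    cases q with
    | nil =>
      change Edge _ _ at e
      cases e
      · exact ⟨.inr .a₁, rfl⟩
      · exact ⟨.inr .a₂, rfl⟩
      · exact ⟨.inr .b', rfl⟩
      · exact ⟨.inr .b'', rfl⟩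
    | cons q' e' => exact (hq q' e' e).elim

theorem mulPath_basisPath (b b' : Basis) : mulPath ℚ (basisPath b) (basisPath b') =
    (composite b b').elim 0 fun c => ofPath ℚ (basisPath c) := by
  rcases b with v | a <;> rcases b' with w | a'
  · by_cases h : v = w
    · subst h
      simp [basisPath, composite, mulPath]
    · simp [basisPath, composite, mulPath, h, Ne.symm h]
  · by_cases h : v = a'.src
    · subst h
      simp [basisPath, composite, mulPath, Quiver.Hom.toPath]
    · simp [basisPath, composite, mulPath, h, Ne.symm h]
  · by_cases h : w = a.tgt
    · subst h
      simp [basisPath, composite, mulPath]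
    · simp [basisPath, composite, mulPath, h]
  · have : a'.src ≠ a.tgt := by cases a <;> cases a' <;> decide
    simp [basisPath, composite, mulPath, this]

/-- The labelling of the paths. -/
noncomputable def pathEquiv : Basis ≃ TotalPath Vertex :=
  Equiv.ofBijective basisPath ⟨basisPath_injective, basisPath_surjective⟩

/-- The coordinates of the elements of the path algebra with respect to the paths. -/
noncomputable def pathRepr : PathAlgebra ℚ Vertex ≃ₗ[ℚ] (Basis →₀ ℚ) :=
  Finsupp.domLCongr (M := ℚ) (R := ℚ) pathEquiv.symm

/-- The basis of the path algebra that consists of the paths. -/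
noncomputable def pathBasis : Module.Basis Basis ℚ (PathAlgebra ℚ Vertex) := .ofRepr pathRepr

theorem pathBasis_apply (b : Basis) : pathBasis b = ofPath ℚ (basisPath b) := by
  rw [pathBasis, Module.Basis.coe_ofRepr]
  refine (LinearEquiv.symm_apply_eq _).mpr ?_
  refine Eq.trans ?_ (Finsupp.domLCongr_single (R := ℚ) pathEquiv.symm (basisPath b) (1 : ℚ)).symm
  rw [show basisPath b = pathEquiv b from rfl, Equiv.symm_apply_apply]

theorem pathBasis_mul (b b' : Basis) :
    pathBasis b * pathBasis b' = (composite b b').elim 0 pathBasis := by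
  rw [pathBasis_apply, pathBasis_apply, ofPath_mul_ofPath, mulPath_basisPath]
  cases composite b b' with
  | none => rfl
  | some c => exact (pathBasis_apply c).symm

theorem sum_pathBasis_vertex : ∑ v, pathBasis (.inl v) = 1 :=
  Finset.sum_congr rfl fun v _ => pathBasis_apply (.inl v)

/-! ### The homomorphism from the path algebra and its image. -/

section Coxeter

variable {W : Type*} [Group W] (cs : CoxeterSystem CoxeterMatrix.F₄ W) [Fintype W]

/-- The homomorphism from the path algebra to the group algebra. -/
noncomputable def pathHom : PathAlgebra ℚ Vertex →ₐ[ℚ] MonoidAlgebra ℚ W :=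
  AlgHom.ofLinearMap (pathBasis.constr ℚ (pathElt cs))
    (by
      rw [← sum_pathBasis_vertex, map_sum, ← sum_pathElt_vertex cs]
      simp only [Module.Basis.constr_basis])
    (by
      rw [LinearMap.map_mul_iff]
      refine pathBasis.ext fun b => pathBasis.ext fun b' => ?_
      rw [LinearMap.compr₂_apply, LinearMap.compl₂_apply, LinearMap.comp_apply,
        LinearMap.mul_apply', LinearMap.mul_apply', Module.Basis.constr_basis,
        Module.Basis.constr_basis, pathElt_mul, pathBasis_mul]
      cases composite b b' with
      | none => exact map_zero (pathBasis.constr ℚ (pathElt cs))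
      | some c => exact Module.Basis.constr_basis pathBasis ℚ (pathElt cs) c)

theorem pathHom_pathBasis (b : Basis) : pathHom cs (pathBasis b) = pathElt cs b :=
  Module.Basis.constr_basis pathBasis ℚ (pathElt cs) b

/-- The source of a path. -/
def basisSrc : Basis → Vertex := Sum.elim id Arrow.src

/-- The target of a path. -/
def basisTgt : Basis → Vertex := Sum.elim id Arrow.tgt

theorem vertex_mul_pathElt_mul_vertex (v w : Vertex) (b : Basis) :
    pathElt cs (.inl v) * pathElt cs b * pathElt cs (.inl w) =
      if basisSrc b = v ∧ basisTgt b = w then pathElt cs b else 0 := by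
  rw [pathElt_mul]
  rcases b with u | a
  · by_cases h : v = u
    · subst h
      by_cases h' : v = w
      · simp [composite, basisSrc, basisTgt, pathElt_mul, h']
      · simp [composite, basisSrc, basisTgt, pathElt_mul, h']
    · simp [composite, basisSrc, basisTgt, h, Ne.symm h]
  · by_cases h : v = a.src
    · subst h
      by_cases h' : w = a.tgt
      · simp [composite, basisSrc, basisTgt, pathElt_mul, h']
      · simp [composite, basisSrc, basisTgt, pathElt_mul, h', Ne.symm h']
    · simp [composite, basisSrc, basisTgt, h, Ne.symm h]

/-- Multiplying a relation on both sides by vertex idempotents leaves only the paths with given end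
points. Only the two parallel edges still have to be separated. -/
theorem linearIndependent_pathElt : LinearIndependent ℚ (pathElt cs) := by
  rw [Fintype.linearIndependent_iff]
  intro g hg b
  -- On the descent set `k` the value of `b` is nonzero, while any other path with the same end
  -- points has value zero.
  obtain ⟨k, hk, hb, hb'⟩ : ∃ k < 16, value b k ≠ 0 ∧ ∀ b', basisSrc b' = basisSrc b →
      basisTgt b' = basisTgt b → b' ≠ b → value b' k = 0 := by
    revert b
    decide +kernel
  have h := congrArg (fun x => pathElt cs (.inl (basisSrc b)) * x *
    pathElt cs (.inl (basisTgt b))) hg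
  simp only [Finset.mul_sum, Finset.sum_mul, mul_smul_comm, smul_mul_assoc,
    vertex_mul_pathElt_mul_vertex, mul_zero, zero_mul] at h
  have h' : ∀ b', (g b' • if basisSrc b' = basisSrc b ∧ basisTgt b' = basisTgt b then
      pathElt cs b' else 0) = descentElt cs fun m => g b' * if basisSrc b' = basisSrc b ∧
        basisTgt b' = basisTgt b then (1 / 1152 : ℚ) * value b' m else 0 := by
    intro b'
    rw [descentElt_smul]
    split
    · rfl
    · rw [descentElt_zero]
  rw [Finset.sum_congr rfl fun b' _ => h' b', ← descentElt_sum, ← descentElt_zero cs] at h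
  have h'' := eq_of_descentElt_eq cs h hk
  rw [Finset.sum_eq_single b] at h''
  · simpa [hb] using h''
  · intro b' _ hne
    split
    · next hh => simp [hb' b' hh.1 hh.2 hne]
    · exact mul_zero _
  · simp

theorem pathHom_injective : Function.Injective (pathHom cs) := by
  rw [injective_iff_map_eq_zero]
  intro x hx
  have h := linearIndependent_pathElt cs
  rw [Fintype.linearIndependent_iff] at h
  have h1 : pathHom cs x = ∑ b, pathBasis.repr x b • pathElt cs b := by
    conv_lhs => rw [← pathBasis.sum_repr x]
    simp only [map_sum, map_smul, pathHom_pathBasis]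
  rw [h1] at hx
  rw [← pathBasis.sum_repr x]
  exact Finset.sum_eq_zero fun b _ => by rw [h _ hx b, zero_smul]

omit [Fintype W] in
theorem eElt_mem_descentSpace (L : Finset (Fin 4)) : eElt cs L ∈ descentSpace cs :=
  Submodule.sum_mem _ fun K _ => Submodule.smul_mem _ _ (Submodule.subset_span ⟨K, rfl⟩)

theorem pathElt_mem_descentSpace (b : Basis) : pathElt cs b ∈ descentSpace cs := by
  classical
  rcases b with v | a
  · rw [← eClass_rep]
    exact Submodule.sum_mem _ fun L _ => eElt_mem_descentSpace cs L
  · obtain ⟨i, hi, j, hj, h⟩ : ∃ i < 16, ∃ j < 16, expansion (.inr a) = [(2, i), (-2, j)] := by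
      cases a <;> decide
    rw [← pathElt_arrow cs hi hj h]
    have (i j : ℕ) := Submodule.sub_mem _ (eElt_mem_descentSpace cs (maskSet i))
      (eElt_mem_descentSpace cs (maskSet j))
    exact Submodule.sub_mem _ (this i j) (this j i)

/-- Sixteen independent elements lie in a space spanned by the sixteen $x_J$. -/
theorem span_pathElt : Submodule.span ℚ (Set.range (pathElt cs)) = descentSpace cs := by
  have : FiniteDimensional ℚ ↥(descentSpace cs) :=
    FiniteDimensional.span_of_finite ℚ (Set.finite_range (xElt cs))
  refine Submodule.eq_of_le_of_finrank_le ?_ ?_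
  · rw [Submodule.span_le, Set.range_subset_iff]
    exact pathElt_mem_descentSpace cs
  · rw [finrank_span_eq_card (linearIndependent_pathElt cs)]
    exact finrank_range_le_card (xElt cs)

theorem toSubmodule_range_pathHom :
    Subalgebra.toSubmodule (pathHom cs).range = descentSpace cs := by
  have h : Subalgebra.toSubmodule (pathHom cs).range =
      Submodule.map (pathHom cs).toLinearMap ⊤ := by
    ext x
    simp
  rw [h, ← span_pathElt, ← pathBasis.span_eq, Submodule.map_span, ← Set.range_comp]
  congr 2
  exact funext fun b => pathHom_pathBasis cs b

end Coxeter

end TypeF4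

namespace TypeF4

/-! ## Modules over the path algebra -/

/-- A basis of an algebra that multiplies like the paths of the quiver. -/
structure PathBasis (D : Type*) [Ring D] [Algebra ℚ D] where
  basis : Module.Basis Basis ℚ D
  mul : ∀ b b', basis b * basis b' = (composite b b').elim 0 basis
  sum_vertex : ∑ v, basis (.inl v) = 1

namespace PathBasis

variable {D : Type*} [Ring D] [Algebra ℚ D] (β : PathBasis D)

theorem repr_mul_inl (r s : D) (v : Vertex) : β.basis.repr (r * s) (.inl v) =
    β.basis.repr r (.inl v) * β.basis.repr s (.inl v) := by
  have h : (LinearMap.mul ℚ D).compr₂ (β.basis.coord (.inl v)) =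
      (LinearMap.mul ℚ ℚ).compl₁₂ (β.basis.coord (.inl v)) (β.basis.coord (.inl v)) := by
    refine β.basis.ext fun b => β.basis.ext fun b' => ?_
    simp only [LinearMap.compr₂_apply, LinearMap.mul_apply', LinearMap.compl₁₂_apply, β.mul,
      Module.Basis.coord_apply, Module.Basis.repr_self, Finsupp.single_apply]
    rcases b with u | a <;> rcases b' with w | a' <;> simp only [composite]
    · by_cases h : u = w
      · subst h
        by_cases h' : u = v <;> simp [h']
      · by_cases h' : u = v
        · subst h'
          simp [h, Ne.symm h]
        · simp [h, h']
    · split <;> simp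
    · split <;> simp
    · simp
  exact congrArg (fun f => f r s) h

/-- An arrow is a product of two paths only as source times arrow or arrow times target, since
products of two arrows vanish. -/
theorem repr_mul_inr (r s : D) (a : Arrow) : β.basis.repr (r * s) (.inr a) =
    β.basis.repr r (.inl a.src) * β.basis.repr s (.inr a) +
      β.basis.repr r (.inr a) * β.basis.repr s (.inl a.tgt) := by
  have h : (LinearMap.mul ℚ D).compr₂ (β.basis.coord (.inr a)) =
      (LinearMap.mul ℚ ℚ).compl₁₂ (β.basis.coord (.inl a.src)) (β.basis.coord (.inr a)) +
      (LinearMap.mul ℚ ℚ).compl₁₂ (β.basis.coord (.inr a)) (β.basis.coord (.inl a.tgt)) := by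
    refine β.basis.ext fun b => β.basis.ext fun b' => ?_
    simp only [LinearMap.compr₂_apply, LinearMap.mul_apply', LinearMap.compl₁₂_apply, β.mul,
      LinearMap.add_apply, Module.Basis.coord_apply, Module.Basis.repr_self, Finsupp.single_apply]
    rcases b with u | c <;> rcases b' with w | d <;> simp only [composite]
    · split <;> simp
    · by_cases h : d = a
      · subst h
        by_cases h' : u = d.src <;> simp [h']
      · split <;> simp [h]
    · by_cases h : c = a
      · subst h
        by_cases h' : w = c.tgt <;> simp [h']
      · split <;> simp [h]
    · simp
  exact congrArg (fun f => f r s) h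

theorem repr_one_inl (v : Vertex) : β.basis.repr 1 (.inl v) = 1 := by
  rw [← β.sum_vertex, map_sum, Finsupp.finsetSum_apply]
  simp [Finsupp.single_apply]

/-- The character of the algebra that belongs to a vertex. -/
noncomputable def char (v : Vertex) : D →+* ℚ where
  toFun r := β.basis.repr r (.inl v)
  map_one' := β.repr_one_inl v
  map_mul' r s := β.repr_mul_inl r s v
  map_zero' := by simp
  map_add' := by simp

theorem char_apply (v : Vertex) (r : D) : β.char v r = β.basis.repr r (.inl v) := rfl

theorem char_basis_inl (v w : Vertex) : β.char w (β.basis (.inl v)) = if v = w then 1 else 0 := by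
  simp [char_apply, Finsupp.single_apply]

theorem char_algebraMap (v : Vertex) (q : ℚ) : β.char v (algebraMap ℚ D q) = q := by
  rw [Algebra.algebraMap_eq_smul_one, char_apply, map_smul, Finsupp.smul_apply, repr_one_inl,
    smul_eq_mul, mul_one]

/-- The one-dimensional module with the character of a vertex. -/
def Simple (_ : PathBasis D) (_ : Vertex) : Type := ℚ

noncomputable instance (v : Vertex) : AddCommGroup (β.Simple v) := inferInstanceAs (AddCommGroup ℚ)

noncomputable instance (v : Vertex) : Module D (β.Simple v) := Module.compHom ℚ (β.char v)

theorem smul_simple (v : Vertex) (r : D) (q : β.Simple v) :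
    r • q = (β.char v r * (show ℚ from q) : ℚ) := rfl

/-- The element `1` of a one-dimensional module. -/
def gen (v : Vertex) : β.Simple v := (1 : ℚ)

theorem gen_ne_zero (v : Vertex) : β.gen v ≠ 0 := one_ne_zero (α := ℚ)

theorem basis_smul_simple (v w : Vertex) (q : β.Simple w) :
    β.basis (.inl v) • q = if v = w then q else 0 := by
  rw [smul_simple, char_basis_inl]
  split
  · exact one_mul (M := ℚ) q
  · exact zero_mul (M₀ := ℚ) q

instance (v : Vertex) : IsSimpleModule D (β.Simple v) := by
  have : Nontrivial (β.Simple v) := inferInstanceAs (Nontrivial ℚ)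
  refine isSimpleModule_iff_toSpanSingleton_surjective.mpr ⟨this, fun m hm q => ?_⟩
  refine ⟨algebraMap ℚ D ((show ℚ from q) / (show ℚ from m)), ?_⟩
  rw [LinearMap.toSpanSingleton_apply, smul_simple, char_algebraMap]
  exact div_mul_cancel₀ (G₀ := ℚ) (show ℚ from q) hm

theorem eq_of_simple_equiv {v w : Vertex} (e : β.Simple v ≃ₗ[D] β.Simple w) : v = w := by
  by_contra h
  have h1 : e (β.gen v) = 0 := by
    have := β.basis_smul_simple v w (e (β.gen v))
    rwa [← map_smul, basis_smul_simple, if_pos rfl, if_neg h] at this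
  exact β.gen_ne_zero v (e.map_eq_zero_iff.mp h1)

/-! ### The Jacobson radical -/

theorem mul_eq_zero_of_char {x y : D} (hx : ∀ v, β.char v x = 0) (hy : ∀ v, β.char v y = 0) :
    x * y = 0 := by
  refine β.basis.ext_elem fun b => ?_
  rw [map_zero, Finsupp.zero_apply]
  rcases b with v | a
  · rw [repr_mul_inl, ← char_apply, hx, zero_mul]
  · rw [repr_mul_inr, ← char_apply, ← char_apply, hx, hy, zero_mul, mul_zero, add_zero]

theorem mem_jacobson {x : D} : x ∈ Ring.jacobson D ↔ ∀ v, β.char v x = 0 := by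
  constructor
  · intro hx v
    have h := Ring.jacobson_smul_top_le (R := D) (M := β.Simple v)
      (Submodule.smul_mem_smul hx (Submodule.mem_top (x := β.gen v)))
    rw [IsSemisimpleModule.jacobson_eq_bot, Submodule.mem_bot, smul_simple] at h
    exact (mul_one _).symm.trans h
  · intro hx
    rw [Ring.jacobson_eq_sInf_isMaximal, Submodule.mem_sInf]
    intro m hm
    have hm : Ideal.IsMaximal m := hm
    by_contra hxm
    -- If a maximal left ideal `m` misses `x`, then `1 = s + r x` with `s ∈ m`. As `x r x = 0`, this
    -- gives `x = x s ∈ m`.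
    have h1 : (1 : D) ∈ m ⊔ Ideal.span {x} := by
      rw [hm.out.2 _ (left_lt_sup.mpr fun h => hxm (h (Ideal.mem_span_singleton_self x)))]
      exact Submodule.mem_top
    obtain ⟨s, hs, y, hy, hsy⟩ := Submodule.mem_sup.mp h1
    obtain ⟨r, rfl⟩ := Submodule.mem_span_singleton.mp hy
    have h2 : x * (r • x) = 0 := by
      refine β.mul_eq_zero_of_char hx fun v => ?_
      rw [smul_eq_mul, map_mul, hx, mul_zero]
    have h3 : x = x * s := by
      conv_lhs => rw [← mul_one x, ← hsy, mul_add, h2, add_zero]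
    exact hxm (h3 ▸ m.smul_mem x hs)

include β in
theorem jacobson_smul_jacobson_smul {M : Type*} [AddCommGroup M] [Module D M] (N : Submodule D M) :
    Ring.jacobson D • Ring.jacobson D • N = ⊥ := by
  rw [eq_bot_iff, Submodule.smul_le]
  intro x hx n hn
  induction hn using Submodule.smul_induction_on' with
  | smul y hy n _ =>
    rw [smul_smul, β.mul_eq_zero_of_char (β.mem_jacobson.mp hx) (β.mem_jacobson.mp hy), zero_smul]
    exact Submodule.zero_mem _
  | add y _ z _ hy hz =>
    rw [smul_add]
    exact Submodule.add_mem _ hy hz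

/-! ### The projective indecomposable modules -/

/-- The left ideal generated by the idempotent of a vertex. -/
abbrev Proj (v : Vertex) : Type _ := ModRep.LeftIdeal (β.basis (.inl v))

/-- Left multiplication prepends paths, so the left ideal is spanned by the paths that end at `v`.
-/
theorem mem_proj_iff {v : Vertex} {x : D} : x ∈ Ideal.span {β.basis (.inl v)} ↔
    ∀ b, basisTgt b ≠ v → β.basis.repr x b = 0 := by
  constructor
  · intro hx b hb
    obtain ⟨r, rfl⟩ := Submodule.mem_span_singleton.mp hx
    rw [smul_eq_mul]
    rcases b with w | a
    · change w ≠ v at hb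
      rw [repr_mul_inl, Module.Basis.repr_self, Finsupp.single_apply,
        if_neg fun h => hb (Sum.inl.inj h).symm, mul_zero]
    · change a.tgt ≠ v at hb
      rw [repr_mul_inr, Module.Basis.repr_self, Finsupp.single_apply, Finsupp.single_apply,
        if_neg (by simp), if_neg fun h => hb (Sum.inl.inj h).symm, mul_zero, mul_zero, add_zero]
  · intro h
    refine Submodule.mem_span_singleton.mpr ⟨x, β.basis.ext_elem fun b => ?_⟩
    rw [smul_eq_mul]
    rcases b with w | a
    · rw [repr_mul_inl, Module.Basis.repr_self, Finsupp.single_apply]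
      by_cases hw : v = w
      · rw [if_pos (congrArg _ hw), mul_one]
      · rw [h (.inl w) (Ne.symm hw), zero_mul]
    · rw [repr_mul_inr, Module.Basis.repr_self, Finsupp.single_apply, Finsupp.single_apply,
        if_neg (by simp), mul_zero, zero_add]
      by_cases hw : v = a.tgt
      · rw [if_pos (congrArg _ hw), mul_one]
      · rw [h (.inr a) (Ne.symm hw), zero_mul]

theorem proj_ext {v : Vertex} {p q : β.Proj v} (h : ∀ b, basisTgt b = v →
    β.basis.repr (p : D) b = β.basis.repr (q : D) b) : p = q := by
  refine Subtype.ext (β.basis.ext_elem fun b => ?_)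
  by_cases hb : basisTgt b = v
  · exact h b hb
  · rw [β.mem_proj_iff.mp p.2 b hb, β.mem_proj_iff.mp q.2 b hb]

/-- The generator of the left ideal of a vertex. -/
noncomputable def idem (v : Vertex) : β.Proj v :=
  ⟨β.basis (.inl v), Ideal.mem_span_singleton_self _⟩

/-- The only path from `v` to `v` is trivial, so $e_vDe_v=\mathbb{Q}e_v$. -/
theorem basis_smul_proj {v : Vertex} (p : β.Proj v) : β.basis (.inl v) • p =
    algebraMap ℚ D (β.char v p) • β.idem v := by
  refine β.proj_ext fun b hb => ?_
  change β.basis.repr (β.basis (.inl v) * (p : D)) b =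
    β.basis.repr (algebraMap ℚ D (β.char v p) * β.basis (.inl v)) b
  rw [← Algebra.smul_def, map_smul, Finsupp.smul_apply]
  rcases b with w | a
  · obtain rfl : w = v := hb
    rw [repr_mul_inl, Module.Basis.repr_self, char_apply, mul_comm, smul_eq_mul]
  · have h : v ≠ a.src := by
      rw [← show a.tgt = v from hb]
      cases a <;> decide
    rw [repr_mul_inr, Module.Basis.repr_self, Finsupp.single_apply, Finsupp.single_apply,
      if_neg fun h' => h (Sum.inl.inj h'), if_neg (by simp), zero_mul, zero_mul, add_zero,
      smul_zero]

theorem span_idem (v : Vertex) : Submodule.span D {β.idem v} = ⊤ := by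
  refine eq_top_iff.mpr fun p _ => ?_
  obtain ⟨r, hr⟩ := Submodule.mem_span_singleton.mp p.2
  exact Submodule.mem_span_singleton.mpr ⟨r, Subtype.ext hr⟩

/-- Applying the idempotent and rescaling recovers the generator. So every proper submodule lies in
the kernel of the character; both indecomposability and the surjectivity of lifted maps rest on
this. -/
theorem eq_top_of_char_ne_zero {v : Vertex} {N : Submodule D (β.Proj v)} {p : β.Proj v}
    (hp : p ∈ N) (h : β.char v p ≠ 0) : N = ⊤ := by
  have h1 := N.smul_mem (algebraMap ℚ D (β.char v p)⁻¹) (N.smul_mem (β.basis (.inl v)) hp)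
  rw [basis_smul_proj, smul_smul, ← map_mul, inv_mul_cancel₀ h, map_one, one_smul] at h1
  rw [eq_top_iff, ← span_idem, Submodule.span_singleton_le_iff_mem]
  exact h1

theorem char_idem (v : Vertex) : β.char v (β.idem v) = 1 := by
  rw [idem, char_basis_inl, if_pos rfl]

theorem projective_proj (v : Vertex) : Module.Projective D (β.Proj v) := by
  refine Module.Projective.of_split (Submodule.subtype _)
    (LinearMap.toSpanSingleton D (β.Proj v) (β.idem v)) (LinearMap.ext fun p => ?_)
  obtain ⟨r, hr⟩ := Submodule.mem_span_singleton.mp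
    ((β.span_idem v).symm ▸ Submodule.mem_top : p ∈ Submodule.span D {β.idem v})
  subst hr
  refine Subtype.ext ?_
  change r * β.basis (.inl v) * β.basis (.inl v) = r * β.basis (.inl v)
  rw [mul_assoc, β.mul]
  simp [composite]

theorem isIndecomposable_proj (v : Vertex) : ModRep.IsIndecomposable D (β.Proj v) := by
  refine ⟨⟨β.idem v, 0, fun h => ?_⟩, fun N N' hN => ?_⟩
  · have := β.char_idem v
    rw [h] at this
    simp at this
  · obtain ⟨n, hn, n', hn', h⟩ := Submodule.mem_sup.mp
      (hN.sup_eq_top.symm ▸ Submodule.mem_top : β.idem v ∈ N ⊔ N')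
    have h1 : β.char v n + β.char v n' = 1 := by
      rw [← β.char_idem v, ← h]
      exact (map_add (β.char v) (n : D) n').symm
    by_cases h2 : β.char v n = 0
    · left
      rw [h2, zero_add] at h1
      have := β.eq_top_of_char_ne_zero hn' (by rw [h1]; exact one_ne_zero)
      rw [← inf_top_eq N, ← this, hN.inf_eq_bot]
    · right
      rw [← inf_top_eq N', ← β.eq_top_of_char_ne_zero hn h2, inf_comm, hN.inf_eq_bot]

/-- The map from the projective module of a vertex to the simple module. -/
noncomputable def topMap (v : Vertex) : β.Proj v →ₗ[D] β.Simple v where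
  toFun p := β.char v p
  map_add' p q := map_add (β.char v) (p : D) q
  map_smul' r p := map_mul (β.char v) r p

theorem topMap_surjective (v : Vertex) : Function.Surjective (β.topMap v) := by
  refine LinearMap.surjective_of_ne_zero fun h => ?_
  have h1 : β.topMap v (β.idem v) = β.gen v := β.char_idem v
  rw [h] at h1
  exact β.gen_ne_zero v h1.symm

theorem eq_of_surjective {v w : Vertex} {f : β.Proj v →ₗ[D] β.Simple w}
    (hf : Function.Surjective f) : v = w := by
  by_contra h
  obtain ⟨p, hp⟩ := hf (β.gen w)
  obtain ⟨r, rfl⟩ := Submodule.mem_span_singleton.mp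
    ((β.span_idem v).symm ▸ Submodule.mem_top : p ∈ Submodule.span D {β.idem v})
  have h1 : β.basis (.inl v) • β.idem v = β.idem v := by
    rw [basis_smul_proj, char_idem, map_one, one_smul]
  rw [← h1, map_smul, map_smul, basis_smul_simple, if_neg h, smul_zero] at hp
  exact β.gen_ne_zero w hp.symm

theorem eq_of_proj_equiv {v w : Vertex} (e : β.Proj v ≃ₗ[D] β.Proj w) : v = w :=
  β.eq_of_surjective (f := β.topMap w ∘ₗ e.toLinearMap)
    ((β.topMap_surjective w).comp e.surjective)

/-- An element `p` of the kernel is killed by all characters, since those of other vertices vanish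
on paths ending at `v`. So `p` lies in the Jacobson radical, and `p` is `p` times the generator. -/
theorem radSeries_one (v : Vertex) :
    ModRep.radSeries D (β.Proj v) 1 = LinearMap.ker (β.topMap v) := by
  refine le_antisymm ?_ fun p hp => ?_
  · change Ring.jacobson D • (⊤ : Submodule D (β.Proj v)) ≤ _
    rw [Submodule.smul_le]
    intro x hx p _
    rw [LinearMap.mem_ker, map_smul, smul_simple, β.mem_jacobson.mp hx]
    exact zero_mul (M₀ := ℚ) (β.topMap v p)
  · have h : (p : D) ∈ Ring.jacobson D := by
      refine β.mem_jacobson.mpr fun w => ?_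
      by_cases hw : w = v
      · subst hw
        exact hp
      · exact β.mem_proj_iff.mp p.2 (.inl w) hw
    have h1 : p = (p : D) • β.idem v := by
      refine Subtype.ext ?_
      obtain ⟨r, hr⟩ := Submodule.mem_span_singleton.mp p.2
      change (p : D) = (p : D) * β.basis (.inl v)
      rw [← hr, smul_eq_mul, mul_assoc, β.mul]
      simp [composite]
    rw [h1]
    exact Submodule.smul_mem_smul h Submodule.mem_top

theorem mem_radSeries_one {v : Vertex} {p : β.Proj v} :
    p ∈ ModRep.radSeries D (β.Proj v) 1 ↔ β.char v p = 0 := by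
  rw [radSeries_one]
  rfl

include β in
theorem radSeries_add_two (P : Type*) [AddCommGroup P] [Module D P] (i : ℕ) :
    ModRep.radSeries D P (i + 2) = ⊥ :=
  β.jacobson_smul_jacobson_smul _

/-- The top of the projective module of a vertex is the simple module. -/
noncomputable def topEquiv (v : Vertex) : ModRep.Top D (β.Proj v) ≃ₗ[D] β.Simple v :=
  (Submodule.quotEquivOfEq _ _ (β.radSeries_one v)).trans
    ((β.topMap v).quotKerEquivOfSurjective (β.topMap_surjective v))

/-! ### Loewy layers -/

/-- Indexes the arrows into a vertex by the simple constituents with multiplicity, so that a Loewy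
layer can be compared with a multiset. -/
theorem eq_of_count {T : Type*} [Fintype T] (f : T → Vertex) (m : Multiset Vertex)
    (h : ∀ w, Fintype.card {t // f t = w} = m.count w) :
    ∃ E : ((w : Vertex) × Fin (m.count w)) ≃ T, ∀ p, f (E p) = p.1 := by
  refine ⟨(Equiv.sigmaCongrRight fun w => (Fintype.equivFinOfCardEq (h w)).symm).trans
    (Equiv.sigmaFiberEquiv f), fun p => ?_⟩
  exact ((Fintype.equivFinOfCardEq (h p.1)).symm p.2).2

/-- The coordinates of the elements of the radical of the projective module of a vertex. -/
noncomputable def radMap (v : Vertex) {ι : Type*} (g : ι → Arrow) (χ : ι → Vertex)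
    (h : ∀ i, (g i).src = χ i) :
    ↥(ModRep.radSeries D (β.Proj v) 1) →ₗ[D] ((i : ι) → β.Simple (χ i)) where
  toFun p i := β.basis.repr (p.1 : D) (.inr (g i))
  map_add' p q := funext fun i => by
    change β.basis.repr ((p.1 : D) + (q.1 : D)) (.inr (g i)) = _
    rw [map_add]
    rfl
  map_smul' r p := funext fun i => by
    -- Radical elements have no vertex coordinates, so only the first term of the product formula
    -- survives, and `r` acts by the character of the source.
    have h0 : β.basis.repr (p.1 : D) (.inl (g i).tgt) = 0 := by
      by_cases hv : (g i).tgt = v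
      · rw [hv]
        exact β.mem_radSeries_one.mp p.2
      · exact β.mem_proj_iff.mp p.1.2 _ hv
    change β.basis.repr (r * (p.1 : D)) (.inr (g i)) =
      β.char (χ i) r * β.basis.repr (p.1 : D) (.inr (g i))
    rw [repr_mul_inr, h0, mul_zero, add_zero, ← h i, char_apply]

theorem loewyLayer_one (v : Vertex) : Nonempty (ModRep.LoewyLayer D (β.Proj v) 1 ≃ₗ[D]
    ((p : (w : Vertex) × Fin (((loewy v).getD 1 0).count w)) → β.Simple p.1)) := by
  obtain ⟨E, hE⟩ := eq_of_count (fun a : {a : Arrow // a.tgt = v} => a.1.src)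
    ((loewy v).getD 1 0) (by revert v; decide)
  let f := β.radMap v (fun p => (E p).1) (fun p => p.1) hE
  have hker : (ModRep.radSeries D (β.Proj v) 2).submoduleOf (ModRep.radSeries D (β.Proj v) 1) =
      LinearMap.ker f := by
    rw [β.radSeries_add_two]
    ext p
    rw [LinearMap.mem_ker]
    change p.1 = 0 ↔ _
    constructor
    · intro hp
      have : p = 0 := Subtype.ext hp
      rw [this, map_zero]
    · intro hp
      refine β.proj_ext fun b hb => ?_
      rw [ZeroMemClass.coe_zero, map_zero, Finsupp.zero_apply]
      rcases b with w | a
      · obtain rfl : w = v := hb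
        exact β.mem_radSeries_one.mp p.2
      · have := congrFun hp (E.symm ⟨a, hb⟩)
        change β.basis.repr (p.1 : D) (.inr (E (E.symm ⟨a, hb⟩)).1) = 0 at this
        rwa [E.apply_symm_apply] at this
  have hsurj : Function.Surjective f := by
    intro q
    let q' : ((w : Vertex) × Fin (((loewy v).getD 1 0).count w)) → ℚ := q
    let c : Arrow → ℚ := fun a => if h : a.tgt = v then q' (E.symm ⟨a, h⟩) else 0
    let x : D := ∑ a, c a • β.basis (.inr a)
    have hx : ∀ a, β.basis.repr x (.inr a) = c a := fun a => by
      simp [x, Finsupp.single_apply]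
    have hx' : ∀ w, β.basis.repr x (.inl w) = 0 := fun w => by
      simp [x]
    have hxv : x ∈ Ideal.span {β.basis (.inl v)} := by
      refine β.mem_proj_iff.mpr fun b hb => ?_
      rcases b with w | a
      · exact hx' w
      · rw [hx]
        exact dif_neg hb
    refine ⟨⟨⟨x, hxv⟩, β.mem_radSeries_one.mpr (hx' v)⟩, funext fun p => ?_⟩
    change β.basis.repr x (.inr (E p).1) = _
    rw [hx]
    have : c (E p).1 = q' p := by
      rw [← congrArg q' (E.symm_apply_apply p)]
      exact dif_pos (E p).2
    exact this
  exact ⟨(Submodule.quotEquivOfEq _ _ hker).trans (f.quotKerEquivOfSurjective hsurj)⟩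

theorem loewyLayer_zero (v : Vertex) : Nonempty (ModRep.LoewyLayer D (β.Proj v) 0 ≃ₗ[D]
    ((p : (w : Vertex) × Fin (((loewy v).getD 0 0).count w)) → β.Simple p.1)) := by
  have h0 : (loewy v).getD 0 0 = {v} := by cases v <;> rfl
  rw [h0]
  let f : ↥(ModRep.radSeries D (β.Proj v) 0) →ₗ[D]
      ((p : (w : Vertex) × Fin (({v} : Multiset Vertex).count w)) → β.Simple p.1) :=
    { toFun := fun p i => β.char i.1 (p.1 : D)
      map_add' := fun p q => funext fun i => map_add (β.char i.1) (p.1 : D) q.1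
      map_smul' := fun r p => funext fun i => map_mul (β.char i.1) r (p.1 : D) }
  have hv : ∀ p : (w : Vertex) × Fin (({v} : Multiset Vertex).count w), p.1 = v := by
    rintro ⟨w, i⟩
    by_contra h
    have : ({v} : Multiset Vertex).count w = 0 := by
      rw [Multiset.count_singleton, if_neg h]
    exact absurd (i.2.trans_eq this) (Nat.not_lt_zero _)
  have hker : (ModRep.radSeries D (β.Proj v) 1).submoduleOf (ModRep.radSeries D (β.Proj v) 0) =
      LinearMap.ker f := by
    ext p
    rw [LinearMap.mem_ker]
    refine β.mem_radSeries_one.trans ?_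
    constructor
    · intro hp
      funext i
      change β.char i.1 (p.1 : D) = 0
      rw [hv i]
      exact hp
    · intro hp
      exact congrFun hp ⟨v, ⟨0, by simp⟩⟩
  have hsurj : Function.Surjective f := by
    intro q
    let c : ℚ := q ⟨v, ⟨0, by simp⟩⟩
    obtain ⟨p, hp⟩ := β.topMap_surjective v c
    refine ⟨⟨p, Submodule.mem_top⟩, funext fun ⟨w, i⟩ => ?_⟩
    have hw : w = v := hv ⟨w, i⟩
    subst hw
    have : i = ⟨0, by simp⟩ :=
      Fin.ext (Nat.lt_one_iff.mp (i.2.trans_eq (Multiset.count_singleton_self w)))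
    rw [this]
    exact hp
  exact ⟨(Submodule.quotEquivOfEq _ _ hker).trans (f.quotKerEquivOfSurjective hsurj)⟩

theorem loewyLayer (v : Vertex) (i : ℕ) : Nonempty (ModRep.LoewyLayer D (β.Proj v) i ≃ₗ[D]
    ((p : (w : Vertex) × Fin (((loewy v).getD i 0).count w)) →
      ModRep.Top D (β.Proj p.1))) := by
  suffices h : Nonempty (ModRep.LoewyLayer D (β.Proj v) i ≃ₗ[D]
      ((p : (w : Vertex) × Fin (((loewy v).getD i 0).count w)) → β.Simple p.1)) from
    h.map fun e => e.trans (LinearEquiv.piCongrRight fun p => (β.topEquiv p.1).symm)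
  match i with
  | 0 => exact β.loewyLayer_zero v
  | 1 => exact β.loewyLayer_one v
  | i + 2 =>
    -- At most two layers are listed; beyond them `getD` returns the empty multiset, whose index
    -- type is empty.
    have h : (loewy v).getD (i + 2) 0 = 0 := by cases v <;> rfl
    rw [h]
    have h1 : Subsingleton (ModRep.LoewyLayer D (β.Proj v) (i + 2)) := by
      rw [Submodule.Quotient.subsingleton_iff, eq_top_iff]
      rintro ⟨p, hp⟩ -
      rw [β.radSeries_add_two, Submodule.mem_bot] at hp
      subst hp
      exact Submodule.zero_mem _
    have h2 : IsEmpty ((w : Vertex) × Fin ((0 : Multiset Vertex).count w)) :=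
      ⟨fun p => absurd p.2.2 (by simp)⟩
    exact ⟨0, 0, fun _ => Subsingleton.elim _ _, fun _ => Subsingleton.elim _ _⟩

end PathBasis

end TypeF4

namespace TypeF4

namespace PathBasis

variable {D : Type*} [Ring D] [Algebra ℚ D] (β : PathBasis D)

/-! ### Composition series -/

/-- Coordinates on which the algebra acts triangularly define a flag: the `i`-th term is cut out by
the vanishing of all coordinates from `i` on. Each successive quotient is one-dimensional with
character `χ i`. -/
theorem hasCompMultiplicity_of_coordinates {P T : Type*} [AddCommGroup P] [Module D P]
    [AddCommGroup T] [Module D T] {n : ℕ} (χ : Fin n → Vertex) (k : Fin n → P →+ ℚ)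
    (hk : ∀ (r : D) p j, (∀ j' > j, k j' p = 0) → k j (r • p) = β.char (χ j) r * k j p)
    (hinj : ∀ p, (∀ j, k j p = 0) → p = 0)
    (hsurj : ∀ j, ∃ p, k j p ≠ 0 ∧ ∀ j' > j, k j' p = 0) {w : Vertex} (e : T ≃ₗ[D] β.Simple w) :
    ModRep.HasCompMultiplicity D P T (Nat.card {j // χ j = w}) := by
  let F : Fin (n + 1) → Submodule D P := fun i =>
    { carrier := {p | ∀ j : Fin n, i ≤ j.castSucc → k j p = 0}
      zero_mem' := fun j _ => map_zero _
      add_mem' := fun {p q} hp hq j hj => by rw [map_add, hp j hj, hq j hj, add_zero]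
      smul_mem' := fun r p hp j hj => by
        rw [hk r p j fun j' hj' => hp j' (hj.trans (Fin.castSucc_lt_castSucc_iff.mpr hj').le),
          hp j hj, mul_zero] }
  have hF : ∀ i p, p ∈ F i ↔ ∀ j : Fin n, i ≤ j.castSucc → k j p = 0 := fun _ _ => Iff.rfl
  have hsucc : ∀ (i : Fin n) p, p ∈ F i.succ ↔ ∀ j > i, k j p = 0 := fun i p => by
    simp only [hF, Fin.succ_le_castSucc_iff, gt_iff_lt]
  have hcast : ∀ (i : Fin n) p, p ∈ F i.castSucc ↔ p ∈ F i.succ ∧ k i p = 0 := fun i p => by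
    simp only [hF, Fin.succ_le_castSucc_iff, Fin.castSucc_le_castSucc_iff]
    refine ⟨fun h => ⟨fun j hj => h j hj.le, h i le_rfl⟩, fun h j hj => ?_⟩
    rcases hj.eq_or_lt with rfl | hj
    · exact h.2
    · exact h.1 j hj
  let f : (i : Fin n) → ↥(F i.succ) →ₗ[D] β.Simple (χ i) := fun i =>
    { toFun := fun p => k i p.1
      map_add' := fun p q => map_add (k i) p.1 q.1
      map_smul' := fun r p => hk r p.1 i ((hsucc i p.1).mp p.2) }
  have hker : ∀ i, (F i.castSucc).submoduleOf (F i.succ) = LinearMap.ker (f i) := by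
    intro i
    ext p
    exact (hcast i p.1).trans ⟨fun h => h.2, fun h => ⟨p.2, h⟩⟩
  have hf : ∀ i, Function.Surjective (f i) := by
    intro i
    refine LinearMap.surjective_of_ne_zero fun h => ?_
    obtain ⟨p, hp, hp'⟩ := hsurj i
    exact hp (LinearMap.congr_fun h ⟨p, (hsucc i p).mpr hp'⟩)
  let g : (i : Fin n) → (↥(F i.succ) ⧸ (F i.castSucc).submoduleOf (F i.succ)) ≃ₗ[D]
      β.Simple (χ i) := fun i =>
    (Submodule.quotEquivOfEq _ _ (hker i)).trans ((f i).quotKerEquivOfSurjective (hf i))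
  let s : CompositionSeries (Submodule D P) :=
    { length := n
      toFun := F
      step := fun i => by
        have hle : F i.castSucc ≤ F i.succ := fun p hp => ((hcast i p).mp hp).1
        exact (covBy_iff_quot_is_simple hle).mpr (IsSimpleModule.congr (g i)) }
  refine ⟨s, ?_, ?_, ?_⟩
  · refine eq_bot_iff.mpr fun p hp => hinj p fun j => ?_
    exact hp j (Fin.zero_le _)
  · refine eq_top_iff.mpr fun p _ j hj => absurd hj (not_le.mpr (Fin.castSucc_lt_last j))
  · refine Nat.card_congr (Equiv.subtypeEquivRight fun i => ?_)
    refine ⟨fun ⟨e'⟩ => ?_, fun h => ?_⟩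
    · exact β.eq_of_simple_equiv ((g i).symm.trans (e'.trans e))
    · subst h
      exact ⟨(g i).trans e.symm⟩

/-- The paths that end at a vertex. -/
def pathsTo : Vertex → List Basis
  | .B3' => [.inr .b', .inl .B3']
  | .B3'' => [.inr .b'', .inl .B3'']
  | .F4 => [.inr .a₁, .inr .a₂, .inl .F4]
  | v => [.inl v]

theorem hasCompMultiplicity (v w : Vertex) : ModRep.HasCompMultiplicity D (β.Proj v)
    (ModRep.Top D (β.Proj w)) (cartan v w) := by
  have hcard : cartan v w = Nat.card {j // basisSrc ((pathsTo v).get j) = w} := by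
    rw [Nat.card_eq_fintype_card]
    revert v w
    decide
  have hinj : ∀ v, Function.Injective (pathsTo v).get := by decide
  have hmem : ∀ v b, basisTgt b = v → ∃ j, (pathsTo v).get j = b := by decide
  have htgt : ∀ v j, basisTgt ((pathsTo v).get j) = v := by decide
  -- The vertex has to come last: its coordinate is the only other one that enters the action on an
  -- arrow coordinate.
  have hlast : ∀ v j a, (pathsTo v).get j = .inr a → ∃ j' > j, (pathsTo v).get j' = .inl v := by
    decide
  rw [hcard]
  refine β.hasCompMultiplicity_of_coordinates _
    (fun j => ((β.basis.coord ((pathsTo v).get j)).toAddMonoidHom).comp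
      ((Ideal.span {β.basis (.inl v)}).subtype.toAddMonoidHom)) ?_ ?_ ?_ (β.topEquiv w)
  · intro r p j hj
    change β.basis.repr (r * (p : D)) ((pathsTo v).get j) =
      β.char _ r * β.basis.repr (p : D) ((pathsTo v).get j)
    have ht := htgt v j
    rcases h : (pathsTo v).get j with u | a
    · rw [repr_mul_inl]
      rfl
    · obtain ⟨j', hj', h'⟩ := hlast v j a h
      have h0 : β.basis.repr (p : D) ((pathsTo v).get j') = 0 := hj j' hj'
      rw [h] at ht
      change a.tgt = v at ht
      rw [h'] at h0
      rw [repr_mul_inr, ht, h0, mul_zero, add_zero]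
      rfl
  · intro p hp
    refine β.proj_ext fun b hb => ?_
    obtain ⟨j, rfl⟩ := hmem v b hb
    rw [ZeroMemClass.coe_zero, map_zero]
    exact hp j
  · intro j
    refine ⟨⟨β.basis ((pathsTo v).get j), β.mem_proj_iff.mpr fun b hb => ?_⟩, ?_, ?_⟩
    · rw [Module.Basis.repr_self, Finsupp.single_apply, if_neg]
      rintro rfl
      exact hb (htgt v j)
    · change β.basis.repr (β.basis ((pathsTo v).get j)) ((pathsTo v).get j) ≠ 0
      simp
    · intro j' hj'
      change β.basis.repr (β.basis ((pathsTo v).get j)) ((pathsTo v).get j') = 0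
      rw [Module.Basis.repr_self, Finsupp.single_apply, if_neg fun h => hj'.ne (hinj v h)]

/-! ### The classification of the projective indecomposable modules -/

/-- Nilpotency of $J$ gives $JN\ne N$, and since the idempotents sum to `1`, some $e_vn$ lies
outside $JN$. A rational functional `l` that vanishes on $JN$ but not at $e_vn$ yields the map
$m\mapsto l(e_vm)$. -/
theorem exists_simple_quotient (N : Type*) [AddCommGroup N] [Module D N] [Nontrivial N] :
    ∃ (v : Vertex) (h : N →ₗ[D] β.Simple v), h ≠ 0 := by
  let _ : Module ℚ N := Module.compHom N (algebraMap ℚ D)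
  obtain ⟨R, hR, hJ⟩ : ∃ R : Submodule D N, R ≠ ⊤ ∧
      ∀ x ∈ Ring.jacobson D, ∀ n : N, x • n ∈ R := by
    refine ⟨Ring.jacobson D • ⊤, fun h => ?_, fun x hx n =>
      Submodule.smul_mem_smul hx Submodule.mem_top⟩
    have h1 := β.jacobson_smul_jacobson_smul (⊤ : Submodule D N)
    rw [h, h] at h1
    exact top_ne_bot h1
  obtain ⟨n, -, hn⟩ := SetLike.exists_of_lt (lt_top_iff_ne_top.mpr hR)
  obtain ⟨v, hv⟩ : ∃ v, β.basis (.inl v) • n ∉ R := by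
    by_contra! h
    refine hn ?_
    rw [← one_smul D n, ← β.sum_vertex, Finset.sum_smul]
    exact Submodule.sum_mem _ fun v _ => h v
  obtain ⟨R', hR'⟩ : ∃ R' : Submodule ℚ N, ∀ n, n ∈ R' ↔ n ∈ R :=
    ⟨{  carrier := R
        zero_mem' := R.zero_mem
        add_mem' := R.add_mem
        smul_mem' := fun q _ hx => R.smul_mem (algebraMap ℚ D q) hx }, fun _ => Iff.rfl⟩
  obtain ⟨l, hl, hlR⟩ := Submodule.exists_le_ker_of_notMem (mt (hR' _).mp hv)
  have hmul : ∀ (r : D) (m : N), l (β.basis (.inl v) • r • m) =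
      β.char v r * l (β.basis (.inl v) • m) := by
    intro r m
    -- Modulo the radical, `e_v r` is the multiple of `e_v` by the character value of `r`; this
    -- makes the map linear over `D`.
    have h1 : β.basis (.inl v) * r - algebraMap ℚ D (β.char v r) * β.basis (.inl v) ∈
        Ring.jacobson D := by
      refine β.mem_jacobson.mpr fun w => ?_
      rw [map_sub, map_mul, map_mul, char_basis_inl, char_algebraMap]
      split
      · next h => rw [h, one_mul, mul_one, sub_self]
      · rw [zero_mul, mul_zero, sub_self]
    have h2 : l ((β.basis (.inl v) * r - algebraMap ℚ D (β.char v r) * β.basis (.inl v)) • m) = 0 :=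
      hlR ((hR' _).mpr (hJ _ h1 m))
    have h3 : (β.basis (.inl v) * r - algebraMap ℚ D (β.char v r) * β.basis (.inl v)) • m =
        β.basis (.inl v) • r • m - β.char v r • β.basis (.inl v) • m := by
      rw [sub_smul, mul_smul, mul_smul]
      rfl
    rw [h3, map_sub, sub_eq_zero] at h2
    exact h2.trans (l.map_smul _ _)
  refine ⟨v,
    { toFun := fun m => l (β.basis (.inl v) • m)
      map_add' := fun x y => by rw [smul_add, map_add]; rfl
      map_smul' := hmul }, fun h => hl ?_⟩
  exact LinearMap.congr_fun h n

/-- A nonzero map to a simple module lifts to a map `f` into its projective cover. Its image is not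
contained in the radical, so `f` is surjective. It splits, and indecomposability of `N` makes the
kernel zero. -/
theorem exists_equiv_proj (N : Type*) [AddCommGroup N] [Module D N] [Module.Projective D N]
    (hN : ModRep.IsIndecomposable D N) : ∃ v, Nonempty (N ≃ₗ[D] β.Proj v) := by
  have := hN.1
  obtain ⟨v, h, hh⟩ := β.exists_simple_quotient N
  obtain ⟨f, hf⟩ := Module.projective_lifting_property (β.topMap v) h (β.topMap_surjective v)
  have hfs : Function.Surjective f := by
    rw [← LinearMap.range_eq_top]
    obtain ⟨n, hn⟩ : ∃ n, h n ≠ 0 := by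
      by_contra! h0
      exact hh (LinearMap.ext h0)
    refine β.eq_top_of_char_ne_zero (p := f n) ⟨n, rfl⟩ ?_
    rw [← hf] at hn
    exact hn
  have := β.projective_proj v
  obtain ⟨g, hg⟩ := Module.projective_lifting_property f LinearMap.id hfs
  have hid : IsIdempotentElem (g ∘ₗ f) := LinearMap.ext fun n =>
    congrArg g (LinearMap.congr_fun hg (f n))
  rcases hN.2 _ _ (LinearMap.IsIdempotentElem.isCompl hid) with h0 | h0
  · obtain ⟨n, hn⟩ := hfs (β.idem v)
    have h1 : g (f n) = 0 := (Submodule.mem_bot D).mp (h0 ▸ LinearMap.mem_range_self (g ∘ₗ f) n)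
    have h2 : f (g (f n)) = f n := LinearMap.congr_fun hg (f n)
    rw [h1, map_zero, hn] at h2
    have h3 := β.char_idem v
    rw [← h2] at h3
    simp at h3
  · refine ⟨v, ⟨LinearEquiv.ofBijective f ⟨?_, hfs⟩⟩⟩
    rw [← LinearMap.ker_eq_bot, eq_bot_iff, ← h0]
    intro n hn
    rw [LinearMap.mem_ker, LinearMap.comp_apply, LinearMap.mem_ker.mp hn, map_zero]

theorem projective_indecomposable_modules {ε : Vertex → D} (hε : ε = fun v => β.basis (.inl v)) :
    (∀ v, Module.Projective D (ModRep.LeftIdeal (ε v)) ∧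
        ModRep.IsIndecomposable D (ModRep.LeftIdeal (ε v))) ∧
    (∀ v w, Nonempty (ModRep.LeftIdeal (ε v) ≃ₗ[D] ModRep.LeftIdeal (ε w)) → v = w) ∧
    (∀ (N : Type*) [AddCommGroup N] [Module D N], Module.Finite D N → Module.Projective D N →
        ModRep.IsIndecomposable D N → ∃ v, Nonempty (N ≃ₗ[D] ModRep.LeftIdeal (ε v))) ∧
    (∀ v, IsSimpleModule D (ModRep.Top D (ModRep.LeftIdeal (ε v)))) ∧
    (∀ v w, Nonempty (ModRep.Top D (ModRep.LeftIdeal (ε v)) ≃ₗ[D]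
        ModRep.Top D (ModRep.LeftIdeal (ε w))) → v = w) ∧
    (∀ v (i : ℕ), Nonempty (ModRep.LoewyLayer D (ModRep.LeftIdeal (ε v)) i ≃ₗ[D]
        ((p : (w : Vertex) × Fin (((loewy v).getD i 0).count w)) →
          ModRep.Top D (ModRep.LeftIdeal (ε p.1))))) ∧
      (∀ v w, ModRep.HasCompMultiplicity D (ModRep.LeftIdeal (ε v))
        (ModRep.Top D (ModRep.LeftIdeal (ε w))) (cartan v w)) := by
  subst hε
  refine ⟨fun v => ⟨β.projective_proj v, β.isIndecomposable_proj v⟩,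
    fun v w ⟨e⟩ => β.eq_of_proj_equiv e, fun N _ _ _ _ hN => β.exists_equiv_proj N hN,
    fun v => IsSimpleModule.congr (β.topEquiv v),
    fun v w ⟨e⟩ => β.eq_of_simple_equiv ((β.topEquiv v).symm.trans (e.trans (β.topEquiv w))),
    β.loewyLayer, β.hasCompMultiplicity⟩

end PathBasis

/-- The basis of the image of the path algebra that consists of the images of the paths. -/
noncomputable def PathBasis.ofAlgEquiv {D : Type*} [Ring D] [Algebra ℚ D]
    (φ : PathAlg.PathAlgebra ℚ Vertex ≃ₐ[ℚ] D) : PathBasis D where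
  basis := pathBasis.map φ.toLinearEquiv
  mul b b' := by
    change φ (pathBasis b) * φ (pathBasis b') = _
    rw [← map_mul, pathBasis_mul]
    cases composite b b' with
    | none => exact map_zero φ
    | some c => rfl
  sum_vertex := by
    change ∑ v, φ (pathBasis (.inl v)) = 1
    rw [← map_sum, sum_pathBasis_vertex, map_one]

end TypeF4

open TypeF4 in
theorem mainTheorem5 {W : Type*} [Group W] (cs : CoxeterSystem CoxeterMatrix.F₄ W) :
    -- the group is finite and its longest element is central
    Finite W ∧
    (∀ w : W, Commute (Descent.longest cs Finset.univ) w) ∧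
    -- the vertices label the classes of subsets of the generators, with the stated types
    (∀ v w : TypeF4.Vertex, Descent.cls cs (TypeF4.rep v) = Descent.cls cs (TypeF4.rep w) → v = w) ∧
    (∀ J : Finset (Fin 4), ∃ v : TypeF4.Vertex, Descent.cls cs J = Descent.cls cs (TypeF4.rep v)) ∧
    (∀ v : TypeF4.Vertex, CoxType.HasType CoxeterMatrix.F₄ (TypeF4.rep v) (TypeF4.type v).2) ∧
    -- the descent algebra is a subalgebra `D`, isomorphic to the path algebra of the quiver
    ∃ (D : Subalgebra ℚ (MonoidAlgebra ℚ W))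
      (φ : PathAlg.PathAlgebra ℚ TypeF4.Vertex ≃ₐ[ℚ] D),
      Subalgebra.toSubmodule D = Descent.descentSpace cs ∧
      (∀ v : TypeF4.Vertex, (φ (PathAlg.PathAlgebra.vertex ℚ v) : MonoidAlgebra ℚ W) =
        Descent.eClass cs (TypeF4.rep v)) ∧
      (∀ (v w : TypeF4.Vertex) (α : v ⟶ w), (φ (PathAlg.PathAlgebra.arrow ℚ α) : MonoidAlgebra ℚ W) =
        Descent.DeltaStreet cs (TypeF4.edgePath α)) ∧
      -- `P v` is the left `D`-module generated by the idempotent of `v`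
      let P : TypeF4.Vertex → Type _ := fun v =>
        ModRep.LeftIdeal (φ (PathAlg.PathAlgebra.vertex ℚ v))
      -- the modules `P v` are the projective indecomposable modules
      (∀ v, Module.Projective D (P v) ∧ ModRep.IsIndecomposable D (P v)) ∧
      (∀ v w, Nonempty (P v ≃ₗ[D] P w) → v = w) ∧
      (∀ (N : Type*) [AddCommGroup N] [Module D N], Module.Finite D N → Module.Projective D N →
        ModRep.IsIndecomposable D N → ∃ v, Nonempty (N ≃ₗ[D] P v)) ∧
      -- their tops are simple and pairwise not isomorphic
      (∀ v, IsSimpleModule D (ModRep.Top D (P v))) ∧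
      (∀ v w, Nonempty (ModRep.Top D (P v) ≃ₗ[D] ModRep.Top D (P w)) → v = w) ∧
      -- their Loewy layers are as listed
      (∀ v (i : ℕ), Nonempty (ModRep.LoewyLayer D (P v) i ≃ₗ[D]
        ((p : (w : TypeF4.Vertex) × Fin (((TypeF4.loewy v).getD i 0).count w)) →
          ModRep.Top D (P p.1)))) ∧
      -- and the Cartan matrix is as listed
      (∀ v w, ModRep.HasCompMultiplicity D (P v) (ModRep.Top D (P w)) (TypeF4.cartan v w)) := by
  have := finite_group cs
  have := Fintype.ofFinite W
  refine ⟨inferInstance, longest_univ_commute cs, fun v w h => vertex_eq_of_cls_eq cs h,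
    exists_vertex_cls_eq cs, hasType_rep, (pathHom cs).range,
    AlgEquiv.ofInjective (pathHom cs) (pathHom_injective cs), toSubmodule_range_pathHom cs,
    fun v => ?_, fun v w (α : Edge v w) => ?_, ?_⟩
  · rw [eClass_rep, ← pathHom_pathBasis, pathBasis_apply]
    rfl
  · have h : ∀ a : Arrow, pathHom cs (PathAlg.PathAlgebra.arrow ℚ a.edge) =
        Descent.DeltaStreet cs (edgePath a.edge) := fun a => by
      rw [DeltaStreet_arrow, ← pathHom_pathBasis, pathBasis_apply]
      rfl
    cases α with
    | a₁ => exact h .a₁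
    | a₂ => exact h .a₂
    | b' => exact h .b'
    | b'' => exact h .b''
  · exact (PathBasis.ofAlgEquiv (AlgEquiv.ofInjective (pathHom cs)
      (pathHom_injective cs))).projective_indecomposable_modules (funext fun v =>
        congrArg _ (pathBasis_apply (.inl v)).symm)
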